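/- **Conventions.** $\mathbb{N}=\{1,2,\dots\}$, $\mathbb{Z}^+=\{0,1,2,\dots\}$, $\Sigma=\{0,1\}$. A function $f:\mathbb{Z}^+\to\mathbb{N}$ is *polynomially bounded* if some deterministic polynomial-time Turing machine outputs $1^{f(n)}$ on input $1^n$. Quantum circuits are composed of gates from a fixed finite set of unitary gates that includes the Hadamard, $T$ and CNOT gates and in which the inverse of every gate is exactly implementable by a series of gates of the set acting on the same qubits. A family $\{Q_x\}_{x\in\Sigma^*}$ of circuits is *polynomial-time uniformly generated* if a deterministic polynomial-time Turing machine outputs a description of $Q_x$ on every input $x\in\Sigma^*$. The one-clean-qubit computation induced by a circuit $Q$ on $w\ge 1$ qubits, one of which is designated as the output qubit, applies $Q$ to the state $|0\rangle\langle 0|\otimes(I/2)^{\otimes(w-1)}$ and measures the output qubit in the computational basis; it accepts if the outcome is $|0\rangle$. For $c,s:\mathbb{Z}^+\to[0,1]$, a promise problem $A=(A_{\mathrm{yes}},A_{\mathrm{no}})$ over $\Sigma$ is in $\mathrm{Q}_{[1]}\mathrm{P}(c,s)$ if there are a polynomial-time uniformly generated family $\{Q_x\}_{x\in\Sigma^*}$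 and a polynomially bounded $w:\mathbb{Z}^+\to\mathbb{N}$ such that each $Q_x$ acts over $w(|x|)$ qubits and the one-clean-qubit computation induced by $Q_x$ accepts with probability at least $c(|x|)$ if $x\in A_{\mathrm{yes}}$, and with probability at most $s(|x|)$ if $x\in A_{\mathrm{no}}$. The problem $A$ is in $\mathrm{SBQ}_{[1]}\mathrm{P}$ if it is in $\mathrm{Q}_{[1]}\mathrm{P}(2^{-r},2^{-r-1})$ for some polynomially bounded $r:\mathbb{Z}^+\to\mathbb{N}$. **Theorem.** Let $p:\mathbb{Z}^+\to\mathbb{N}$ be polynomially bounded. Then for every promise problem $A\in\mathrm{SBQ}_{[1]}\mathrm{P}$ there is a polynomially bounded $q:\mathbb{Z}^+\to\mathbb{N}$ such that $$A\in\mathrm{Q}_{[1]}\mathrm{P}\bigl(2^{-q}(1-2^{-p}),\ 2^{-q}\cdot 2^{-p}\bigr).$$ -/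

import Mathlib

namespace CleanQubit

/-! ### Gates and circuits -/

/-- Index set of the standard basis of the state space of `k` qubits. -/
abbrev Bits (k : ℕ) : Type := Fin k → Bool

/-- The Hadamard operator, as an operator on one qubit. -/
noncomputable def hGate : Matrix (Bits 1) (Bits 1) ℂ :=
  fun i j => (if i 0 && j 0 then -1 else 1) / ((Real.sqrt 2 : ℝ) : ℂ)

/-- The `T` operator `diag (1, exp (i π / 4))`, as an operator on one qubit. -/
noncomputable def tGate : Matrix (Bits 1) (Bits 1) ℂ :=
  Matrix.diagonal fun i =>
    if i 0 then Complex.exp (Complex.I * ((Real.pi : ℝ) : ℂ) / 4) else 1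

/-- The controlled-NOT operator `|a, b⟩ ↦ |a, b ⊕ a⟩` on two qubits. -/
def cnot : Matrix (Bits 2) (Bits 2) ℂ :=
  fun i j => if i 0 = j 0 ∧ i 1 = xor (j 1) (j 0) then 1 else 0

/-- A finite set of quantum gates: the `g`-th gate is the unitary operator `(gate g).2`
on `(gate g).1` qubits. -/
structure GateSet where
  size : ℕ
  gate : Fin size → Σ k : ℕ, Matrix (Bits k) (Bits k) ℂ
  unitary : ∀ g, (gate g).2 ∈ Matrix.unitaryGroup (Bits (gate g).1) ℂ

/-- The number of qubits on which the `g`-th gate acts. -/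
abbrev GateSet.arity (G : GateSet) (g : Fin G.size) : ℕ := (G.gate g).1

/-- A gate of `G` together with the designation of the distinct qubits, among `w` qubits,
to which it is applied. -/
structure PlacedGate (G : GateSet) (w : ℕ) where
  idx : Fin G.size
  wires : Fin (G.arity idx) ↪ Fin w

/-- The operator on `w` qubits induced by a placed gate: the gate on the designated qubits,
tensored with the identity on all the other qubits. -/
def PlacedGate.toMatrix {G : GateSet} {w : ℕ} (P : PlacedGate G w) :
    Matrix (Bits w) (Bits w) ℂ :=
  fun i j =>
    if ∀ q, q ∉ Set.range P.wires → i q = j q then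
      (G.gate P.idx).2 (fun a => i (P.wires a)) (fun a => j (P.wires a))
    else 0

/-- The operator induced by a series of placed gates, the head of the list being applied first. -/
def opOf {G : GateSet} {w : ℕ} (L : List (PlacedGate G w)) : Matrix (Bits w) (Bits w) ℂ :=
  L.foldl (fun M P => P.toMatrix * M) 1

/-- The gate set includes the Hadamard, `T` and controlled-NOT gates. -/
def GateSet.ContainsHTCnot (G : GateSet) : Prop :=
  (∃ g, G.gate g = ⟨1, hGate⟩) ∧ (∃ g, G.gate g = ⟨1, tGate⟩) ∧ ∃ g, G.gate g = ⟨2, cnot⟩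

/-- The inverse of each gate is exactly implementable by a series of gates of the gate set
applied to the same qubits. -/
def GateSet.InverseClosed (G : GateSet) : Prop :=
  ∀ g, ∃ L : List (PlacedGate G (G.arity g)), opOf L = (G.gate g).2.conjTranspose

/-- A quantum circuit over the gate set `G`, with its designated output qubit. -/
structure Circuit (G : GateSet) where
  width : ℕ
  out : Fin width
  gates : List (PlacedGate G width)

/-- Self-delimiting unary code `1ⁿ0` of a natural number. -/
def unaryCode (n : ℕ) : List Bool := List.replicate n true ++ [false]

/-- Description of a placed gate: the index of the gate, then the qubits it is applied to. -/
def PlacedGate.encode {G : GateSet} {w : ℕ} (P : PlacedGate G w) : List Bool :=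
  unaryCode P.idx ++ (List.ofFn fun a => unaryCode (P.wires a)).flatten

/-- Description of a circuit: the number of qubits, the output qubit, and the series of gates. -/
def Circuit.encode {G : GateSet} (C : Circuit G) : List Bool :=
  unaryCode C.width ++ unaryCode C.out ++ (C.gates.map PlacedGate.encode).flatten

/-! ### Computation with `k` clean qubits -/

/-- The initial state `(|0⟩⟨0|)^{⊗ k} ⊗ (I/2)^{⊗ (w - k)}`, a tensor product of `w` diagonal
one-qubit density operators. -/
noncomputable def initState (w k : ℕ) : Matrix (Bits w) (Bits w) ℂ :=
  Matrix.diagonal fun i =>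
    ∏ q : Fin w, if (q : ℕ) < k then (if i q then 0 else 1) else (1 / 2 : ℂ)

/-- The projection onto the states in which qubit `o` is `|0⟩`. -/
def zeroProj {w : ℕ} (o : Fin w) : Matrix (Bits w) (Bits w) ℂ :=
  Matrix.diagonal fun i => if i o then 0 else 1

/-- The acceptance probability of the `k`-clean-qubit computation induced by `C`: the probability
of the outcome `|0⟩` when the output qubit of `Q ρ Q†` is measured. -/
noncomputable def Circuit.accProb {G : GateSet} (C : Circuit G) (k : ℕ) : ℝ :=
  (Matrix.trace (zeroProj C.out *
    (opOf C.gates * initState C.width k * (opOf C.gates).conjTranspose))).re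

/-! ### Complexity classes -/

/-- `f` is polynomially bounded: a deterministic polynomial-time Turing machine outputs `1^{f n}`
on input `1ⁿ`. -/
def PolyBounded (f : ℕ → ℕ+) : Prop :=
  Nonempty (Turing.TM2ComputableInPolyTime Computability.unaryEncodeNat
    (fun m : ℕ+ => Computability.unaryEncodeNat (m : ℕ)) f)

/-- A deterministic polynomial-time Turing machine outputs, on every input string `x`,
the description of `Q x`. -/
def PolyTimeUniform {G : GateSet} (Q : List Bool → Circuit G) : Prop :=
  Nonempty (Turing.TM2ComputableInPolyTime (id : List Bool → List Bool) Circuit.encode Q)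

/-- A promise problem over the binary alphabet. -/
structure PromiseProblem where
  yes : Set (List Bool)
  no : Set (List Bool)
  disjoint : Disjoint yes no

/-- The class `Q[f]P(c, s)` over the gate set `G`. It is defined for all `c` and `s`; one is
interested in `c > s`. -/
def QP (G : GateSet) (f : ℕ → ℕ+) (c s : ℕ → ℝ) : Set PromiseProblem :=
  {A | ∃ Q : List Bool → Circuit G, PolyTimeUniform Q ∧
    (∃ w : ℕ → ℕ+, PolyBounded w ∧ (∀ n, f n ≤ w n) ∧ ∀ x, (Q x).width = w x.length) ∧
    (∀ x ∈ A.yes, c x.length ≤ (Q x).accProb (f x.length)) ∧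
    (∀ x ∈ A.no, (Q x).accProb (f x.length) ≤ s x.length)}

/-- The class `Q[1]P(c, s)`. -/
def QoneP (G : GateSet) (c s : ℕ → ℝ) : Set PromiseProblem := QP G (fun _ => 1) c s

/-- The function `n ↦ 2^{-p n}`. -/
noncomputable def twoPowNeg (p : ℕ → ℕ+) (n : ℕ) : ℝ := (2 : ℝ) ^ (-((p n : ℕ) : ℤ))

/-- The class `SBQ[1]P`: the union of `Q[1]P(2^{-p}, 2^{-p-1})` over all polynomially bounded
functions `p`. -/
def SBQoneP (G : GateSet) : Set PromiseProblem :=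
  {A | ∃ p : ℕ → ℕ+, PolyBounded p ∧
    A ∈ QoneP G (twoPowNeg p) (twoPowNeg fun n => p n + 1)}

end CleanQubit

/-! Let $a$ be the acceptance probability of the given circuit. It suffices to combine $N$ copies of
it into a one-clean-qubit circuit whose acceptance probability lies between $(a/2)^N$ and $2(a/2)^N$
(`accProb_circuit_bounds`). Take $N=p+1$ and $q=(r+1)(p+1)$: if $a\ge 2^{-r}$ the new probability is
at least $2^{-q}$, and if $a\le 2^{-r-1}$ it is at most $2\cdot 2^{-(r+2)(p+1)}=2^{-q}2^{-p}$.

The copies act on $N$ registers in the maximally mixed state. Let $S$ project onto the states in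
which the first qubit of every register is $|1\rangle$, and let $R$ project onto acceptance in every
register, pulled back to the time before the circuits are applied; the circuits are conjugated by
negations so that $|1\rangle$ plays the role of $|0\rangle$. Both are tensor powers, so the
normalised trace of $SR$ is an $N$-th power; its base is $a/2$, because the first qubit has the
right value with probability $1/2$.

The clean qubit is negated conditionally on $S$, then on $R$, then on $S$ again, with powers of $T$
in between and a Hadamard gate at either end (`amplifier`). The phases are chosen so that in the
$|0\rangle\to|0\rangle$ block of the product the terms $1$, $S$, $R$ and $SR$ cancel, and
$i\sqrt2\,RS-i(\sqrt2+1)SRS$ is left (`zeroProj_amplifier`). Its squared norm is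
$2\,\mathrm{tr}(SR)-\mathrm{tr}(SRSR)$ up to normalisation (`trace_amplifier`), and
$0\le\mathrm{tr}(SRSR)\le\mathrm{tr}(SR)$ (`trace_bounds`), whence the factor $2$ between the
bounds.

No clean ancilla is available for the conditional negations. They are realised by a ladder of
Toffoli gates on ancillas in an arbitrary state; the ladder is run twice, so that the unknown values
cancel and the ancillas are restored (`chainFun_link`, `opOf_flipIf`). Toffoli gates come from
Hadamard, $T$ and CNOT (`opOf_toffoli`).

Uniformity requires an actual Turing machine. A small language of programs on stacks of bits, with
calls to given machines, is compiled to `FinTM2` with step counts (`nonempty_computable`). One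
program in it writes the description of the combined circuit in polynomial time
(`PolyTimeUniform.combine`), and another computes $q$ and the new width (`PolyBounded.add_mul`). -/

namespace CleanQubit

open Turing StateTransition

/-! ### Structured programs on stacks of bits -/

/-- From configuration `c` the machine `M` reaches `c'` in at most `t` steps. -/
def ReachesIn {σ : Type*} (f : σ → Option σ) (t : ℕ) (c c' : σ) : Prop :=
  ∃ n ≤ t, (flip bind f)^[n] (some c) = some c'

namespace ReachesIn

variable {σ : Type*} {f : σ → Option σ} {t u : ℕ} {a b c : σ}

theorem refl (t : ℕ) (a : σ) : ReachesIn f t a a := ⟨0, Nat.zero_le _, rfl⟩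

theorem trans (h₁ : ReachesIn f t a b) (h₂ : ReachesIn f u b c) : ReachesIn f (t + u) a c := by
  obtain ⟨n, hn, h⟩ := h₁
  obtain ⟨m, hm, h'⟩ := h₂
  exact ⟨m + n, by omega, by rw [Function.iterate_add_apply, h, h']⟩

theorem mono (h : ReachesIn f t a b) (htu : t ≤ u) : ReachesIn f u a b := by
  obtain ⟨n, hn, h⟩ := h
  exact ⟨n, hn.trans htu, h⟩

theorem single (h : f a = some b) : ReachesIn f 1 a b := ⟨1, le_rfl, h⟩

theorem head (h : f a = some b) (h₂ : ReachesIn f t b c) : ReachesIn f (t + 1) a c := by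
  rw [Nat.add_comm]
  exact (single h).trans h₂

end ReachesIn

/-- A machine used as a subroutine: on the input `l` it outputs `fn l` in time `cost l`. -/
structure Subroutine where
  tm : FinTM2
  inp : Bool → tm.Γ tm.k₀
  outp : tm.Γ tm.k₁ → Bool
  fn : List Bool → List Bool
  cost : List Bool → ℕ
  run : ∀ l, ∃ o, o.map outp = fn l ∧
    ReachesIn tm.step (cost l) (initList tm (l.map inp)) (haltList tm o)

/-- Structured programs on a family of stacks of bits indexed by `K`, with subroutines indexed
by `C`. -/
inductive Prog (K C : Type) : Type
  | skip : Prog K C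
  | push : K → Bool → Prog K C → Prog K C
  | seq : Prog K C → Prog K C → Prog K C
  | pop : K → Prog K C → Prog K C → Prog K C → Prog K C
  | loop : K → Bool → Prog K C → Prog K C → Prog K C
  | call : C → K → K → Prog K C

namespace Prog

set_option linter.unusedSectionVars false

variable {K C : Type} [DecidableEq K] [DecidableEq C] (sub : C → Subroutine)

/-- The effect of a loop which pops the bits of `l` off the stack `k`. -/
def loopDen (k : K) (s : Bool) (f g : (K → List Bool) → K → List Bool) :
    List Bool → (K → List Bool) → K → List Bool
  | [], S => Function.update S k []
  | false :: l, S =>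
    if s then Function.update S k l else loopDen k s f g l (f (Function.update S k l))
  | true :: l, S => loopDen k s f g l (g (Function.update S k l))

/-- The number of steps of a loop. -/
def loopCost (k : K) (s : Bool) (f g : (K → List Bool) → K → List Bool)
    (cf cg : (K → List Bool) → ℕ) : List Bool → (K → List Bool) → ℕ
  | [], _ => 1
  | false :: l, S =>
    if s then 1 else 1 + cf (Function.update S k l) +
      loopCost k s f g cf cg l (f (Function.update S k l))
  | true :: l, S =>
    1 + cg (Function.update S k l) + loopCost k s f g cf cg l (g (Function.update S k l))

/-- The effect of a program on the stacks. `pop k p q r` pops a bit off stack `k` and continues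
with `p` if there was none, `q` if it was `false`, and `r` if it was `true`. `loop k s q r` does
so repeatedly until the stack is empty or, if `s` holds, a bit `false` has been popped.
`call c k k'` moves the contents of stack `k` to the input of subroutine `c`, and its output to
`k'`, reversing both. -/
def den : Prog K C → (K → List Bool) → K → List Bool
  | skip, S => S
  | push k a p, S => den p (Function.update S k (a :: S k))
  | seq p q, S => den q (den p S)
  | pop k p q r, S =>
    match S k with
    | [] => den p S
    | false :: l => den q (Function.update S k l)
    | true :: l => den r (Function.update S k l)
  | loop k s q r, S => loopDen k s (den q) (den r) (S k) S
  | call c k k', S =>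
    Function.update (Function.update S k []) k'
      (((sub c).fn (S k).reverse).reverse ++ Function.update S k [] k')

/-- A bound on the number of steps of a program. -/
def cost : Prog K C → (K → List Bool) → ℕ
  | skip, _ => 0
  | push k a p, S => 1 + cost p (Function.update S k (a :: S k))
  | seq p q, S => cost p S + cost q (den sub p S)
  | pop k p q r, S =>
    match S k with
    | [] => 1 + cost p S
    | false :: l => 1 + cost q (Function.update S k l)
    | true :: l => 1 + cost r (Function.update S k l)
  | loop k s q r, S => loopCost k s (den sub q) (den sub r) (cost q) (cost r) (S k) S
  | call c k _, S =>
    (S k).length + 1 + (sub c).cost (S k).reverse + ((sub c).fn (S k).reverse).length + 1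

/-- The bodies of loops leave the stack that controls the loop unchanged. -/
def WF : Prog K C → Prop
  | skip => True
  | push _ _ p => WF p
  | seq p q => WF p ∧ WF q
  | pop _ p q r => WF p ∧ WF q ∧ WF r
  | loop k _ q r => WF q ∧ WF r ∧ ∀ S, den sub q S k = S k ∧ den sub r S k = S k
  | call _ _ _ => True

/-- The labels of the machine code of a program. -/
def Lab : Prog K C → Type
  | skip => Unit
  | push _ _ p => Unit ⊕ Lab p
  | seq p q => Lab p ⊕ Lab q
  | pop _ p q r => Unit ⊕ Lab p ⊕ Lab q ⊕ Lab r
  | loop _ _ q r => Unit ⊕ Lab q ⊕ Lab r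
  | call c _ _ => Bool ⊕ (sub c).tm.Λ

/-- The first label of the machine code of a program, or the exit label if there is no code. -/
def entry {Λ : Type} : (p : Prog K C) → (Lab sub p → Λ) → Λ → Λ
  | skip, _, exit => exit
  | push _ _ _, emb, _ => emb (.inl ())
  | seq p q, emb, exit => entry p (fun l => emb (.inl l)) (entry q (fun l => emb (.inr l)) exit)
  | pop _ _ _ _, emb, _ => emb (.inl ())
  | loop _ _ _ _, emb, _ => emb (.inl ())
  | call _ _ _, emb, _ => emb (.inl false)

noncomputable instance fintypeLab : (p : Prog K C) → Fintype (Lab sub p)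
  | skip => inferInstanceAs (Fintype Unit)
  | push _ _ p => by
    have := fintypeLab p
    exact inferInstanceAs (Fintype (Unit ⊕ Lab sub p))
  | seq p q => by
    have := fintypeLab p
    have := fintypeLab q
    exact inferInstanceAs (Fintype (Lab sub p ⊕ Lab sub q))
  | pop _ p q r => by
    have := fintypeLab p
    have := fintypeLab q
    have := fintypeLab r
    exact inferInstanceAs (Fintype (Unit ⊕ Lab sub p ⊕ Lab sub q ⊕ Lab sub r))
  | loop _ _ q r => by
    have := fintypeLab q
    have := fintypeLab r
    exact inferInstanceAs (Fintype (Unit ⊕ Lab sub q ⊕ Lab sub r))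
  | call c _ _ => by
    have := (sub c).tm.ΛFin
    exact inferInstanceAs (Fintype (Bool ⊕ (sub c).tm.Λ))

/-- Stacks of the machine: the stacks of the program and those of the subroutines. -/
abbrev Stk (K : Type) (sub : C → Subroutine) : Type := K ⊕ Σ c, (sub c).tm.K

/-- Stack alphabets. -/
abbrev Alph (K : Type) (sub : C → Subroutine) : Stk K sub → Type
  | .inl _ => Bool
  | .inr x => (sub x.1).tm.Γ x.2

/-- Internal state: the bit popped last and the internal states of the subroutines. -/
abbrev Reg (sub : C → Subroutine) : Type := Option Bool × ∀ c, (sub c).tm.σ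

/-- The initial internal states of the subroutines. -/
abbrev regInit (sub : C → Subroutine) : ∀ c, (sub c).tm.σ := fun c => (sub c).tm.initialState

/-- Translation of the statements of a subroutine. -/
def trans {Λ : Type} (c : C) (emb : (sub c).tm.Λ → Λ) (exit : Λ) :
    TM2.Stmt (sub c).tm.Γ (sub c).tm.Λ (sub c).tm.σ → TM2.Stmt (Alph K sub) Λ (Reg sub)
  | .push k f q => TM2.Stmt.push (.inr ⟨c, k⟩) (fun v => f (v.2 c)) (trans c emb exit q)
  | .peek k f q => TM2.Stmt.peek (.inr ⟨c, k⟩)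
      (fun v a => (v.1, Function.update v.2 c (f (v.2 c) a))) (trans c emb exit q)
  | .pop k f q => TM2.Stmt.pop (.inr ⟨c, k⟩)
      (fun v a => (v.1, Function.update v.2 c (f (v.2 c) a))) (trans c emb exit q)
  | .load f q => TM2.Stmt.load (fun v => (v.1, Function.update v.2 c (f (v.2 c)))) (trans c emb exit q)
  | .branch f q r => TM2.Stmt.branch (fun v => f (v.2 c)) (trans c emb exit q) (trans c emb exit r)
  | .goto f => TM2.Stmt.goto fun v => emb (f (v.2 c))
  | .halt => TM2.Stmt.goto fun _ => exit

/-- The machine code of a program. -/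
def code {Λ : Type} : (p : Prog K C) → (emb : Lab sub p → Λ) → (exit : Λ) →
    Lab sub p → TM2.Stmt (Alph K sub) Λ (Reg sub)
  | .skip, _, exit, _ => TM2.Stmt.goto fun _ => exit
  | .push k a p, emb, exit, l =>
    match l with
    | .inl _ => TM2.Stmt.push (.inl k) (fun _ => a)
        (TM2.Stmt.goto fun _ => entry sub p (fun l => emb (.inr l)) exit)
    | .inr l => code p (fun l => emb (.inr l)) exit l
  | .seq p q, emb, exit, l =>
    match l with
    | .inl l => code p (fun l => emb (.inl l)) (entry sub q (fun l => emb (.inr l)) exit) l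
    | .inr l => code q (fun l => emb (.inr l)) exit l
  | .pop k p q r, emb, exit, l =>
    match l with
    | .inl _ => TM2.Stmt.pop (.inl k) (fun v a => (a, v.2))
        (TM2.Stmt.goto fun v => match v.1 with
          | none => entry sub p (fun l => emb (.inr (.inl l))) exit
          | some false => entry sub q (fun l => emb (.inr (.inr (.inl l)))) exit
          | some true => entry sub r (fun l => emb (.inr (.inr (.inr l)))) exit)
    | .inr (.inl l) => code p (fun l => emb (.inr (.inl l))) exit l
    | .inr (.inr (.inl l)) => code q (fun l => emb (.inr (.inr (.inl l)))) exit l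
    | .inr (.inr (.inr l)) => code r (fun l => emb (.inr (.inr (.inr l)))) exit l
  | .loop k s q r, emb, exit, l =>
    match l with
    | .inl _ => TM2.Stmt.pop (.inl k) (fun v a => (a, v.2))
        (TM2.Stmt.goto fun v => match v.1 with
          | none => exit
          | some false =>
            if s then exit else entry sub q (fun l => emb (.inr (.inl l))) (emb (.inl ()))
          | some true => entry sub r (fun l => emb (.inr (.inr l))) (emb (.inl ())))
    | .inr (.inl l) => code q (fun l => emb (.inr (.inl l))) (emb (.inl ())) l
    | .inr (.inr l) => code r (fun l => emb (.inr (.inr l))) (emb (.inl ())) l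
  | .call c k k', emb, exit, l =>
    match l with
    | .inl false => TM2.Stmt.pop (.inl k) (fun v a => (a, v.2))
        (TM2.Stmt.branch (fun v => v.1.isSome)
          (TM2.Stmt.push (.inr ⟨c, (sub c).tm.k₀⟩) (fun v => (sub c).inp (v.1.getD false))
            (TM2.Stmt.goto fun _ => emb (.inl false)))
          (TM2.Stmt.goto fun _ => emb (.inr (sub c).tm.main)))
    | .inl true => TM2.Stmt.pop (.inr ⟨c, (sub c).tm.k₁⟩) (fun v a => (a.map (sub c).outp, v.2))
        (TM2.Stmt.branch (fun v => v.1.isSome)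
          (TM2.Stmt.push (.inl k') (fun v => v.1.getD false) (TM2.Stmt.goto fun _ => emb (.inl true)))
          (TM2.Stmt.goto fun _ => exit))
    | .inr l => trans sub c (fun l => emb (.inr l)) (emb (.inl true)) ((sub c).tm.m l)

instance decidableEqStk : DecidableEq (Stk K sub) := inferInstance

/-- The stacks of the machine when all subroutines but `c` are inactive. -/
def stkSub (S : K → List Bool) (c : C) (T : ∀ k, List ((sub c).tm.Γ k)) :
    ∀ k, List (Alph K sub k)
  | .inl k => S k
  | .inr ⟨c', k⟩ => if h : c' = c then by subst h; exact T k else []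

/-- The stacks of the machine when all subroutines are inactive. -/
def stk (S : K → List Bool) : ∀ k, List (Alph K sub k)
  | .inl k => S k
  | .inr _ => []

theorem stkSub_nil (S : K → List Bool) (c : C) : stkSub sub S c (fun _ => []) = stk sub S := by
  funext k
  rcases k with k | ⟨c', k⟩
  · rfl
  · by_cases h : c' = c
    · subst h
      simp [stkSub, stk]
    · simp [stkSub, stk, h]

theorem update_stk (S : K → List Bool) (k : K) (l : List Bool) :
    Function.update (stk sub S) (.inl k) l = stk sub (Function.update S k l) := by
  funext x
  rcases x with x | x
  · by_cases h : x = k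
    · subst h
      simp [stk]
    · rw [Function.update_of_ne (by simpa using h)]
      simp [stk, h]
  · rfl

theorem update_stkSub_inl (S : K → List Bool) (c : C) (T : ∀ k, List ((sub c).tm.Γ k)) (k : K)
    (l : List Bool) :
    Function.update (stkSub sub S c T) (.inl k) l = stkSub sub (Function.update S k l) c T := by
  funext x
  rcases x with x | ⟨c', x⟩
  · by_cases h : x = k
    · subst h
      simp [stkSub]
    · rw [Function.update_of_ne (by simpa using h)]
      simp [stkSub, h]
  · rfl

theorem update_stkSub_inr (S : K → List Bool) (c : C) (T : ∀ k, List ((sub c).tm.Γ k))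
    (k : (sub c).tm.K) (l : List ((sub c).tm.Γ k)) :
    Function.update (stkSub sub S c T) (.inr ⟨c, k⟩) l =
      stkSub sub S c (Function.update T k l) := by
  funext x
  rcases x with x | ⟨c', x⟩
  · rfl
  · by_cases h : c' = c
    · subst h
      by_cases h : x = k
      · subst h
        simp [stkSub]
      · rw [Function.update_of_ne (by simpa using h)]
        simp [stkSub, h]
    · rw [Function.update_of_ne (by simp [h])]
      simp [stkSub, h]

@[simp] theorem stkSub_inr_self (S : K → List Bool) (c : C) (T : ∀ k, List ((sub c).tm.Γ k))
    (k : (sub c).tm.K) : stkSub sub S c T (.inr ⟨c, k⟩) = T k := by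
  simp [stkSub]

@[simp] theorem stkSub_inl (S : K → List Bool) (c : C) (T : ∀ k, List ((sub c).tm.Γ k))
    (k : K) : stkSub sub S c T (.inl k) = S k := rfl

@[simp] theorem stk_inl (S : K → List Bool) (k : K) : stk sub S (.inl k) = S k := rfl

/-- The configuration of the machine that represents a configuration of a subroutine. -/
def cfgSub {Λ : Type} (c : C) (emb : (sub c).tm.Λ → Λ) (exit : Λ) (b : Option Bool)
    (S : K → List Bool) (x : TM2.Cfg (sub c).tm.Γ (sub c).tm.Λ (sub c).tm.σ) :
    TM2.Cfg (Alph K sub) Λ (Reg sub) :=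
  ⟨some (x.l.elim exit emb), (b, Function.update (regInit sub) c x.var), stkSub sub S c x.stk⟩

/-- The translation touches only the stacks and the state component of `c`, so each statement of the
subroutine is mirrored exactly. Halting becomes a jump to `exit`, which is why `cfgSub` places a
halted configuration at `exit`. -/
theorem stepAux_trans {Λ : Type} (c : C) (emb : (sub c).tm.Λ → Λ) (exit : Λ) (b : Option Bool)
    (S : K → List Bool) (q : TM2.Stmt (sub c).tm.Γ (sub c).tm.Λ (sub c).tm.σ)
    (v : (sub c).tm.σ) (T : ∀ k, List ((sub c).tm.Γ k)) :
    TM2.stepAux (trans sub c emb exit q) (b, Function.update (regInit sub) c v)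
      (stkSub sub S c T) = cfgSub sub c emb exit b S (TM2.stepAux q v T) := by
  induction q generalizing v T with
  | push k f q ih =>
    simp only [trans, TM2.stepAux, stkSub_inr_self, Function.update_self]
    rw [update_stkSub_inr]
    exact ih _ _
  | peek k f q ih =>
    simp only [trans, TM2.stepAux, stkSub_inr_self, Function.update_self, Function.update_idem]
    exact ih _ _
  | pop k f q ih =>
    simp only [trans, TM2.stepAux, stkSub_inr_self, Function.update_self, Function.update_idem]
    rw [update_stkSub_inr]
    exact ih _ _
  | load f q ih =>
    simp only [trans, TM2.stepAux, Function.update_self, Function.update_idem]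
    exact ih _ _
  | branch f q r ih ih' =>
    simp only [trans, TM2.stepAux, Function.update_self]
    cases f v
    · exact ih' _ _
    · exact ih _ _
  | goto f => simp [trans, cfgSub]
  | halt => simp [trans, cfgSub]

theorem reachesIn_cfgSub {Λ : Type} (M : Λ → TM2.Stmt (Alph K sub) Λ (Reg sub)) (c : C)
    (emb : (sub c).tm.Λ → Λ) (exit : Λ)
    (hM : ∀ l, M (emb l) = trans sub c emb exit ((sub c).tm.m l)) (b : Option Bool)
    (S : K → List Bool) {t : ℕ} {x y : (sub c).tm.Cfg} (h : ReachesIn (sub c).tm.step t x y) :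
    ReachesIn (TM2.step M) t (cfgSub sub c emb exit b S x) (cfgSub sub c emb exit b S y) := by
  obtain ⟨n, hn, h⟩ := h
  refine ReachesIn.mono ?_ hn
  clear hn
  induction n generalizing x with
  | zero =>
    cases h
    exact ReachesIn.refl _ _
  | succ n ih =>
    rw [Function.iterate_succ_apply] at h
    rcases hx : (sub c).tm.step x with _ | z
    · have h0 : (flip bind (sub c).tm.step)^[n] none = none := by
        clear h ih
        induction n with
        | zero => rfl
        | succ n ih => rw [Function.iterate_succ_apply]; exact ih
      have h1 : flip bind (sub c).tm.step (some x) = none := hx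
      rw [h1, h0] at h
      cases h
    · have h1 : flip bind (sub c).tm.step (some x) = some z := hx
      rw [h1] at h
      refine ReachesIn.head ?_ (ih h)
      obtain ⟨_ | l, v, T⟩ := x
      · cases hx
      · have hz : TM2.stepAux ((sub c).tm.m l) v T = z := Option.some.inj hx
        simp only [cfgSub, Option.elim, TM2.step, hM]
        rw [stepAux_trans, hz]
        rfl

theorem initList_eq (tm : FinTM2) (s : List (tm.Γ tm.k₀)) :
    initList tm s = ⟨some tm.main, tm.initialState, Function.update (fun _ => []) tm.k₀ s⟩ := by
  unfold initList
  congr 1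
  funext k
  by_cases h : k = tm.k₀
  · subst h
    simp
  · simp [h]

theorem haltList_eq (tm : FinTM2) (s : List (tm.Γ tm.k₁)) :
    haltList tm s = ⟨none, tm.initialState, Function.update (fun _ => []) tm.k₁ s⟩ := by
  unfold haltList
  congr 1
  funext k
  by_cases h : k = tm.k₁
  · subst h
    simp
  · simp [h]

end Prog

end CleanQubit

/-! ### Correctness and running time of the machine code of a program. -/

namespace CleanQubit

open Turing StateTransition

namespace Prog

set_option linter.unusedSectionVars false

variable {K C : Type} [DecidableEq K] [DecidableEq C] (sub : C → Subroutine)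

/-- The configuration of the machine at label `l`, when all subroutines are inactive. -/
abbrev cfg {Λ : Type} (l : Λ) (b : Option Bool) (S : K → List Bool) :
    TM2.Cfg (Alph K sub) Λ (Reg sub) :=
  ⟨some l, (b, regInit sub), stk sub S⟩

/-- `loopDen` recurses on the contents of the control stack at the start of the loop, whereas the
machine pops from the current stack. The two agree because the bodies leave that stack unchanged
(`hS`), so the induction can run over the popped list. -/
theorem reachesIn_loop {Λ : Type} (M : Λ → TM2.Stmt (Alph K sub) Λ (Reg sub)) (k : K) (s : Bool)
    (q r : Prog K C) (emb : Lab sub (loop k s q r) → Λ) (exit : Λ)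
    (hM : ∀ l, M (emb l) = code sub (loop k s q r) emb exit l)
    (hS : ∀ S, den sub q S k = S k ∧ den sub r S k = S k)
    (hq : ∀ b S, ∃ b', ReachesIn (TM2.step M) (cost sub q S)
      (cfg sub (entry sub q (fun l => emb (.inr (.inl l))) (emb (.inl ()))) b S)
      (cfg sub (emb (.inl ())) b' (den sub q S)))
    (hr : ∀ b S, ∃ b', ReachesIn (TM2.step M) (cost sub r S)
      (cfg sub (entry sub r (fun l => emb (.inr (.inr l))) (emb (.inl ()))) b S)
      (cfg sub (emb (.inl ())) b' (den sub r S)))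
    (l : List Bool) (b : Option Bool) (S : K → List Bool) (hl : S k = l) :
    ∃ b', ReachesIn (TM2.step M)
      (loopCost k s (den sub q) (den sub r) (cost sub q) (cost sub r) l S)
      (cfg sub (emb (.inl ())) b S)
      (cfg sub exit b' (loopDen k s (den sub q) (den sub r) l S)) := by
  have h0 : M (emb (.inl ())) = code sub (loop k s q r) emb exit (.inl ()) := hM _
  simp only [code] at h0
  induction l generalizing b S with
  | nil =>
    refine ⟨none, ReachesIn.single ?_⟩
    simp only [TM2.step, h0, TM2.stepAux, stk_inl, hl, List.head?_nil, List.tail_nil,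
      update_stk]
    rfl
  | cons a l ih =>
    cases a
    · by_cases hs : s
      · refine ⟨some false, ?_⟩
        simp only [loopDen, loopCost, hs, if_true]
        refine ReachesIn.single ?_
        simp only [TM2.step, h0, TM2.stepAux, stk_inl, hl, List.head?_cons, List.tail_cons,
          update_stk, hs, if_true]
      · obtain ⟨b', h⟩ := hq (some false) (Function.update S k l)
        obtain ⟨b'', h'⟩ := ih b' (den sub q (Function.update S k l)) (by simp [hS])
        refine ⟨b'', ?_⟩
        simp only [loopDen, loopCost, if_neg hs]
        refine ReachesIn.mono (ReachesIn.head ?_ (h.trans h')) (by omega)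
        simp only [TM2.step, h0, TM2.stepAux, stk_inl, hl, List.head?_cons, List.tail_cons,
          update_stk, if_neg hs]
    · obtain ⟨b', h⟩ := hr (some true) (Function.update S k l)
      obtain ⟨b'', h'⟩ := ih b' (den sub r (Function.update S k l)) (by simp [hS])
      refine ⟨b'', ?_⟩
      simp only [loopDen, loopCost]
      refine ReachesIn.mono (ReachesIn.head ?_ (h.trans h')) (by omega)
      simp only [TM2.step, h0, TM2.stepAux, stk_inl, hl, List.head?_cons, List.tail_cons,
        update_stk]

theorem reachesIn_call_input {Λ : Type} (M : Λ → TM2.Stmt (Alph K sub) Λ (Reg sub)) (c : C)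
    (k k' : K) (emb : Lab sub (call c k k') → Λ) (exit : Λ)
    (hM : ∀ l, M (emb l) = code sub (call c k k') emb exit l) (l l' : List Bool)
    (b : Option Bool) (S : K → List Bool) (hl : S k = l) :
    ReachesIn (TM2.step M) (l.length + 1)
      ⟨some (emb (.inl false)), (b, regInit sub), stkSub sub S c
        (Function.update (fun _ => []) (sub c).tm.k₀ (l'.map (sub c).inp))⟩
      ⟨some (emb (.inr (sub c).tm.main)), (none, regInit sub), stkSub sub (Function.update S k []) c
        (Function.update (fun _ => []) (sub c).tm.k₀ ((l.reverse ++ l').map (sub c).inp))⟩ := by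
  have h0 : M (emb (.inl false)) = code sub (call c k k') emb exit (.inl false) := hM _
  simp only [code] at h0
  induction l generalizing b S l' with
  | nil =>
    refine ReachesIn.single ?_
    simp only [TM2.step, h0, TM2.stepAux, stkSub_inl, hl, List.head?_nil, List.tail_nil,
      update_stkSub_inl]
    rfl
  | cons a l ih =>
    have h := ih (a :: l') (some a) (Function.update S k l) (by simp)
    rw [Function.update_idem] at h
    simp only [List.reverse_cons, List.append_assoc, List.singleton_append]
    refine ReachesIn.head ?_ h
    simp only [TM2.step, h0, TM2.stepAux, stkSub_inl, hl, List.head?_cons, List.tail_cons,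
      update_stkSub_inl, Option.isSome_some, cond_true, Option.getD_some, stkSub_inr_self,
      update_stkSub_inr, Function.update_self, Function.update_idem, List.map_cons]

theorem reachesIn_call_output {Λ : Type} (M : Λ → TM2.Stmt (Alph K sub) Λ (Reg sub)) (c : C)
    (k k' : K) (emb : Lab sub (call c k k') → Λ) (exit : Λ)
    (hM : ∀ l, M (emb l) = code sub (call c k k') emb exit l) (o : List ((sub c).tm.Γ (sub c).tm.k₁))
    (b : Option Bool) (S : K → List Bool) :
    ReachesIn (TM2.step M) (o.length + 1)
      ⟨some (emb (.inl true)), (b, regInit sub), stkSub sub S c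
        (Function.update (fun _ => []) (sub c).tm.k₁ o)⟩
      (cfg sub exit none (Function.update S k' ((o.map (sub c).outp).reverse ++ S k'))) := by
  have h0 : M (emb (.inl true)) = code sub (call c k k') emb exit (.inl true) := hM _
  simp only [code] at h0
  induction o generalizing b S with
  | nil =>
    refine ReachesIn.single ?_
    simp only [TM2.step, h0, TM2.stepAux, stkSub_inr_self,
      List.head?_nil, List.tail_nil, update_stkSub_inr, List.map_nil,
      List.reverse_nil, List.nil_append, Function.update_eq_self]
    rw [stkSub_nil]
    rfl
  | cons a o ih =>
    have h := ih (some ((sub c).outp a))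
      (Function.update S k' ((sub c).outp a :: S k'))
    rw [Function.update_idem, Function.update_self] at h
    simp only [List.map_cons, List.reverse_cons, List.append_assoc, List.singleton_append]
    refine ReachesIn.head ?_ h
    simp only [TM2.step, h0, TM2.stepAux, stkSub_inr_self, Function.update_self,
      List.head?_cons, List.tail_cons, update_stkSub_inr, Function.update_idem, Option.map_some,
      Option.isSome_some, cond_true, Option.getD_some, stkSub_inl, update_stkSub_inl]

/-- Three phases: feed the input stack, run the subroutine, drain its output. A run ends in
`haltList`, with the initial internal state and every stack but the output empty. After draining,
the subroutine is therefore as it was before the call and can be called again. -/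
theorem reachesIn_call {Λ : Type} (M : Λ → TM2.Stmt (Alph K sub) Λ (Reg sub)) (c : C)
    (k k' : K) (emb : Lab sub (call c k k') → Λ) (exit : Λ)
    (hM : ∀ l, M (emb l) = code sub (call c k k') emb exit l)
    (b : Option Bool) (S : K → List Bool) :
    ReachesIn (TM2.step M) (cost sub (call c k k') S) (cfg sub (emb (.inl false)) b S)
      (cfg sub exit none (den sub (call c k k') S)) := by
  obtain ⟨o, ho, h⟩ := (sub c).run (S k).reverse
  have h₁ := reachesIn_call_input sub M c k k' emb exit hM (S k) [] b S rfl
  have h₂ := reachesIn_cfgSub sub M c (fun l => emb (.inr l)) (emb (.inl true))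
    (fun l => hM (.inr l)) none (Function.update S k []) h
  have h₃ := reachesIn_call_output sub M c k k' emb exit hM o none (Function.update S k [])
  have e : o.length = ((sub c).fn (S k).reverse).length := by simp [← ho]
  have e' : Function.update (fun _ => ([] : List _)) (sub c).tm.k₀ [] =
    fun k : (sub c).tm.K => ([] : List ((sub c).tm.Γ k)) := Function.update_eq_self _ _
  rw [List.map_nil, e', stkSub_nil, List.append_nil] at h₁
  rw [initList_eq, haltList_eq] at h₂
  simp only [cfgSub, Function.update_eq_self] at h₂
  rw [ho, e] at h₃
  have := (h₁.trans h₂).trans h₃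
  refine ReachesIn.mono this ?_
  simp only [cost]
  omega

/-- The embedding of labels and the exit label are arbitrary, since in the induction the code of a
subprogram sits inside a larger machine and continues at a label chosen by its context. The register
`b'` holding the last popped bit is left unspecified, because every pop overwrites it before it is
read. -/
theorem reachesIn_code {Λ : Type} (M : Λ → TM2.Stmt (Alph K sub) Λ (Reg sub)) (p : Prog K C)
    (hp : p.WF sub) (emb : Lab sub p → Λ) (exit : Λ)
    (hM : ∀ l, M (emb l) = code sub p emb exit l) (b : Option Bool) (S : K → List Bool) :
    ∃ b', ReachesIn (TM2.step M) (cost sub p S) (cfg sub (entry sub p emb exit) b S)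
      (cfg sub exit b' (den sub p S)) := by
  induction p generalizing exit b S with
  | skip => exact ⟨b, ReachesIn.refl _ _⟩
  | push k a p ih =>
    have h0 : M (emb (.inl ())) = code sub (push k a p) emb exit (.inl ()) := hM _
    simp only [code] at h0
    obtain ⟨b', h⟩ := ih hp (fun l => emb (.inr l)) exit (fun l => hM _) b
      (Function.update S k (a :: S k))
    refine ⟨b', ReachesIn.mono (ReachesIn.head ?_ h) (by simp only [cost]; omega)⟩
    simp only [entry, TM2.step, h0, TM2.stepAux, stk_inl, update_stk]
  | seq p q ih ih' =>
    obtain ⟨b', h⟩ := ih hp.1 (fun l => emb (.inl l)) (entry sub q (fun l => emb (.inr l)) exit)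
      (fun l => hM _) b S
    obtain ⟨b'', h'⟩ := ih' hp.2 (fun l => emb (.inr l)) exit (fun l => hM _) b' (den sub p S)
    exact ⟨b'', h.trans h'⟩
  | pop k p q r ih ih' ih'' =>
    have h0 : M (emb (.inl ())) = code sub (pop k p q r) emb exit (.inl ()) := hM _
    simp only [code] at h0
    rcases hS : S k with _ | ⟨_ | _, l⟩
    · obtain ⟨b', h⟩ := ih hp.1 (fun l => emb (.inr (.inl l))) exit (fun l => hM _) none S
      refine ⟨b', ?_⟩
      simp only [cost, den, hS]
      refine ReachesIn.mono (ReachesIn.head ?_ h) (by omega)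
      have e : Function.update (stk sub S) (.inl k) [] = stk sub S := by
        rw [update_stk, ← hS, Function.update_eq_self]
      simp only [entry, TM2.step, h0, TM2.stepAux, stk_inl, hS, List.head?_nil,
        List.tail_nil, e]
    · obtain ⟨b', h⟩ := ih' hp.2.1 (fun l => emb (.inr (.inr (.inl l)))) exit (fun l => hM _)
        (some false) (Function.update S k l)
      refine ⟨b', ?_⟩
      simp only [cost, den, hS]
      refine ReachesIn.mono (ReachesIn.head ?_ h) (by omega)
      simp only [entry, TM2.step, h0, TM2.stepAux, stk_inl, hS, List.head?_cons,
        List.tail_cons, update_stk]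
    · obtain ⟨b', h⟩ := ih'' hp.2.2 (fun l => emb (.inr (.inr (.inr l)))) exit (fun l => hM _)
        (some true) (Function.update S k l)
      refine ⟨b', ?_⟩
      simp only [cost, den, hS]
      refine ReachesIn.mono (ReachesIn.head ?_ h) (by omega)
      simp only [entry, TM2.step, h0, TM2.stepAux, stk_inl, hS, List.head?_cons,
        List.tail_cons, update_stk]
  | loop k s q r ih ih' =>
    exact reachesIn_loop sub M k s q r emb exit hM hp.2.2
      (fun b S => ih hp.1 (fun l => emb (.inr (.inl l))) (emb (.inl ())) (fun l => hM _) b S)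
      (fun b S => ih' hp.2.1 (fun l => emb (.inr (.inr l))) (emb (.inl ())) (fun l => hM _) b S)
      (S k) b S rfl
  | call c k k' => exact ⟨none, reachesIn_call sub M c k k' emb exit hM b S⟩

/-- The stacks when only stack `k` is nonempty. -/
abbrev only (k : K) (l : List Bool) : K → List Bool := Function.update (fun _ => []) k l

/-- The machine that runs a program. -/
noncomputable def toTM [Fintype K] [Fintype C] (p : Prog K C) (k₀ k₁ : K) : FinTM2 :=
  letI : ∀ c, Fintype (sub c).tm.K := fun c => (sub c).tm.kFin
  letI : ∀ c, Fintype (sub c).tm.σ := fun c => (sub c).tm.σFin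
  letI := fintypeLab sub p
  { K := Stk K sub
    k₀ := .inl k₀
    k₁ := .inl k₁
    Γ := Alph K sub
    Λ := Option (Lab sub p)
    main := entry sub p some none
    σ := Reg sub
    initialState := (none, regInit sub)
    Γk₀Fin := inferInstanceAs (Fintype Bool)
    m := fun l => match l with
      -- `haltList` demands the initial internal state, so the exit label forgets the bit popped
      -- last. This is the one step by which the time bound `P + 1` of `nonempty_computable` exceeds
      -- the cost of the program.
      | none => TM2.Stmt.load (fun v => (none, v.2)) TM2.Stmt.halt
      | some l => code sub p some none l }

theorem nonempty_computable [Fintype K] [Fintype C] (p : Prog K C) (hp : p.WF sub) (k₀ k₁ : K)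
    {α β : Type} {ea : α → List Bool} {eb : β → List Bool} {f : α → β}
    (hf : ∀ a, den sub p (only k₀ (ea a)) = only k₁ (eb (f a)))
    (P : Polynomial ℕ) (hP : ∀ a, cost sub p (only k₀ (ea a)) ≤ P.eval (ea a).length) :
    Nonempty (TM2ComputableInPolyTime ea eb f) := by
  refine ⟨⟨⟨toTM sub p k₀ k₁, Equiv.refl Bool, Equiv.refl Bool⟩, P + 1, fun a => ?_⟩⟩
  have h : ReachesIn (toTM sub p k₀ k₁).step (P.eval (ea a).length + 1)
      (initList (toTM sub p k₀ k₁) ((ea a).map id))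
      (haltList (toTM sub p k₀ k₁) ((eb (f a)).map id)) := by
    have e : ∀ k l, stk sub (only k l) =
        Function.update (β := fun k => List (Alph K sub k)) (fun _ => []) (.inl k) l := by
      intro k l
      rw [← update_stk]
      congr 1
      funext x
      cases x <;> rfl
    have e₁ : initList (toTM sub p k₀ k₁) ((ea a).map id) =
        cfg sub (entry sub p some none) none (only k₀ (ea a)) := by
      refine (congrArg _ (List.map_id (ea a))).trans ?_
      refine (initList_eq (toTM sub p k₀ k₁) (ea a)).trans ?_
      rw [cfg, e]
      rfl
    have e₂ : haltList (toTM sub p k₀ k₁) ((eb (f a)).map id) =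
        ⟨none, (none, regInit sub), stk sub (only k₁ (eb (f a)))⟩ := by
      refine (congrArg _ (List.map_id (eb (f a)))).trans ?_
      refine (haltList_eq (toTM sub p k₀ k₁) (eb (f a))).trans ?_
      rw [e]
      rfl
    rw [e₁, e₂]
    obtain ⟨b', h⟩ := reachesIn_code sub (toTM sub p k₀ k₁).m p hp some none (fun l => rfl) none
      (only k₀ (ea a))
    rw [hf] at h
    have h' : ReachesIn (toTM sub p k₀ k₁).step 1 (cfg sub none b' (only k₁ (eb (f a))))
      ⟨none, (none, regInit sub), stk sub (only k₁ (eb (f a)))⟩ := ReachesIn.single rfl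
    exact (h.mono (hP a)).trans h'
  choose n hn h using h
  refine ⟨⟨n, ?_⟩, ?_⟩
  · exact h
  · simpa using hn

end Prog

end CleanQubit

/-! ### Rules for specifying programs, and elementary stack operations. -/

namespace CleanQubit

open Turing StateTransition

namespace Prog

set_option linter.unusedSectionVars false

variable {K C : Type} [DecidableEq K] [DecidableEq C] {sub : C → Subroutine}

/-- The program does not mention the stack `k`. -/
def Avoids (k : K) : Prog K C → Prop
  | skip => True
  | push k' _ p => k ≠ k' ∧ Avoids k p
  | seq p q => Avoids k p ∧ Avoids k q
  | pop k' p q r => k ≠ k' ∧ Avoids k p ∧ Avoids k q ∧ Avoids k r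
  | loop k' _ q r => k ≠ k' ∧ Avoids k q ∧ Avoids k r
  | call _ k' k'' => k ≠ k' ∧ k ≠ k''

theorem loopDen_of_forall {k k' : K} (hk : k ≠ k') (s : Bool)
    {f g : (K → List Bool) → K → List Bool} (hf : ∀ S, f S k = S k) (hg : ∀ S, g S k = S k)
    (l : List Bool) (S : K → List Bool) : loopDen k' s f g l S k = S k := by
  induction l generalizing S with
  | nil => simp [loopDen, hk]
  | cons a l ih =>
    cases a
    · rw [loopDen]
      split
      · simp [hk]
      · rw [ih, hf, Function.update_of_ne hk]
    · rw [loopDen, ih, hg, Function.update_of_ne hk]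

theorem Avoids.den_eq {k : K} {p : Prog K C} (h : p.Avoids k) (S : K → List Bool) :
    den sub p S k = S k := by
  induction p generalizing S with
  | skip => rfl
  | push k' a p ih => rw [den, ih h.2, Function.update_of_ne h.1]
  | seq p q ih ih' => rw [den, ih' h.2, ih h.1]
  | pop k' p q r ih ih' ih'' =>
    rcases hS : S k' with _ | ⟨_ | _, l⟩
    · simp only [den, hS, ih h.2.1]
    · simp only [den, hS, ih' h.2.2.1, Function.update_of_ne h.1]
    · simp only [den, hS, ih'' h.2.2.2, Function.update_of_ne h.1]
  | loop k' s q r ih ih' => exact loopDen_of_forall h.1 s (ih h.2.1) (ih' h.2.2) _ _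
  | call c k' k'' => rw [den, Function.update_of_ne h.2, Function.update_of_ne h.1]

/-- The bodies of loops do not mention the stack that controls the loop. -/
def Safe : Prog K C → Prop
  | skip => True
  | push _ _ p => Safe p
  | seq p q => Safe p ∧ Safe q
  | pop _ p q r => Safe p ∧ Safe q ∧ Safe r
  | loop k _ q r => Safe q ∧ Safe r ∧ q.Avoids k ∧ r.Avoids k
  | call _ _ _ => True

/-- `WF` quantifies over all contents of the stacks; `Safe` is a sufficient condition that can be
read off the program text. -/
theorem Safe.wf {p : Prog K C} (h : p.Safe) : p.WF sub := by
  induction p with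
  | skip => trivial
  | push _ _ p ih => exact ih h
  | seq p q ih ih' => exact ⟨ih h.1, ih' h.2⟩
  | pop _ p q r ih ih' ih'' => exact ⟨ih h.1, ih' h.2.1, ih'' h.2.2⟩
  | loop k s q r ih ih' =>
    exact ⟨ih h.1, ih' h.2.1, fun S => ⟨h.2.2.1.den_eq S, h.2.2.2.den_eq S⟩⟩
  | call _ _ _ => trivial

variable (sub) in
/-- The program takes the stacks `S` to the stacks `S'` in at most `t` steps. -/
structure Spec (p : Prog K C) (S S' : K → List Bool) (t : ℕ) : Prop where
  den_eq : den sub p S = S'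
  cost_le : cost sub p S ≤ t

/-- A sequence of programs. -/
def block (ps : List (Prog K C)) : Prog K C := ps.foldr seq skip

namespace Spec

variable {p q r : Prog K C} {S S' S'' : K → List Bool} {t u : ℕ} {k k' : K} {l : List Bool}
  {s : Bool}

theorem mono (h : Spec sub p S S' t) (htu : t ≤ u) : Spec sub p S S' u :=
  ⟨h.1, h.2.trans htu⟩

theorem congr (h : Spec sub p S S' t) (e : S' = S'') : Spec sub p S S'' t := e ▸ h

theorem skip : Spec sub skip S S 0 := ⟨rfl, le_rfl⟩

theorem seq (h : Spec sub p S S' t) (h' : Spec sub q S' S'' u) :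
    Spec sub (seq p q) S S'' (t + u) := by
  obtain ⟨rfl, h⟩ := h
  obtain ⟨rfl, h'⟩ := h'
  exact ⟨rfl, Nat.add_le_add h h'⟩

theorem nil : Spec sub (block []) S S 0 := skip

theorem cons {ps : List (Prog K C)} (h : Spec sub p S S' t) (h' : Spec sub (block ps) S' S'' u) :
    Spec sub (block (p :: ps)) S S'' (t + u) := seq h h'

theorem last (h : Spec sub p S S' t) : Spec sub (block [p]) S S' t := cons h nil

theorem push {a : Bool} : Spec sub (push k a .skip) S (Function.update S k (a :: S k)) 1 :=
  ⟨rfl, le_rfl⟩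

theorem pop_nil (hS : S k = []) (h : Spec sub p S S' t) : Spec sub (pop k p q r) S S' (t + 1) := by
  obtain ⟨rfl, h⟩ := h
  exact ⟨by simp [den, hS], by simp only [cost, hS]; omega⟩

theorem pop_false (hS : S k = false :: l) (h : Spec sub q (Function.update S k l) S' t) :
    Spec sub (pop k p q r) S S' (t + 1) := by
  obtain ⟨rfl, h⟩ := h
  exact ⟨by simp [den, hS], by simp only [cost, hS]; omega⟩

theorem pop_true (hS : S k = true :: l) (h : Spec sub r (Function.update S k l) S' t) :
    Spec sub (pop k p q r) S S' (t + 1) := by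
  obtain ⟨rfl, h⟩ := h
  exact ⟨by simp [den, hS], by simp only [cost, hS]; omega⟩

theorem loop_nil (hS : S k = []) : Spec sub (loop k s q r) S S 1 :=
  ⟨by simp only [den, hS, loopDen]; rw [← hS, Function.update_eq_self],
    by simp only [cost, hS, loopCost]; omega⟩

theorem loop_stop (hS : S k = false :: l) :
    Spec sub (loop k true q r) S (Function.update S k l) 1 :=
  ⟨by simp [den, hS, loopDen], by simp [cost, hS, loopCost]⟩

theorem loop_false (hS : S k = false :: l) (h : Spec sub q (Function.update S k l) S' t)
    (hS' : S' k = l) (h' : Spec sub (loop k false q r) S' S'' u) :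
    Spec sub (loop k false q r) S S'' (t + u + 1) := by
  obtain ⟨rfl, h⟩ := h
  obtain ⟨rfl, h'⟩ := h'
  refine ⟨by simp [den, hS, loopDen, hS'], ?_⟩
  simp only [cost, hS'] at h'
  simp only [cost, hS, loopCost, Bool.false_eq_true, if_false]
  omega

theorem loop_true (hS : S k = true :: l) (h : Spec sub r (Function.update S k l) S' t)
    (hS' : S' k = l) (h' : Spec sub (loop k s q r) S' S'' u) :
    Spec sub (loop k s q r) S S'' (t + u + 1) := by
  obtain ⟨rfl, h⟩ := h
  obtain ⟨rfl, h'⟩ := h'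
  refine ⟨by simp [den, hS, loopDen, hS'], ?_⟩
  simp only [cost, hS'] at h'
  simp only [cost, hS, loopCost]
  omega

theorem call {c : C} : Spec sub (call c k k') S
    (Function.update (Function.update S k []) k'
      (((sub c).fn (S k).reverse).reverse ++ Function.update S k [] k'))
    ((S k).length + (sub c).cost (S k).reverse + ((sub c).fn (S k).reverse).length + 2) :=
  ⟨rfl, by simp only [cost]; omega⟩

/-- A loop over the stack `k` with body `r` for both bits: `T i` are the stacks, apart from `k`,
after `i` rounds. -/
theorem loop_forall (T : ℕ → K → List Bool) (l : List Bool)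
    (hr : ∀ i < l.length, ∀ l', Spec sub r (Function.update (T i) k l')
      (Function.update (T (i + 1)) k l') t) :
    Spec sub (loop k false r r) (Function.update (T 0) k l)
      (Function.update (T l.length) k []) ((t + 1) * l.length + 1) := by
  induction l generalizing T with
  | nil => simpa using loop_nil (by simp)
  | cons a l ih =>
    have h₁ := hr 0 (by simp) l
    have h₂ := ih (fun i => T (i + 1)) (fun i hi l' => hr (i + 1) (by simpa using hi) l')
    have e : (t + 1) * (a :: l).length + 1 = t + ((t + 1) * l.length + 1) + 1 := by
      simp only [List.length_cons]; ring
    rw [e]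
    cases a
    · exact loop_false (l := l) (by simp) (by simpa using h₁) (by simp) h₂
    · exact loop_true (l := l) (by simp) (by simpa using h₁) (by simp) h₂

end Spec

/-- Empty the stack `k`. -/
def drain (k : K) : Prog K C := loop k false skip skip

/-- Move the contents of `k` to `k'`, reversing them. -/
def move (k k' : K) : Prog K C := loop k false (push k' false skip) (push k' true skip)

/-- Move the contents of `k` to both `k'` and `k''`, reversing them. -/
def move₂ (k k' k'' : K) : Prog K C :=
  loop k false (push k' false (push k'' false skip)) (push k' true (push k'' true skip))

/-- Append the reversed contents of `k` to `k'`, with `t` as auxiliary stack. -/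
def copy (t k k' : K) : Prog K C := seq (move₂ k t k') (move t k)

/-- Move the number in unary on top of `k` to `k'`. -/
def readUnary (k k' : K) : Prog K C := loop k true skip (push k' true skip)

namespace Spec

variable {S : K → List Bool} {k k' k'' t : K}

theorem drain : Spec sub (drain k) S (Function.update S k []) ((S k).length + 1) := by
  have := loop_forall (sub := sub) (r := Prog.skip) (k := k) (t := 0) (fun _ => S) (S k)
    (fun i _ l' => skip)
  simpa only [Function.update_eq_self, Nat.zero_add, Nat.one_mul, Prog.drain] using this

theorem move (h : k ≠ k') : Spec sub (move k k') S
    (Function.update (Function.update S k []) k' ((S k).reverse ++ S k'))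
    (2 * (S k).length + 1) := by
  generalize hl : S k = l
  induction l generalizing S with
  | nil =>
    have : Function.update (Function.update S k []) k' (([] : List Bool).reverse ++ S k') = S := by
      rw [← hl, Function.update_eq_self, hl]
      simp
    rw [this]
    exact loop_nil hl
  | cons a l ih =>
    have h₂ := ih (S := Function.update (Function.update S k l) k' (a :: S k'))
      (by simp [h])
    have e : Function.update (Function.update (Function.update (Function.update S k l) k'
        (a :: S k')) k []) k' (l.reverse ++ Function.update (Function.update S k l) k'
        (a :: S k') k') =
        Function.update (Function.update S k []) k' ((a :: l).reverse ++ S k') := by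
      rw [Function.update_comm h.symm, Function.update_idem, Function.update_idem]
      simp
    rw [e] at h₂
    have e₃ : 2 * (a :: l).length + 1 = 1 + (2 * l.length + 1) + 1 := by
      simp only [List.length_cons]; ring
    rw [e₃]
    cases a
    · exact loop_false hl push (by simp [h]) (by simpa [h.symm, Prog.move] using h₂)
    · exact loop_true hl push (by simp [h]) (by simpa [h.symm, Prog.move] using h₂)

theorem move₂ (h : k ≠ k') (h' : k ≠ k'') (h'' : k' ≠ k'') : Spec sub (move₂ k k' k'') S
    (Function.update (Function.update (Function.update S k []) k' ((S k).reverse ++ S k'))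
      k'' ((S k).reverse ++ S k'')) (3 * (S k).length + 1) := by
  generalize hl : S k = l
  induction l generalizing S with
  | nil =>
    have : Function.update (Function.update (Function.update S k []) k'
        (([] : List Bool).reverse ++ S k')) k'' (([] : List Bool).reverse ++ S k'') = S := by
      rw [← hl, Function.update_eq_self, hl]
      simp
    rw [this]
    exact loop_nil hl
  | cons a l ih =>
    have h₂ := ih (S := Function.update (Function.update (Function.update S k l) k' (a :: S k'))
      k'' (a :: S k'')) (by simp [h, h'])
    have e : Function.update (Function.update (Function.update (Function.update (Function.update
        (Function.update S k l) k' (a :: S k')) k'' (a :: S k'')) k []) k'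
          (l.reverse ++ (a :: S k'))) k'' (l.reverse ++ (a :: S k'')) =
        Function.update (Function.update (Function.update S k []) k' ((a :: l).reverse ++ S k'))
          k'' ((a :: l).reverse ++ S k'') := by
      funext x
      simp only [Function.update_apply]
      split_ifs <;> simp
    simp only [Function.update_self, Function.update_of_ne h''] at h₂
    rw [e] at h₂
    have e₃ : 3 * (a :: l).length + 1 = 2 + (3 * l.length + 1) + 1 := by
      simp only [List.length_cons]; ring
    rw [e₃]
    have h₁ : Spec sub (.push k' a (.push k'' a .skip)) (Function.update S k l)
        (Function.update (Function.update (Function.update S k l) k' (a :: S k'))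
          k'' (a :: S k'')) 2 := ⟨by simp [den, h.symm, h'.symm, h''.symm], by simp [cost]⟩
    cases a
    · exact loop_false hl h₁ (by simp [h, h']) h₂
    · exact loop_true hl h₁ (by simp [h, h']) h₂

theorem copy (h : k ≠ t) (h' : k ≠ k') (h'' : t ≠ k') (ht : S t = []) :
    Spec sub (copy t k k') S (Function.update S k' ((S k).reverse ++ S k'))
      (5 * (S k).length + 2) := by
  have h₁ := move₂ (sub := sub) (S := S) h h' h''
  have h₂ := move (sub := sub) (S := Function.update (Function.update (Function.update S k []) t
    ((S k).reverse ++ S t)) k' ((S k).reverse ++ S k')) h.symm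
  refine mono (u := 5 * (S k).length + 2) ?_ le_rfl
  have h₃ := seq h₁ h₂
  refine mono (t := _) (u := _) ⟨?_, h₃.2⟩ ?_
  · rw [Prog.copy, h₃.1]
    funext x
    simp only [Function.update_apply]
    split_ifs <;> simp_all
  · simp [h'', ht]
    omega

theorem readUnary (h : k ≠ k') {n : ℕ} {l : List Bool}
    (hl : S k = List.replicate n true ++ false :: l) : Spec sub (readUnary k k') S
    (Function.update (Function.update S k l) k' (List.replicate n true ++ S k')) (2 * n + 1) := by
  induction n generalizing S with
  | zero =>
    have := loop_stop (sub := sub) (q := .skip) (r := .push k' true .skip)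
      (show S k = false :: l by simpa using hl)
    have e : Function.update (Function.update S k l) k' (S k') = Function.update S k l := by
      funext x
      simp only [Function.update_apply]
      split_ifs <;> simp_all
    simpa [Prog.readUnary, e] using this
  | succ n ih =>
    have h₂ := ih (S := Function.update (Function.update S k (List.replicate n true ++ false :: l))
      k' (true :: S k')) (by simp [h])
    have e : 2 * (n + 1) + 1 = 1 + (2 * n + 1) + 1 := by ring
    rw [e]
    refine loop_true (l := List.replicate n true ++ false :: l)
      (by rw [hl, List.replicate_succ]; rfl) push (by simp [h]) ?_
    refine ⟨?_, ?_⟩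
    · have := h₂.1
      simp only [Function.update_of_ne h.symm]
      refine this.trans ?_
      funext x
      simp only [Function.update_apply]
      split_ifs <;> simp_all
      simp [List.replicate_succ', List.append_assoc]
    · simp only [Function.update_of_ne h.symm]
      exact h₂.2

end Spec

end Prog

end CleanQubit

namespace CleanQubit

open Turing StateTransition

/-! ### Subroutines from machines -/

/-- The number of symbols that a statement pushes at most. -/
def pushes {K : Type} {Γ : K → Type} {Λ σ : Type} : TM2.Stmt Γ Λ σ → ℕ
  | .push _ _ q => pushes q + 1
  | .peek _ _ q => pushes q
  | .pop _ _ q => pushes q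
  | .load _ q => pushes q
  | .branch _ q r => pushes q + pushes r
  | .goto _ => 0
  | .halt => 0

theorem length_stepAux_le {K : Type} [DecidableEq K] {Γ : K → Type} {Λ σ : Type}
    (q : TM2.Stmt Γ Λ σ) (v : σ) (S : ∀ k, List (Γ k)) (k : K) :
    ((TM2.stepAux q v S).stk k).length ≤ (S k).length + pushes q := by
  induction q generalizing v S with
  | push k' f q ih =>
    simp only [TM2.stepAux, pushes]
    refine (ih _ _).trans ?_
    by_cases h : k = k'
    · subst h
      simp only [Function.update_self, List.length_cons]
      omega
    · rw [Function.update_of_ne h]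
      omega
  | peek k' f q ih => exact ih _ _
  | pop k' f q ih =>
    simp only [TM2.stepAux, pushes]
    refine (ih _ _).trans ?_
    by_cases h : k = k'
    · subst h
      simp only [Function.update_self, List.length_tail]
      omega
    · rw [Function.update_of_ne h]
  | load f q ih => exact ih _ _
  | branch f q r ih ih' =>
    simp only [TM2.stepAux, pushes]
    have := ih v S
    have := ih' v S
    cases f v <;> simp only [cond_true, cond_false] <;> omega
  | goto f => simp [pushes]
  | halt => simp [pushes]

/-- Every step pushes at most as many symbols as the statement of its label contains, and there are
finitely many labels. Hence a polynomial bound on time is also one on the length of the output,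
which the caller needs because moving the output costs time. -/
theorem exists_length_le (tm : FinTM2) :
    ∃ c : ℕ, ∀ (t : ℕ) (x y : tm.Cfg), ReachesIn tm.step t x y →
      (y.stk tm.k₁).length ≤ (x.stk tm.k₁).length + c * t := by
  have := tm.ΛFin
  refine ⟨∑ l, pushes (tm.m l), fun t x y h => ?_⟩
  obtain ⟨n, hn, h⟩ := h
  have key : (y.stk tm.k₁).length ≤ (x.stk tm.k₁).length + (∑ l, pushes (tm.m l)) * n := by
    clear hn
    induction n generalizing y with
    | zero =>
      cases h
      simp
    | succ n ih =>
      rw [Function.iterate_succ_apply'] at h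
      rcases hz : (flip bind tm.step)^[n] (some x) with _ | z
      · rw [hz] at h
        cases h
      · rw [hz] at h
        have h' : tm.step z = some y := h
        have := ih z hz
        obtain ⟨_ | l, v, T⟩ := z
        · cases h'
        · have hy : TM2.stepAux (tm.m l) v T = y := Option.some.inj h'
          rw [← hy]
          refine (length_stepAux_le _ _ _ _).trans ?_
          have hl : pushes (tm.m l) ≤ ∑ l, pushes (tm.m l) :=
            Finset.single_le_sum (f := fun l => pushes (tm.m l)) (fun _ _ => Nat.zero_le _)
              (Finset.mem_univ l)
          rw [Nat.mul_succ]
          exact (Nat.add_le_add this hl).trans (by omega)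
  exact key.trans (Nat.add_le_add_left (Nat.mul_le_mul_left _ hn) _)

/-- A machine that computes `f` in polynomial time is a subroutine, for any interpretation of
strings of bits as inputs. -/
theorem exists_subroutine {α β : Type} {ea : α → List Bool} {eb : β → List Bool} {f : α → β}
    (h : Nonempty (TM2ComputableInPolyTime ea eb f)) (dec : List Bool → α) (i : Bool → Bool)
    (hdec : ∀ l, ea (dec l) = l.map i) :
    ∃ (s : Subroutine) (P : Polynomial ℕ), (∀ l, s.fn l = eb (f (dec l))) ∧
      (∀ l, s.cost l ≤ P.eval l.length) ∧ ∀ l, (s.fn l).length ≤ P.eval l.length := by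
  obtain ⟨⟨⟨tm, ei, eo⟩, P, hP⟩⟩ := h
  have hP (l) : ReachesIn tm.step (P.eval l.length)
      (initList tm (l.map fun a => ei.symm (i a)))
      (haltList tm ((eb (f (dec l))).map eo.symm)) := by
    have := hP (dec l)
    rw [hdec, List.map_map, List.length_map] at this
    exact ⟨this.steps, this.steps_le_m, this.evals_in_steps⟩
  obtain ⟨c, hc⟩ := exists_length_le tm
  refine ⟨⟨tm, fun a => ei.symm (i a), eo, fun l => eb (f (dec l)), fun l => P.eval l.length,
    -- `P` bounds the time. The summands `X` and `c * P` bound the output: what may be on the output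
    -- stack at the start, if it is also the input stack, plus what is pushed.
    fun l => ⟨(eb (f (dec l))).map eo.symm, ?_, hP l⟩⟩, P + Polynomial.X + Polynomial.C c * P,
    fun l => rfl, fun l => ?_, fun l => ?_⟩
  · rw [List.map_map]
    simp
  · simp only [Polynomial.eval_add, Polynomial.eval_X]
    omega
  · have := hc _ _ _ (hP l)
    rw [Prog.initList_eq, Prog.haltList_eq] at this
    simp only [Function.update_self, List.length_map] at this
    refine this.trans ?_
    simp only [Polynomial.eval_add, Polynomial.eval_mul, Polynomial.eval_C, Polynomial.eval_X]
    have key : ∀ (s : List (tm.Γ tm.k₀)) (k : tm.K),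
        (Function.update (fun k => ([] : List (tm.Γ k))) tm.k₀ s k).length ≤ s.length := by
      intro s k
      by_cases h : k = tm.k₀
      · subst h
        simp
      · simp [Function.update_of_ne h]
    have := key (l.map fun a => ei.symm (i a)) tm.k₁
    rw [List.length_map] at this
    omega

theorem unaryEncodeNat_eq (n : ℕ) : Computability.unaryEncodeNat n = List.replicate n true := by
  induction n with
  | zero => rfl
  | succ n ih => rw [Computability.unaryEncodeNat, ih, List.replicate_succ]

/-- Every string of bits is read as its length in unary, so such a machine can be fed the input $x$
itself to obtain $f(|x|)$. -/
theorem exists_subroutine_of_polyBounded {f : ℕ → ℕ+} (hf : PolyBounded f) :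
    ∃ (s : Subroutine) (P : Polynomial ℕ), (∀ l, s.fn l = List.replicate (f l.length) true) ∧
      (∀ l, s.cost l ≤ P.eval l.length) ∧ ∀ n, (f n : ℕ) ≤ P.eval n := by
  obtain ⟨s, P, h₁, h₂, h₃⟩ := exists_subroutine hf List.length (fun _ => true)
    (fun l => by rw [unaryEncodeNat_eq, List.map_const'])
  simp only [unaryEncodeNat_eq] at h₁
  refine ⟨s, P, h₁, h₂, fun n => ?_⟩
  have := h₃ (List.replicate n true)
  rw [h₁] at this
  simpa using this

end CleanQubit

/-! ### Named stacks, and arithmetic of polynomially bounded functions. -/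

namespace CleanQubit

open Turing StateTransition

/-- The stacks of our programs, `m` of which hold the qubits of a gate. -/
inductive Var (m : ℕ) : Type
  | x | a | b | d | e | l | r | f | n | cnt | cnt' | wid | o | s | t | out | fin
  | wire : Fin m → Var m
  deriving DecidableEq, Fintype

/-- Contents of the stacks. -/
structure Store (m : ℕ) : Type where
  (x a b d e l r f n cnt cnt' wid o s t out fin : List Bool)
  wire : Fin m → List Bool

namespace Store

variable {m : ℕ}

/-- The contents of each of the stacks. -/
def get (σ : Store m) : Var m → List Bool
  | .x => σ.x | .a => σ.a | .b => σ.b | .d => σ.d | .e => σ.e | .l => σ.l | .r => σ.r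
  | .f => σ.f | .n => σ.n | .cnt => σ.cnt | .cnt' => σ.cnt' | .wid => σ.wid | .o => σ.o
  | .s => σ.s | .t => σ.t | .out => σ.out | .fin => σ.fin | .wire j => σ.wire j

/-- The store with all stacks empty. -/
def empty : Store m :=
  ⟨[], [], [], [], [], [], [], [], [], [], [], [], [], [], [], [], [], fun _ => []⟩

variable (σ : Store m) (v : List Bool)

@[simp] theorem get_x : σ.get .x = σ.x := rfl
@[simp] theorem get_a : σ.get .a = σ.a := rfl
@[simp] theorem get_b : σ.get .b = σ.b := rfl
@[simp] theorem get_d : σ.get .d = σ.d := rfl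
@[simp] theorem get_e : σ.get .e = σ.e := rfl
@[simp] theorem get_l : σ.get .l = σ.l := rfl
@[simp] theorem get_r : σ.get .r = σ.r := rfl
@[simp] theorem get_f : σ.get .f = σ.f := rfl
@[simp] theorem get_n : σ.get .n = σ.n := rfl
@[simp] theorem get_cnt : σ.get .cnt = σ.cnt := rfl
@[simp] theorem get_cnt' : σ.get .cnt' = σ.cnt' := rfl
@[simp] theorem get_wid : σ.get .wid = σ.wid := rfl
@[simp] theorem get_o : σ.get .o = σ.o := rfl
@[simp] theorem get_s : σ.get .s = σ.s := rfl
@[simp] theorem get_t : σ.get .t = σ.t := rfl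
@[simp] theorem get_out : σ.get .out = σ.out := rfl
@[simp] theorem get_fin : σ.get .fin = σ.fin := rfl
@[simp] theorem get_wire (j : Fin m) : σ.get (.wire j) = σ.wire j := rfl

@[simp] theorem update_x : Function.update σ.get .x v = get {σ with x := v} := by
  funext k; cases k <;> rfl
@[simp] theorem update_a : Function.update σ.get .a v = get {σ with a := v} := by
  funext k; cases k <;> rfl
@[simp] theorem update_b : Function.update σ.get .b v = get {σ with b := v} := by
  funext k; cases k <;> rfl
@[simp] theorem update_d : Function.update σ.get .d v = get {σ with d := v} := by
  funext k; cases k <;> rfl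
@[simp] theorem update_e : Function.update σ.get .e v = get {σ with e := v} := by
  funext k; cases k <;> rfl
@[simp] theorem update_l : Function.update σ.get .l v = get {σ with l := v} := by
  funext k; cases k <;> rfl
@[simp] theorem update_r : Function.update σ.get .r v = get {σ with r := v} := by
  funext k; cases k <;> rfl
@[simp] theorem update_f : Function.update σ.get .f v = get {σ with f := v} := by
  funext k; cases k <;> rfl
@[simp] theorem update_n : Function.update σ.get .n v = get {σ with n := v} := by
  funext k; cases k <;> rfl
@[simp] theorem update_cnt : Function.update σ.get .cnt v = get {σ with cnt := v} := by
  funext k; cases k <;> rfl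
@[simp] theorem update_cnt' : Function.update σ.get .cnt' v = get {σ with cnt' := v} := by
  funext k; cases k <;> rfl
@[simp] theorem update_wid : Function.update σ.get .wid v = get {σ with wid := v} := by
  funext k; cases k <;> rfl
@[simp] theorem update_o : Function.update σ.get .o v = get {σ with o := v} := by
  funext k; cases k <;> rfl
@[simp] theorem update_s : Function.update σ.get .s v = get {σ with s := v} := by
  funext k; cases k <;> rfl
@[simp] theorem update_t : Function.update σ.get .t v = get {σ with t := v} := by
  funext k; cases k <;> rfl
@[simp] theorem update_out : Function.update σ.get .out v = get {σ with out := v} := by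
  funext k; cases k <;> rfl
@[simp] theorem update_fin : Function.update σ.get .fin v = get {σ with fin := v} := by
  funext k; cases k <;> rfl
@[simp] theorem update_wire (j : Fin m) : Function.update σ.get (.wire j) v =
    get {σ with wire := Function.update σ.wire j v} := by
  funext k
  cases k with
  | wire i =>
    by_cases h : i = j
    · subst h
      simp
    · rw [Function.update_of_ne (by simpa using h)]
      simp [h]
  | _ => rfl

theorem only_x : Prog.only .x v = get {(empty : Store m) with x := v} := by
  funext k; cases k <;> rfl

theorem only_out : Prog.only .out v = get {(empty : Store m) with out := v} := by
  funext k; cases k <;> rfl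

theorem only_fin : Prog.only .fin v = get {(empty : Store m) with fin := v} := by
  funext k; cases k <;> rfl

end Store

namespace Prog

/-- The program that writes `c + (f n + 1) * (g n + 1)` in unary, if the subroutines `false` and
`true` compute `f` and `g`. -/
def mulProg (c : ℕ) : Prog (Var 0) Bool := block [
  move₂ .x .a .b,
  call false .a .n,
  call true .b .wid,
  push .n true skip,
  push .wid true skip,
  loop .n false (copy .t .wid .out) (copy .t .wid .out),
  drain .wid,
  block (List.replicate c (push .out true skip))]

theorem mulProg_safe (c : ℕ) : (mulProg c).Safe := by
  have h : ∀ c, (block (List.replicate c (push (K := Var 0) (C := Bool) .out true skip))).Safe := by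
    intro c
    induction c with
    | zero => trivial
    | succ c ih => exact ⟨trivial, ih⟩
  simp [mulProg, block, Safe, Avoids, move₂, move, copy, drain]
  exact h c

variable {C : Type} [DecidableEq C] {sub : C → Subroutine}

theorem spec_push_out {m : ℕ} (σ : Store m) (c : ℕ) :
    Spec sub (block (List.replicate c (push .out true skip))) σ.get
      (Store.get {σ with out := List.replicate c true ++ σ.out}) c := by
  induction c generalizing σ with
  | zero => exact Spec.nil
  | succ c ih =>
    have h₂ := ih {σ with out := true :: σ.out}
    have e : List.replicate c true ++ true :: σ.out = List.replicate (c + 1) true ++ σ.out := by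
      simp [List.replicate_succ']
    simp only [e] at h₂
    apply Spec.mono
    · apply Spec.cons Spec.push
      simp only [Store.update_out, Store.get_out]
      exact h₂
    · omega

theorem spec_mulProg {sub : Bool → Subroutine} {f g : ℕ → ℕ}
    (hf : ∀ l, (sub false).fn l = List.replicate (f l.length) true)
    (hg : ∀ l, (sub true).fn l = List.replicate (g l.length) true) (c : ℕ) (v : List Bool) :
    Spec sub (mulProg c) (Store.get {Store.empty with x := v})
      (Store.get {Store.empty with
        out := List.replicate (c + (f v.length + 1) * (g v.length + 1)) true})
      (5 * v.length + (sub false).cost v + (sub true).cost v + f v.length + 3 * g v.length +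
        (5 * (g v.length + 1) + 2 + 1) * (f v.length + 1) + c + 20) := by
  -- After `i` rounds `i` copies of `g + 1` have been written; the stack `n` holds `f + 1` and
  -- serves as the counter.
  have hloop := Spec.loop_forall (sub := sub) (k := Var.n) (r := copy .t .wid .out)
    (t := 5 * (g v.length + 1) + 2)
    (fun i => Store.get {(Store.empty : Store 0) with
      wid := List.replicate (g v.length + 1) true
      out := List.replicate (i * (g v.length + 1)) true})
    (List.replicate (f v.length + 1) true) (fun i hi l' => by
      apply Spec.mono
      · apply Spec.congr (Spec.copy (by simp) (by simp) (by simp) (by simp [Store.empty]))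
        simp [Store.empty, List.replicate_append_replicate]
        ring_nf
      · simp)
  simp only [Store.update_n, Store.empty, zero_mul, List.replicate_zero] at hloop
  apply Spec.mono
  · apply Spec.cons (Spec.move₂ (by simp) (by simp) (by simp))
    simp only [Store.update_x, Store.update_a, Store.update_b, Store.get_x, Store.get_a,
      Store.get_b]
    apply Spec.cons Spec.call
    simp only [Store.update_a, Store.update_n, Store.get_a, Store.get_n, hf]
    apply Spec.cons Spec.call
    simp only [Store.update_b, Store.update_wid, Store.get_b, Store.get_wid, hg]
    apply Spec.cons Spec.push
    simp only [Store.update_n, Store.get_n]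
    apply Spec.cons Spec.push
    simp only [Store.update_wid, Store.get_wid]
    simp only [Store.empty, List.append_nil, List.reverse_reverse, List.reverse_replicate,
      ← List.replicate_succ]
    apply Spec.cons hloop
    apply Spec.cons Spec.drain
    simp only [Store.update_wid]
    apply Spec.last
    apply Spec.congr (spec_push_out _ _)
    simp [List.replicate_append_replicate]
  · simp [Store.empty, hf, hg]
    omega

end Prog

/-- This one closure property covers both uses: $c=0$ for the exponent $(r+1)(p+1)$, and $c=2$ for
the width $(p+1)(w+1)+2$ of the combined circuit. -/
theorem PolyBounded.add_mul {f g : ℕ → ℕ+} (hf : PolyBounded f) (hg : PolyBounded g) (c : ℕ)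
    {h : ℕ → ℕ+} (hh : ∀ n, (h n : ℕ) = c + (f n + 1) * (g n + 1)) : PolyBounded h := by
  obtain ⟨s, P, hs, hP, hP'⟩ := exists_subroutine_of_polyBounded hf
  obtain ⟨s', P', hs', hQ, hQ'⟩ := exists_subroutine_of_polyBounded hg
  have key := fun n => Prog.spec_mulProg (sub := fun b => bif b then s' else s)
    (f := fun n => f n) (g := fun n => g n) hs hs' c (List.replicate n true)
  refine Prog.nonempty_computable (fun b => bif b then s' else s) (Prog.mulProg c)
    (Prog.mulProg_safe c).wf .x .out (fun n => ?_)
    (5 * Polynomial.X + P + P' + P + 3 * P' + (5 * (P' + 1) + 2 + 1) * (P + 1) +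
      Polynomial.C c + 20) (fun n => ?_)
  · rw [Store.only_x, Store.only_out, unaryEncodeNat_eq, unaryEncodeNat_eq, (key n).den_eq, hh]
    simp
  · rw [Store.only_x, unaryEncodeNat_eq]
    refine (key n).cost_le.trans ?_
    have h₁ := hP (List.replicate n true)
    have h₂ := hQ (List.replicate n true)
    have h₃ := hP' n
    have h₄ := hQ' n
    simp only [List.length_replicate, cond_true, cond_false, Polynomial.eval_add,
      Polynomial.eval_mul, Polynomial.eval_X, Polynomial.eval_C, Polynomial.eval_ofNat,
      Polynomial.eval_one] at *
    gcongr

end CleanQubit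

/-! ### Programs that write a fixed circuit at computed qubits. -/

namespace CleanQubit

variable {G : GateSet} {m : ℕ}

/-- The description of the circuit `L` with qubit `j` replaced by `e j`. -/
def emitText {a : ℕ} (L : List (PlacedGate G a)) (e : Fin a → ℕ) : List Bool :=
  (L.map fun P => unaryCode P.idx ++
    ((List.finRange _).map fun i => unaryCode (e (P.wires i))).flatten).flatten

namespace Prog

variable {C : Type} [DecidableEq C] {sub : C → Subroutine}

theorem spec_push_replicate {K : Type} [DecidableEq K] (k : K) (S : K → List Bool) (c : ℕ) :
    Spec sub (block (List.replicate c (push k true skip))) S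
      (Function.update S k (List.replicate c true ++ S k)) c := by
  induction c generalizing S with
  | zero => exact Spec.nil.congr (by simp)
  | succ c ih =>
    apply Spec.mono
    · apply Spec.cons Spec.push
      apply Spec.congr (ih _)
      simp [List.replicate_succ']
    · omega

theorem safe_block {K C : Type} {ps : List (Prog K C)} :
    (block ps).Safe ↔ ∀ p ∈ ps, p.Safe := by
  induction ps with
  | nil => simp [block, Safe]
  | cons p ps ih =>
    have : (block (p :: ps)).Safe ↔ p.Safe ∧ (block ps).Safe := Iff.rfl
    simp [this, ih]

theorem avoids_block {K C : Type} {k : K} {ps : List (Prog K C)} :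
    (block ps).Avoids k ↔ ∀ p ∈ ps, p.Avoids k := by
  induction ps with
  | nil => simp [block, Avoids]
  | cons p ps ih =>
    have : (block (p :: ps)).Avoids k ↔ p.Avoids k ∧ (block ps).Avoids k := Iff.rfl
    simp [this, ih]

/-- Append the numbers in unary on the stacks `ks`, terminated by `false`, to the stack `k`. -/
def emitNums (k : Var m) (ks : List (Var m)) : Prog (Var m) C :=
  block (ks.map fun k' => seq (copy .t k' k) (push k false skip))

theorem spec_emitNums {k : Var m} (hk : k ≠ .t) {α : Type} (ks : List α) (v : α → Var m)
    (e : α → ℕ) (S : Var m → List Bool) (ht : S .t = []) {M : ℕ}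
    (hv : ∀ j ∈ ks, v j ≠ .t ∧ v j ≠ k ∧ S (v j) = List.replicate (e j) true ∧ e j ≤ M) :
    Spec sub (emitNums k (ks.map v)) S
      (Function.update S k ((ks.map fun j => unaryCode (e j)).flatten.reverse ++ S k))
      (ks.length * (5 * M + 3)) := by
  induction ks generalizing S with
  | nil => exact (Spec.nil.congr (by simp)).mono (Nat.zero_le _)
  | cons j ks ih =>
    obtain ⟨h₁, h₂, h₃, h₄⟩ := hv j (by simp)
    apply Spec.mono
    · apply Spec.cons
      · apply Spec.seq (Spec.copy h₁ h₂ hk.symm ht)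
        apply Spec.push
      · apply Spec.congr (ih _ _ _)
        · simp [h₃, unaryCode]
        · simp [hk.symm, ht]
        · intro i hi
          obtain ⟨h₁, h₂, h₃, h₄⟩ := hv i (by simp [hi])
          simp [h₁, h₂, h₃, h₄]
    · simp only [h₃, List.length_replicate, List.length_cons]
      nlinarith

/-- Write the description of the circuit `L`, on the qubits whose numbers are on the stacks
`Var.wire`, to the stack `k`. -/
def emit {a : ℕ} (ha : a ≤ m) (k : Var m) (L : List (PlacedGate G a)) : Prog (Var m) C :=
  block (L.map fun P => block [block (List.replicate P.idx (push k true skip)), push k false skip,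
    emitNums k ((List.finRange _).map fun i => .wire ((P.wires i).castLE ha))])

/-- `L` is fixed, so its gates are hard-coded in the program and `c` depends on `L` alone; only the
numbers of the qubits vary, bounded by `M`. The bound on the length of the text pays for moving it
later. -/
theorem spec_emit {a : ℕ} (ha : a ≤ m) {k : Var m} (hk : k ≠ .t) (hk' : ∀ j, k ≠ .wire j)
    (L : List (PlacedGate G a)) : ∃ c : ℕ, ∀ (M : ℕ) (e : Fin a → ℕ) (_ : ∀ j, e j ≤ M)
      (S : Var m → List Bool) (_ : S .t = [])
      (_ : ∀ j : Fin a, S (.wire (j.castLE ha)) = List.replicate (e j) true),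
      Spec sub (emit ha k L) S (Function.update S k ((emitText L e).reverse ++ S k))
        (c * (M + 1)) ∧ (emitText L e).length ≤ c * (M + 1) := by
  induction L with
  | nil =>
    exact ⟨0, fun M e he S ht hw => ⟨(Spec.nil.congr (by simp [emitText])).mono (Nat.zero_le _),
      by simp [emitText]⟩⟩
  | cons P L ih =>
    obtain ⟨c, hc⟩ := ih
    refine ⟨P.idx + 1 + G.arity P.idx * 5 + c, fun M e he S ht hw => ⟨?_, ?_⟩⟩
    · apply Spec.mono
      · apply Spec.cons
        · apply Spec.cons (spec_push_replicate _ _ _)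
          apply Spec.cons Spec.push
          apply Spec.last
          apply spec_emitNums hk (M := M) (e := fun i => e (P.wires i))
          · simp [hk.symm, ht]
          · intro j _
            exact ⟨by simp, (hk' _).symm, by simp [(hk' _).symm, hw], he _⟩
        · apply Spec.congr (hc M e he _ _ _).1
          · simp [emitText, unaryCode]
          · simp [hk.symm, ht]
          · intro j
            simp [(hk' _).symm, hw]
      · simp only [List.length_finRange]
        have : (P.idx : ℕ) ≤ P.idx * (M + 1) := Nat.le_mul_of_pos_right _ (by omega)
        nlinarith [Nat.zero_le (G.arity P.idx * M)]
    · have h₁ := (hc M e he S ht hw).2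
      have h₂ : ((List.finRange (G.arity P.idx)).map
          fun i => unaryCode (e (P.wires i))).flatten.length ≤ G.arity P.idx * (M + 1) := by
        rw [List.length_flatten, List.map_map]
        refine (List.sum_le_card_nsmul _ (M + 1) fun x hx => ?_).trans (by simp)
        simp only [List.mem_map] at hx
        obtain ⟨i, _, rfl⟩ := hx
        simpa [unaryCode] using he _
      have e₁ : (emitText (P :: L) e).length = P.idx + 1 +
          ((List.finRange (G.arity P.idx)).map
            fun i => unaryCode (e (P.wires i))).flatten.length + (emitText L e).length := by
        simp only [emitText, List.map_cons, List.flatten_cons, List.length_append, unaryCode,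
          List.length_replicate, List.length_singleton]
      rw [e₁]
      have : (P.idx : ℕ) ≤ P.idx * (M + 1) := Nat.le_mul_of_pos_right _ (by omega)
      nlinarith [Nat.zero_le (G.arity P.idx * (M + 1))]

/-- Empty the stacks `Var.wire`. -/
def drainWires : Prog (Var m) C := block ((List.finRange m).map fun j => drain (.wire j))

theorem spec_drainWires (σ : Store m) {M : ℕ} (hσ : ∀ j, (σ.wire j).length ≤ M) :
    Spec sub drainWires σ.get (Store.get {σ with wire := fun _ => []}) (m * (M + 1)) := by
  have key : ∀ (js : List (Fin m)) (W : Fin m → List Bool), (∀ j, (W j).length ≤ M) →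
      Spec sub (block (js.map fun j => drain (.wire j))) (Store.get {σ with wire := W})
        (Store.get {σ with wire := fun j => if j ∈ js then [] else W j})
        (js.length * (M + 1)) := by
    intro js
    induction js with
    | nil => exact fun W _ => (Spec.nil.congr (by simp)).mono (Nat.zero_le _)
    | cons j js ih =>
      intro W hW
      apply Spec.mono
      · apply Spec.cons Spec.drain
        simp only [Store.update_wire]
        apply Spec.congr (ih _ _)
        · congr 2
          funext i
          by_cases h : i = j
          · simp [h]
          · simp [h]
        · intro i
          by_cases h : i = j
          · simp [h]
          · simpa [h] using hW i
      · have := hW j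
        simp only [Store.get_wire, List.length_cons]
        nlinarith
  have := key (List.finRange m) σ.wire hσ
  simpa [drainWires] using this

/-- Append the number given by the sum of the contents of the stacks `x.1` and `x.2` to `k`. -/
def setNum (k : Var m) (x : List (Var m) × ℕ) : Prog (Var m) C :=
  seq (block (x.1.map fun k' => copy .t k' k)) (block (List.replicate x.2 (push k true skip)))

/-- The value of such a sum. -/
def numVal (S : Var m → List Bool) (x : List (Var m) × ℕ) : ℕ :=
  x.2 + (x.1.map fun k => (S k).length).sum

theorem spec_setNum {k : Var m} (hk : k ≠ .t) (x : List (Var m) × ℕ) (S : Var m → List Bool)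
    (ht : S .t = []) {M : ℕ} (hx : ∀ k' ∈ x.1, k' ≠ .t ∧ k' ≠ k ∧
      S k' = List.replicate (S k').length true ∧ (S k').length ≤ M) :
    Spec sub (setNum k x) S (Function.update S k (List.replicate (numVal S x) true ++ S k))
      (x.1.length * (5 * M + 2) + x.2) := by
  obtain ⟨ks, c⟩ := x
  have key : Spec sub (block (ks.map fun k' => copy .t k' k)) S (Function.update S k
      (List.replicate (ks.map fun k => (S k).length).sum true ++ S k))
      (ks.length * (5 * M + 2)) := by
    replace hx : ∀ k' ∈ ks, k' ≠ .t ∧ k' ≠ k ∧ S k' = List.replicate (S k').length true ∧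
      (S k').length ≤ M := hx
    clear c
    induction ks generalizing S with
    | nil => exact (Spec.nil.congr (by simp)).mono (Nat.zero_le _)
    | cons k' ks ih =>
      obtain ⟨h₁, h₂, h₃, h₄⟩ := hx k' (by simp)
      have e : (ks.map fun k'' => (Function.update S k ((S k').reverse ++ S k) k'').length) =
          ks.map fun k'' => (S k'').length := by
        refine List.map_congr_left fun k'' hk'' => ?_
        rw [Function.update_of_ne (hx k'' (by simp [hk''])).2.1]
      apply Spec.mono
      · apply Spec.cons (Spec.copy h₁ h₂ hk.symm ht)
        apply Spec.congr (ih _ _ _)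
        · rw [e]
          rw [h₃]
          simp [← List.append_assoc, List.replicate_append_replicate, Nat.add_comm]
        · simp [hk.symm, ht]
        · intro k'' hk''
          obtain ⟨h₁, h₂, h₃, h₄⟩ := hx k'' (by simp [hk''])
          rw [Function.update_of_ne h₂]
          exact ⟨h₁, h₂, h₃, h₄⟩
      · simp only [List.length_cons]
        nlinarith
  apply Spec.mono
  · apply Spec.seq key
    apply Spec.congr (spec_push_replicate _ _ _)
    simp [numVal, ← List.append_assoc, List.replicate_append_replicate]
  · simp

/-- The stacks `W`, with the numbers `v j` in unary on the stacks `j` in `js`. -/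
def fillWires {a : ℕ} (js : List (Fin a)) (v : Fin a → ℕ) (W : Fin m → List Bool) (i : Fin m) :
    List Bool :=
  if h : (i : ℕ) < a then if ⟨i, h⟩ ∈ js then List.replicate (v ⟨i, h⟩) true else W i else W i

@[simp] theorem fillWires_castLE {a : ℕ} (ha : a ≤ m) (js : List (Fin a)) (v : Fin a → ℕ)
    (W : Fin m → List Bool) (j : Fin a) : fillWires js v W (j.castLE ha) =
      if j ∈ js then List.replicate (v j) true else W (j.castLE ha) := by
  simp [fillWires]

@[simp] theorem fillWires_nil {a : ℕ} (v : Fin a → ℕ) (W : Fin m → List Bool) :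
    fillWires [] v W = W := by
  funext i
  simp [fillWires]

theorem fillWires_cons {a : ℕ} (ha : a ≤ m) {j : Fin a} {js : List (Fin a)} (hj : j ∉ js)
    (v : Fin a → ℕ) (W : Fin m → List Bool) :
    fillWires js v (Function.update W (j.castLE ha) (List.replicate (v j) true)) =
      fillWires (j :: js) v W := by
  funext i
  by_cases h : (i : ℕ) < a
  · obtain ⟨i', rfl⟩ : ∃ i' : Fin a, i'.castLE ha = i := ⟨⟨i, h⟩, rfl⟩
    rw [fillWires_castLE, fillWires_castLE]
    by_cases h' : i' = j
    · subst h'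
      simp [hj]
    · rw [Function.update_of_ne (by simpa [Fin.castLE_inj] using h')]
      simp [h']
  · have : i ≠ j.castLE ha := by
      rintro rfl
      exact h (by simp)
    simp [fillWires, h, this]

theorem length_fillWires_le {a : ℕ} {js : List (Fin a)} {v : Fin a → ℕ} {W : Fin m → List Bool}
    {M : ℕ} (hv : ∀ j, v j ≤ M) (hW : ∀ j, (W j).length ≤ M) (i : Fin m) :
    (fillWires js v W i).length ≤ M := by
  unfold fillWires
  split_ifs
  · simpa using hv _
  · exact hW _
  · exact hW _

/-- Write the description of the circuit `L`, on the qubits with the given numbers, to the stack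
`Var.out`. -/
def emitAt {a : ℕ} (ha : a ≤ m) (L : List (PlacedGate G a)) (x : Fin a → List (Var m) × ℕ) :
    Prog (Var m) C :=
  block [block ((List.finRange a).map fun j => setNum (.wire (j.castLE ha)) (x j)),
    emit ha .out L, drainWires]

theorem spec_emitAt {a : ℕ} (ha : a ≤ m) (L : List (PlacedGate G a))
    (x : Fin a → List (Var m) × ℕ) (hx : ∀ j, ∀ k ∈ (x j).1, k ≠ .t ∧ ∀ i, k ≠ .wire i) :
    ∃ c : ℕ, ∀ (M : ℕ) (σ : Store m) (_ : σ.t = []) (_ : σ.wire = fun _ => [])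
      (_ : ∀ j, ∀ k ∈ (x j).1, σ.get k = List.replicate (σ.get k).length true ∧
        (σ.get k).length ≤ M),
      Spec sub (emitAt ha L x) σ.get (Store.get {σ with
        out := (emitText L fun j => numVal σ.get (x j)).reverse ++ σ.out}) (c * (M + 1)) := by
  obtain ⟨c, hc⟩ := spec_emit (sub := sub) ha (k := .out) (by simp) (by simp) L
  set A := ∑ j, (x j).1.length with hA
  set B := ∑ j, (x j).2 with hB
  have hA' (j) : (x j).1.length ≤ A :=
    Finset.single_le_sum (f := fun j => (x j).1.length) (fun _ _ => Nat.zero_le _)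
      (Finset.mem_univ j)
  have hB' (j) : (x j).2 ≤ B :=
    Finset.single_le_sum (f := fun j => (x j).2) (fun _ _ => Nat.zero_le _) (Finset.mem_univ j)
  refine ⟨a * (A * 5 + B) + c * (B + A + 1) + m * (B + A + 1), fun M σ ht hw hσ => ?_⟩
  -- A qubit number is a constant plus a sum of stack lengths. It may thus exceed `M`, and `B + A *
  -- M` takes the place of `M` when the text is written.
  have hval (j) : numVal σ.get (x j) ≤ B + A * M := by
    refine Nat.add_le_add (hB' j) ?_
    refine (List.sum_le_card_nsmul _ M fun n hn => ?_).trans ?_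
    · simp only [List.mem_map] at hn
      obtain ⟨k, hk, rfl⟩ := hn
      exact (hσ j k hk).2
    · simpa using Nat.mul_le_mul_right M (hA' j)
  have get_wire' : ∀ (W : Fin m → List Bool) (j) (k), k ∈ (x j).1 →
      Store.get {σ with wire := W} k = σ.get k := by
    intro W j k hk
    have := (hx j k hk).2
    cases k <;> first | rfl | exact absurd rfl (this _)
  have key : ∀ (js : List (Fin a)) (W : Fin m → List Bool), js.Nodup →
      (∀ j ∈ js, W (j.castLE ha) = []) →
      Spec sub (block (js.map fun j => setNum (.wire (j.castLE ha)) (x j)))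
        (Store.get {σ with wire := W})
        (Store.get {σ with wire := fillWires js (fun j => numVal σ.get (x j)) W})
        (js.length * (A * (5 * M + 2) + B)) := by
    intro js
    induction js with
    | nil => exact fun W _ _ => (Spec.nil.congr (by simp)).mono (Nat.zero_le _)
    | cons j js ih =>
      intro W hnd hW
      rw [List.nodup_cons] at hnd
      have e : numVal (Store.get {σ with wire := W}) (x j) = numVal σ.get (x j) := by
        unfold numVal
        congr 2
        exact List.map_congr_left fun k hk => by rw [get_wire' W j k hk]
      apply Spec.mono
      · apply Spec.cons
        · apply spec_setNum (M := M) (by simp) _ _ ht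
          intro k hk
          rw [get_wire' W j k hk]
          exact ⟨(hx j k hk).1, (hx j k hk).2 _, (hσ j k hk).1, (hσ j k hk).2⟩
        · simp only [Store.update_wire, Store.get_wire, hW j (by simp), e]
          apply Spec.congr (ih _ hnd.2 _)
          · congr 2
            rw [List.append_nil]
            exact fillWires_cons ha hnd.1 (fun j => numVal σ.get (x j)) W
          · intro j' hj'
            rw [Function.update_of_ne]
            · exact hW j' (by simp [hj'])
            · intro h
              rw [Fin.castLE_inj] at h
              exact hnd.1 (h ▸ hj')
      · have h₁ := Nat.mul_le_mul_right (5 * M + 2) (hA' j)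
        have h₂ := hB' j
        rw [List.length_cons, Nat.succ_mul js.length]
        omega
  have hfin := key (List.finRange a) σ.wire (List.nodup_finRange a) (by simp [hw])
  simp only [List.length_finRange] at hfin
  apply Spec.mono
  · apply Spec.cons hfin
    apply Spec.cons (hc (B + A * M) (fun j => numVal σ.get (x j)) hval _ ht (by simp)).1
    simp only [Store.update_out]
    apply Spec.last
    apply Spec.congr (spec_drainWires (M := B + A * M) _ _)
    · simp [hw]
    · exact length_fillWires_le hval (by simp [hw])
  · nlinarith [Nat.zero_le (a * A * M), Nat.zero_le (a * B * M), Nat.zero_le (c * B * M),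
      Nat.zero_le (c * A), Nat.zero_le (m * B * M), Nat.zero_le (m * A), Nat.zero_le (a * A)]

end Prog

end CleanQubit

/-! ### Programs that rewrite a given circuit gate by gate. -/

namespace CleanQubit

variable {G : GateSet} {m : ℕ}

/-- The circuit in which each gate `P` of `gs` is replaced by the circuit `tmpl P.idx` on the same
qubits, and qubit `j` by qubit `s + 1 + j`, in reverse order if `rev` holds. -/
def gatesText (tmpl : ∀ g, List (PlacedGate G (G.arity g))) (rev : Bool) (s : ℕ) {w : ℕ}
    (gs : List (PlacedGate G w)) : List Bool :=
  ((bif rev then gs.reverse else gs).map fun P =>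
    emitText (tmpl P.idx) fun a => s + 1 + P.wires a).flatten

theorem PlacedGate.encode_eq {w : ℕ} (P : PlacedGate G w) : P.encode = unaryCode P.idx ++
    ((List.finRange _).map fun a => unaryCode (P.wires a)).flatten := by
  rw [PlacedGate.encode, List.ofFn_eq_map]

namespace Prog

variable {C : Type} [DecidableEq C] {sub : C → Subroutine}

/-- Read a qubit from the stack `Var.r` to `Var.wire j`, and shift it. -/
def readWire (j : Fin m) : Prog (Var m) C :=
  block [copy .t .s (.wire j), push (.wire j) true skip, readUnary .r (.wire j)]

/-- The shift is `s + 1` rather than `s` because the first qubit `s` of a block is its ancilla and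
the register starts behind it. -/
theorem spec_readWires {a : ℕ} (ha : a ≤ m) (e : Fin a → ℕ) {s M : ℕ} (hs : s ≤ M)
    (he : ∀ j, e j ≤ M) (js : List (Fin a)) (hjs : js.Nodup) (rest : List Bool) (σ : Store m)
    (ht : σ.t = []) (hσ : σ.s = List.replicate s true)
    (hr : σ.r = (js.map fun j => unaryCode (e j)).flatten ++ rest)
    (hw : ∀ j ∈ js, σ.wire (j.castLE ha) = []) :
    Spec sub (block (js.map fun j => readWire (j.castLE ha))) σ.get (Store.get {σ with
      r := rest, wire := fillWires js (fun j => s + 1 + e j) σ.wire})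
      (js.length * (7 * M + 4)) := by
  induction js generalizing σ with
  | nil =>
    refine (Spec.nil.congr ?_).mono (Nat.zero_le _)
    simp only [List.map_nil, List.flatten_nil, List.nil_append] at hr
    rw [← hr, fillWires_nil]
  | cons j js ih =>
    rw [List.nodup_cons] at hjs
    apply Spec.mono
    · apply Spec.cons
      · apply Spec.cons (Spec.copy (by simp) (by simp) (by simp)
          (show σ.get .t = [] from ht))
        simp only [Store.update_wire, Store.get_s, Store.get_wire, hw j (by simp)]
        apply Spec.cons Spec.push
        simp only [Store.update_wire, Store.get_wire, Function.update_idem, Function.update_self]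
        apply Spec.last
        apply Spec.readUnary (by simp) (n := e j)
          (l := (js.map fun j => unaryCode (e j)).flatten ++ rest)
        simp [hr, unaryCode]
      · simp only [Store.update_wire, Store.update_r, Store.get_wire, Function.update_idem,
          Function.update_self]
        apply Spec.congr (ih hjs.2 _ _ _ _ _)
        · congr 2
          rw [← fillWires_cons ha hjs.1]
          congr 2
          simp [hσ, ← List.replicate_succ, List.replicate_append_replicate]
          ring_nf
        · exact ht
        · exact hσ
        · simp
        · intro j' hj'
          dsimp only
          rw [Function.update_of_ne]
          · exact hw j' (by simp [hj'])
          · intro h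
            rw [Fin.castLE_inj] at h
            exact hjs.1 (h ▸ hj')
    · have := he j
      simp only [Store.get_s, hσ, List.length_replicate, List.length_cons]
      rw [Nat.succ_mul js.length]
      omega

/-- Process a gate `g` whose qubits are on the stack `Var.r`. -/
def handler (har : ∀ g, G.arity g ≤ m) (tmpl : ∀ g, List (PlacedGate G (G.arity g))) (rev : Bool)
    (g : Fin G.size) : Prog (Var m) C :=
  block [block ((List.finRange (G.arity g)).map fun j => readWire (j.castLE (har g))),
    emit (har g) .e (tmpl g), drainWires, bif rev then move .e .l else skip]

/-- Without `rev`, texts accumulate on `e`, reversed. With `rev`, each text is moved from `e` to `l`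
at once: this undoes its reversal and puts it in front of the texts of the earlier gates. The order
of the gates is reversed, but not the text of each replacement circuit. -/
theorem spec_handler (har : ∀ g, G.arity g ≤ m) (tmpl : ∀ g, List (PlacedGate G (G.arity g)))
    (rev : Bool) : ∃ c : ℕ, ∀ (M s w : ℕ) (_ : s + 1 + w ≤ M) (P : PlacedGate G w)
      (rest : List Bool) (σ : Store m) (_ : σ.t = []) (_ : σ.s = List.replicate s true)
      (_ : σ.wire = fun _ => []) (_ : rev → σ.e = [])
      (_ : σ.r = ((List.finRange _).map fun a => unaryCode (P.wires a)).flatten ++ rest),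
      Spec sub (handler har tmpl rev P.idx) σ.get (Store.get {σ with
        r := rest
        e := bif rev then [] else
          (emitText (tmpl P.idx) fun a => s + 1 + P.wires a).reverse ++ σ.e
        l := bif rev then (emitText (tmpl P.idx) fun a => s + 1 + P.wires a) ++ σ.l else σ.l})
        (c * (M + 1)) ∧
      (emitText (tmpl P.idx) fun a => s + 1 + P.wires a).length ≤ c * (M + 1) := by
  choose c hc using fun g => spec_emit (sub := sub) (har g) (k := .e) (by simp) (by simp) (tmpl g)
  have hc' (g) : c g ≤ ∑ g, c g :=
    Finset.single_le_sum (f := c) (fun _ _ => Nat.zero_le _) (Finset.mem_univ g)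
  refine ⟨m * 7 + 3 * (∑ g, c g) + m + 1, fun M s w hM P rest σ ht hs hw he hr => ?_⟩
  have hwires (a) : s + 1 + (P.wires a : ℕ) ≤ M := by have := (P.wires a).2; omega
  have h₁ := spec_readWires (sub := sub) (har P.idx) (fun a => (P.wires a : ℕ)) (s := s) (M := M)
    (by omega) (fun a => by have := hwires a; omega) (List.finRange _) (List.nodup_finRange _)
    rest σ ht hs hr (by simp [hw])
  have h₂ := hc P.idx M (fun a => s + 1 + (P.wires a : ℕ)) hwires
    (Store.get {σ with
      r := rest, wire := fillWires (List.finRange _) (fun a => s + 1 + (P.wires a : ℕ)) σ.wire})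
    ht (by simp)
  have hlen := h₂.2.trans (Nat.mul_le_mul_right (M + 1) (hc' P.idx))
  constructor
  · apply Spec.mono
    · apply Spec.cons h₁
      apply Spec.cons h₂.1
      simp only [Store.update_e, Store.get_e]
      apply Spec.cons (spec_drainWires (M := M) _ _)
      · apply Spec.last (t := 2 * ((∑ g, c g) * (M + 1)) + 1)
        cases rev
        · exact (Spec.skip.congr (by simp [hw])).mono (Nat.zero_le _)
        · simp only [cond_true, he rfl]
          apply Spec.mono
          · apply Spec.congr (Spec.move (by simp))
            simp [hw]
          · simpa using hlen
      · exact length_fillWires_le hwires (by simp [hw])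
    · have := hc' P.idx
      have := har P.idx
      simp only [List.length_finRange]
      have h₃ := Nat.mul_le_mul_right (7 * M + 4) (har P.idx)
      have h₄ := Nat.mul_le_mul_right (M + 1) (hc' P.idx)
      nlinarith
  · refine hlen.trans ?_
    gcongr
    omega

/-- Pop a number `i` in unary off the stack `Var.r` and continue with the `i`-th program. -/
def select : List (Prog (Var m) C) → Prog (Var m) C
  | [] => skip
  | p :: ps => pop .r skip p (select ps)

/-- For the surplus rounds of the loop in `gates`, after all gates have been read. -/
theorem spec_select_nil (ps : List (Prog (Var m) C)) (σ : Store m) (hσ : σ.r = []) :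
    Spec sub (select ps) σ.get σ.get 1 := by
  cases ps with
  | nil => exact Spec.skip.mono (Nat.zero_le _)
  | cons p ps => exact (Spec.pop_nil (show σ.get .r = [] from hσ) Spec.skip).mono (by omega)

theorem spec_select (ps : List (Prog (Var m) C)) (i : ℕ) (hi : i < ps.length) (σ : Store m)
    (rest : List Bool) (hσ : σ.r = unaryCode i ++ rest) {S : Var m → List Bool} {t : ℕ}
    (h : Spec sub ps[i] (Store.get {σ with r := rest}) S t) :
    Spec sub (select ps) σ.get S (t + i + 1) := by
  induction ps generalizing i σ with
  | nil => simp at hi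
  | cons p ps ih =>
    cases i with
    | zero => exact Spec.pop_false (l := rest) (by simp [hσ, unaryCode]) (by simpa using h)
    | succ i =>
      refine (Spec.pop_true (l := unaryCode i ++ rest)
        (by simp [hσ, unaryCode, List.replicate_succ]) ?_)
      rw [Store.update_r]
      exact ih i (by simpa using hi) _ rfl h

/-- Write the circuit `gatesText` to the stack `Var.out`, if the description of `gs` is on the
stack `Var.d`. -/
def gates (har : ∀ g, G.arity g ≤ m) (tmpl : ∀ g, List (PlacedGate G (G.arity g))) (rev : Bool) :
    Prog (Var m) C :=
  block [move₂ .d .t .f, move₂ .t .d .r,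
    loop .f false (select ((List.finRange G.size).map (handler har tmpl rev)))
      (select ((List.finRange G.size).map (handler har tmpl rev))),
    move .e .l, move .l .out]

theorem spec_gates (har : ∀ g, G.arity g ≤ m) (tmpl : ∀ g, List (PlacedGate G (G.arity g)))
    (rev : Bool) : ∃ c : ℕ, ∀ (M s w : ℕ) (_ : s + 1 + w ≤ M) (gs : List (PlacedGate G w))
      (σ : Store m) (_ : σ.t = []) (_ : σ.s = List.replicate s true)
      (_ : σ.wire = fun _ => []) (_ : σ.e = []) (_ : σ.l = []) (_ : σ.r = []) (_ : σ.f = [])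
      (_ : σ.d = (gs.map PlacedGate.encode).flatten) (_ : σ.d.length ≤ M),
      Spec sub (gates har tmpl rev) σ.get (Store.get {σ with
        out := (gatesText tmpl rev s gs).reverse ++ σ.out}) (c * (M + 1) ^ 2) := by
  obtain ⟨c, hc⟩ := spec_handler (sub := sub) har tmpl rev
  refine ⟨5 * c + G.size + 16, fun M s w hM gs σ ht hs hw he hl hr hf hd hdM => ?_⟩
  obtain ⟨x, a, b, d, e, l, r, f, n, cnt, cnt', wid, o, st, t, out, fin, wr⟩ := σ
  dsimp only at ht hs hw he hl hr hf hd hdM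
  subst ht hs hw he hl hr hf
  -- The number of gates is not available as a counter. The loop instead runs once for every bit of
  -- the description, which is often enough since each gate takes at least one bit.
  have hgs : gs.length ≤ d.length := by
    rw [hd, List.length_flatten, List.map_map]
    have := List.card_nsmul_le_sum (gs.map (List.length ∘ PlacedGate.encode)) 1 (by
      intro n hn
      simp only [List.mem_map] at hn
      obtain ⟨P, _, rfl⟩ := hn
      simp only [Function.comp_apply, PlacedGate.encode, unaryCode, List.length_append,
        List.length_singleton]
      omega)
    simpa using this
  have hlen : (gatesText tmpl rev s gs).length ≤ M * (c * (M + 1)) := by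
    rw [gatesText, List.length_flatten, List.map_map]
    refine (List.sum_le_card_nsmul _ (c * (M + 1)) fun n hn => ?_).trans ?_
    · simp only [List.mem_map] at hn
      obtain ⟨P, _, rfl⟩ := hn
      exact (hc M s w hM P [] {Store.empty with
        s := List.replicate s true
        r := ((List.finRange _).map fun a => unaryCode (P.wires a)).flatten ++ []}
        rfl rfl rfl (fun _ => rfl) rfl).2
    · simp only [List.length_map, smul_eq_mul]
      refine Nat.mul_le_mul_right _ (le_trans ?_ (hgs.trans hdM))
      cases rev <;> simp
  -- Invariant after `i` rounds: the first `i` gates have been rewritten and the descriptions of the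
  -- others are on `r`. For `i` beyond the number of gates, `take` and `drop` no longer change, so
  -- the same formula covers the idle rounds.
  have hloop := Spec.loop_forall (sub := sub) (k := Var.f)
    (r := select ((List.finRange G.size).map (handler har tmpl rev)))
    (t := c * (M + 1) + G.size + 1)
    (fun i => Store.get (m := m) ⟨x, a, b, d,
      bif rev then [] else (gatesText tmpl rev s (gs.take i)).reverse,
      bif rev then gatesText tmpl rev s (gs.take i) else [],
      ((gs.drop i).map PlacedGate.encode).flatten,
      [], n, cnt, cnt', wid, o, List.replicate s true, [], out, fin, fun _ => []⟩)
    d.reverse (by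
      intro i _ l'
      simp only [Store.update_f]
      by_cases hi : i < gs.length
      · apply Spec.mono
        · apply spec_select _ (gs[i].idx) (by simp) _
            (((List.finRange _).map fun a => unaryCode (gs[i].wires a)).flatten ++
              ((gs.drop (i + 1)).map PlacedGate.encode).flatten)
          · rw [List.drop_eq_getElem_cons hi]
            simp only [List.map_cons, List.flatten_cons, PlacedGate.encode_eq, List.append_assoc]
          · simp only [List.getElem_map, List.getElem_finRange, Fin.cast_mk, Fin.eta]
            apply Spec.congr (hc M s w hM gs[i] ((gs.drop (i + 1)).map PlacedGate.encode).flatten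
              _ rfl rfl rfl (by intro h; simp [h]) rfl).1
            rw [List.take_succ_eq_append_getElem hi]
            cases rev <;>
              simp only [gatesText, cond_true, cond_false, List.map_append, List.flatten_append,
                List.map_cons, List.map_nil, List.flatten_cons, List.flatten_nil, List.append_nil,
                List.reverse_append, List.reverse_cons, List.reverse_nil, List.nil_append]
        · have := gs[i].idx.2
          omega
      · rw [List.drop_eq_nil_of_le (by omega), List.drop_eq_nil_of_le (by omega),
          List.take_of_length_le (by omega), List.take_of_length_le (by omega)]
        apply Spec.mono
        · apply spec_select_nil
          rfl
        · omega)
  rw [List.drop_eq_nil_of_le (i := d.reverse.length) (by simpa using hgs),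
    List.take_of_length_le (i := d.reverse.length) (by simpa using hgs)] at hloop
  have e₀ : gatesText tmpl rev s ([] : List (PlacedGate G w)) = [] := by
    cases rev <;> simp [gatesText]
  rw [List.drop_zero, ← hd, List.take_zero] at hloop
  simp only [Store.update_f, e₀, List.map_nil, List.flatten_nil,
    List.reverse_nil, Bool.cond_self] at hloop
  apply Spec.mono
  · apply Spec.cons (Spec.move₂ (by simp) (by simp) (by simp))
    simp only [Store.update_d, Store.update_t, Store.update_f, Store.get_d, Store.get_t,
      Store.get_f, List.append_nil]
    apply Spec.cons (Spec.move₂ (by simp) (by simp) (by simp))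
    simp only [Store.update_d, Store.update_t, Store.update_r, Store.get_d, Store.get_t,
      Store.get_r, List.append_nil, List.reverse_reverse]
    apply Spec.cons hloop
    apply Spec.cons (Spec.move (by simp))
    simp only [Store.update_e, Store.update_l, Store.get_e, Store.get_l]
    apply Spec.last
    apply Spec.congr (Spec.move (by simp))
    simp only [Store.update_out, Store.update_l, Store.get_out, Store.get_l]
    cases rev <;> simp
  · have e₁ : (bif rev then [] else (gatesText tmpl rev s gs).reverse).length ≤
        M * (c * (M + 1)) := by
      cases rev
      · simpa using hlen
      · simp
    have e₂ : ((bif rev then [] else (gatesText tmpl rev s gs).reverse).reverse ++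
        (bif rev then gatesText tmpl rev s gs else [])).length ≤ M * (c * (M + 1)) := by
      cases rev
      · simpa using hlen
      · simpa using hlen
    simp only [Store.get_d, Store.get_t, Store.get_e, Store.get_l, List.length_reverse]
    have e₄ : M * (c * (M + 1)) + c * (M + 1) = c * (M + 1) ^ 2 := by ring
    have e₅ : M * G.size ≤ G.size * (M + 1) ^ 2 := by nlinarith [Nat.zero_le (G.size * M)]
    have e₆ : M * 8 + 8 ≤ 8 * (M + 1) ^ 2 := by nlinarith
    have e₇ : (5 * c + G.size + 16) * (M + 1) ^ 2 =
      5 * (c * (M + 1) ^ 2) + G.size * (M + 1) ^ 2 + 16 * (M + 1) ^ 2 := by ring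
    have e₈ : (c * (M + 1) + G.size + 1 + 1) * d.length ≤
        M * (c * (M + 1)) + M * G.size + 2 * M :=
      (Nat.mul_le_mul_left _ hdM).trans_eq (by ring)
    omega

end Prog

end CleanQubit

/-! ### Programs that write text depending on the position of a block. -/

namespace CleanQubit

set_option linter.unusedSectionVars false

variable {G : GateSet} {m : ℕ}

/-- A circuit of which `N` copies are to be combined. -/
structure Setup (G : GateSet) where
  w : ℕ
  N : ℕ
  o : Fin w
  gs : List (PlacedGate G w)

namespace Setup

/-- The contents of the stacks at an intermediate stage, with `s` in unary on the stack
`Var.s`. -/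
def env (m : ℕ) (δ : Setup G) (s : ℕ) (c c' out : List Bool) : Store m where
  x := []
  a := []
  b := []
  d := (δ.gs.map PlacedGate.encode).flatten
  e := []
  l := []
  r := []
  f := []
  n := List.replicate δ.N true
  cnt := c
  cnt' := c'
  wid := List.replicate (δ.w + 1) true
  o := List.replicate δ.o true
  s := List.replicate s true
  t := []
  out := out
  fin := []
  wire := fun _ => []

/-- `M` bounds the size of the data. -/
structure Bounded (δ : Setup G) (M : ℕ) : Prop where
  wires : 1 + (δ.N + 1) * (δ.w + 1) ≤ M
  text : (δ.gs.map PlacedGate.encode).flatten.length ≤ M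

theorem Bounded.le_top {δ : Setup G} {M : ℕ} (h : δ.Bounded M) :
    1 + δ.N * (δ.w + 1) + (δ.w + 1) ≤ M := by
  have := h.wires
  rw [Nat.succ_mul] at this
  omega

theorem Bounded.N_le {δ : Setup G} {M : ℕ} (h : δ.Bounded M) : δ.N ≤ M := by
  have := h.le_top
  nlinarith [Nat.zero_le (δ.N * δ.w)]

theorem Bounded.w_lt {δ : Setup G} {M : ℕ} (h : δ.Bounded M) : δ.w + 1 ≤ M := by
  have := h.le_top
  omega

end Setup

namespace Prog

variable {C : Type} [DecidableEq C]

/-- The program `p` appends the text `f δ s` to the stack `Var.out`, if `s` is on the stack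
`Var.s`, in polynomial time. -/
structure Writes (sub : C → Subroutine) (p : Prog (Var m) C) (f : Setup G → ℕ → List Bool) :
    Prop where
  spec : ∃ c, ∀ (δ : Setup G) (M : ℕ), δ.Bounded M → ∀ s ≤ 1 + δ.N * (δ.w + 1), ∀ n n' out,
    Spec sub p (δ.env m s n n' out).get (δ.env m s n n' ((f δ s).reverse ++ out)).get
      (c * (M + 1) ^ 2)
  safe : p.Safe
  avoids : p.Avoids .cnt ∧ p.Avoids .cnt'

/-- The program `p` appends the text `f δ` to the stack `Var.out` in polynomial time. -/
structure WritesTop (sub : C → Subroutine) (p : Prog (Var m) C) (f : Setup G → List Bool) :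
    Prop where
  spec : ∃ c, ∀ (δ : Setup G) (M : ℕ), δ.Bounded M → ∀ out,
    Spec sub p (δ.env m 0 [] [] out).get (δ.env m 0 [] [] ((f δ).reverse ++ out)).get
      (c * (M + 1) ^ 3)
  safe : p.Safe

variable {sub : C → Subroutine} {p q : Prog (Var m) C} {f g : Setup G → ℕ → List Bool}
  {f' g' : Setup G → List Bool}

theorem Writes.seq (hp : Writes sub p f) (hq : Writes sub q g) :
    Writes sub (seq p q) fun δ s => f δ s ++ g δ s := by
  obtain ⟨c, hc⟩ := hp.spec
  obtain ⟨c', hc'⟩ := hq.spec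
  refine ⟨⟨c + c', fun δ M hM s hs n n' out => ?_⟩, ⟨hp.safe, hq.safe⟩,
    ⟨hp.avoids.1, hq.avoids.1⟩, hp.avoids.2, hq.avoids.2⟩
  rw [add_mul, List.reverse_append, List.append_assoc]
  exact (hc δ M hM s hs n n' out).seq (hc' δ M hM s hs n n' _)

theorem WritesTop.seq (hp : WritesTop sub p f') (hq : WritesTop sub q g') :
    WritesTop sub (seq p q) fun δ => f' δ ++ g' δ := by
  obtain ⟨c, hc⟩ := hp.spec
  obtain ⟨c', hc'⟩ := hq.spec
  refine ⟨⟨c + c', fun δ M hM out => ?_⟩, hp.safe, hq.safe⟩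
  rw [add_mul, List.reverse_append, List.append_assoc]
  exact (hc δ M hM out).seq (hc' δ M hM _)

/-- Between the loops over the blocks the stack `Var.s` is empty, hence the value `0`. The cubic
bound allows for the loops over `N` blocks with bodies of quadratic cost. -/
theorem Writes.top (hp : Writes sub p f) : WritesTop sub p fun δ => f δ 0 := by
  obtain ⟨c, hc⟩ := hp.spec
  refine ⟨⟨c, fun δ M hM out => (hc δ M hM 0 (Nat.zero_le _) [] [] out).mono ?_⟩, hp.safe⟩
  exact Nat.mul_le_mul_left c (Nat.pow_le_pow_right (by omega) (by omega))

theorem safe_replicate_push (k : Var m) (c : ℕ) :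
    (block (List.replicate c (push (C := C) k true skip))).Safe := by
  rw [safe_block]
  intro p hp
  rw [List.eq_of_mem_replicate hp]
  trivial

theorem avoids_replicate_push {k k' : Var m} (h : k ≠ k') (c : ℕ) :
    (block (List.replicate c (push (C := C) k' true skip))).Avoids k := by
  rw [avoids_block]
  intro p hp
  rw [List.eq_of_mem_replicate hp]
  exact ⟨h, trivial⟩

theorem safe_emit {a : ℕ} (ha : a ≤ m) {k : Var m} (hk' : ∀ j, k ≠ .wire j)
    (L : List (PlacedGate G a)) : (emit (C := C) ha k L).Safe := by
  rw [emit, safe_block]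
  intro p hp
  simp only [List.mem_map] at hp
  obtain ⟨P, _, rfl⟩ := hp
  refine ⟨safe_replicate_push _ _, trivial, ?_, trivial⟩
  rw [emitNums, safe_block]
  intro p hp
  simp only [List.mem_map] at hp
  obtain ⟨_, ⟨i, _, rfl⟩, rfl⟩ := hp
  simp [Safe, Avoids, copy, move, move₂, (hk' _).symm]

theorem avoids_emit {a : ℕ} (ha : a ≤ m) {k k' : Var m} (hk : k' ≠ .t) (hk' : ∀ j, k' ≠ .wire j)
    (h : k' ≠ k) (L : List (PlacedGate G a)) : (emit (C := C) ha k L).Avoids k' := by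
  rw [emit, avoids_block]
  intro p hp
  simp only [List.mem_map] at hp
  obtain ⟨P, _, rfl⟩ := hp
  refine ⟨avoids_replicate_push h _, ⟨h, trivial⟩, ?_, trivial⟩
  rw [emitNums, avoids_block]
  intro p hp
  simp only [List.mem_map] at hp
  obtain ⟨_, ⟨i, _, rfl⟩, rfl⟩ := hp
  simp [Avoids, copy, move, move₂, h, hk, hk' _]

theorem safe_drainWires : (drainWires : Prog (Var m) C).Safe := by
  rw [drainWires, safe_block]
  intro p hp
  simp only [List.mem_map] at hp
  obtain ⟨j, _, rfl⟩ := hp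
  simp [drain, Safe, Avoids]

theorem avoids_drainWires {k : Var m} (hk : ∀ j, k ≠ .wire j) :
    (drainWires : Prog (Var m) C).Avoids k := by
  rw [drainWires, avoids_block]
  intro p hp
  simp only [List.mem_map] at hp
  obtain ⟨j, _, rfl⟩ := hp
  simp [drain, Avoids, hk]

theorem writes_emitAt {a : ℕ} (ha : a ≤ m) (L : List (PlacedGate G a))
    (x : Fin a → List (Var m) × ℕ) (hx : ∀ j, ∀ k ∈ (x j).1, k = .s ∨ k = .wid ∨ k = .o) :
    Writes sub (emitAt ha L x)
      fun (δ : Setup G) s => emitText L fun j => numVal (δ.env m s [] [] []).get (x j) := by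
  obtain ⟨c, hc⟩ := spec_emitAt (sub := sub) ha L x (fun j k hk => by
    rcases hx j k hk with rfl | rfl | rfl <;> simp)
  refine ⟨⟨c, fun δ M hM s hs n n' out => ?_⟩, ⟨?_, ?_, safe_drainWires, trivial⟩, ⟨?_, ?_,
    avoids_drainWires (by simp), trivial⟩, ?_, ?_, avoids_drainWires (by simp), trivial⟩
  · have := hM.le_top
    have h := hc M (δ.env m s n n' out) rfl rfl (fun j k hk => by
      have := δ.o.2
      rcases hx j k hk with rfl | rfl | rfl <;> simp [Setup.env] <;> omega)
    refine (h.congr ?_).mono (Nat.mul_le_mul_left c (by nlinarith))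
    have e : (fun j => numVal (δ.env m s n n' out).get (x j)) =
        fun j => numVal (δ.env m s [] [] []).get (x j) := by
      funext j
      unfold numVal
      congr 2
      refine List.map_congr_left fun k hk => ?_
      rcases hx j k hk with rfl | rfl | rfl <;> rfl
    rw [e]
    rfl
  · rw [safe_block]
    intro p hp
    simp only [List.mem_map] at hp
    obtain ⟨j, _, rfl⟩ := hp
    refine ⟨?_, safe_replicate_push _ _⟩
    rw [safe_block]
    intro p hp
    simp only [List.mem_map] at hp
    obtain ⟨k, hk, rfl⟩ := hp
    rcases hx j k hk with rfl | rfl | rfl <;> simp [Safe, Avoids, copy, move, move₂]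
  · exact safe_emit ha (by simp) L
  · rw [avoids_block]
    intro p hp
    simp only [List.mem_map] at hp
    obtain ⟨j, _, rfl⟩ := hp
    refine ⟨?_, avoids_replicate_push (by simp) _⟩
    rw [avoids_block]
    intro p hp
    simp only [List.mem_map] at hp
    obtain ⟨k, hk, rfl⟩ := hp
    rcases hx j k hk with rfl | rfl | rfl <;> simp [Avoids, copy, move, move₂]
  · exact avoids_emit ha (by simp) (by simp) (by simp) L
  · rw [avoids_block]
    intro p hp
    simp only [List.mem_map] at hp
    obtain ⟨j, _, rfl⟩ := hp
    refine ⟨?_, avoids_replicate_push (by simp) _⟩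
    rw [avoids_block]
    intro p hp
    simp only [List.mem_map] at hp
    obtain ⟨k, hk, rfl⟩ := hp
    rcases hx j k hk with rfl | rfl | rfl <;> simp [Avoids, copy, move, move₂]
  · exact avoids_emit ha (by simp) (by simp) (by simp) L

theorem safe_select {ps : List (Prog (Var m) C)} (h : ∀ p ∈ ps, p.Safe) : (select ps).Safe := by
  induction ps with
  | nil => trivial
  | cons p ps ih => exact ⟨trivial, h p (by simp), ih fun q hq => h q (by simp [hq])⟩

theorem avoids_select {k : Var m} (hk : k ≠ .r) {ps : List (Prog (Var m) C)}
    (h : ∀ p ∈ ps, p.Avoids k) : (select ps).Avoids k := by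
  induction ps with
  | nil => trivial
  | cons p ps ih => exact ⟨hk, trivial, h p (by simp), ih fun q hq => h q (by simp [hq])⟩

theorem safe_handler (har : ∀ g, G.arity g ≤ m) (tmpl : ∀ g, List (PlacedGate G (G.arity g)))
    (rev : Bool) (g : Fin G.size) : (handler (C := C) har tmpl rev g).Safe := by
  refine ⟨?_, safe_emit _ (by simp) _, safe_drainWires, ?_, trivial⟩
  · rw [safe_block]
    intro p hp
    simp only [List.mem_map] at hp
    obtain ⟨j, _, rfl⟩ := hp
    simp [readWire, readUnary, block, Safe, Avoids, copy, move, move₂]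
  · cases rev <;> simp [Safe, Avoids, move]

theorem avoids_handler {k : Var m} (h₁ : k ≠ .t) (h₂ : k ≠ .s) (h₃ : k ≠ .r) (h₄ : k ≠ .e)
    (h₅ : k ≠ .l) (h₆ : ∀ j, k ≠ .wire j) (har : ∀ g, G.arity g ≤ m)
    (tmpl : ∀ g, List (PlacedGate G (G.arity g)))
    (rev : Bool) (g : Fin G.size) : (handler (C := C) har tmpl rev g).Avoids k := by
  refine ⟨?_, avoids_emit _ h₁ h₆ h₄ _, avoids_drainWires h₆, ?_, trivial⟩
  · rw [avoids_block]
    intro p hp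
    simp only [List.mem_map] at hp
    obtain ⟨j, _, rfl⟩ := hp
    simp [readWire, readUnary, block, Avoids, copy, move, move₂, h₁, h₂, h₃, h₆ _]
  · cases rev <;> simp [Avoids, move, h₄, h₅]

theorem writes_gates (har : ∀ g, G.arity g ≤ m) (tmpl : ∀ g, List (PlacedGate G (G.arity g)))
    (rev : Bool) : Writes sub (gates har tmpl rev) fun (δ : Setup G) s => gatesText tmpl rev s δ.gs := by
  obtain ⟨c, hc⟩ := spec_gates (sub := sub) har tmpl rev
  have hs : (select ((List.finRange G.size).map (handler (C := C) har tmpl rev))).Safe := by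
    apply safe_select
    intro p hp
    simp only [List.mem_map] at hp
    obtain ⟨g, _, rfl⟩ := hp
    exact safe_handler har tmpl rev g
  have ha : ∀ k : Var m, k ≠ .t → k ≠ .s → k ≠ .r → k ≠ .e → k ≠ .l → (∀ j, k ≠ .wire j) →
      (select ((List.finRange G.size).map (handler (C := C) har tmpl rev))).Avoids k := by
    intro k h₁ h₂ h₃ h₄ h₅ h₆
    apply avoids_select h₃
    intro p hp
    simp only [List.mem_map] at hp
    obtain ⟨g, _, rfl⟩ := hp
    exact avoids_handler h₁ h₂ h₃ h₄ h₅ h₆ har tmpl rev g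
  refine ⟨⟨c, fun δ M hM s hs n n' out => ?_⟩, ?_, ?_, ?_⟩
  · have := hM.le_top
    exact hc M s δ.w (by omega) δ.gs (δ.env m s n n' out) rfl rfl rfl rfl rfl rfl rfl rfl hM.text
  · simp [gates, block, Safe, Avoids, move, move₂, hs, ha]
  · simp [gates, block, Avoids, move, move₂, ha]
  · simp [gates, block, Avoids, move, move₂, ha]

end Prog

end CleanQubit

/-! ### Loops over the blocks in either direction. -/

namespace CleanQubit

set_option linter.unusedSectionVars false

variable {G : GateSet} {m : ℕ}

/-- The texts `f s` for the first qubits `s` of the blocks `0, …, n - 1`. -/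
def upText (f : ℕ → List Bool) (W n : ℕ) : List Bool :=
  ((List.range n).map fun i => f (1 + i * W)).flatten

/-- The texts `f s` for the first qubits `s` of the blocks `N - 1, …, N - n`. -/
def downText (f : ℕ → List Bool) (W N n : ℕ) : List Bool :=
  ((List.range n).map fun i => f (1 + (N - (i + 1)) * W)).flatten

theorem upText_succ (f : ℕ → List Bool) (W n : ℕ) :
    upText f W (n + 1) = upText f W n ++ f (1 + n * W) := by
  simp [upText, List.range_succ]

theorem downText_succ (f : ℕ → List Bool) (W N n : ℕ) :
    downText f W N (n + 1) = downText f W N n ++ f (1 + (N - (n + 1)) * W) := by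
  simp [downText, List.range_succ]

namespace Prog

variable {C : Type} [DecidableEq C]

/-- Run `p` with the number of the first qubit behind all the blocks on the stack `Var.s`. -/
def atTop (p : Prog (Var m) C) : Prog (Var m) C :=
  block [push .s true skip, copy .t .n .cnt, loop .cnt false (copy .t .wid .s) (copy .t .wid .s),
    p, drain .s]

/-- Run `p` for the first qubits of the blocks in ascending order. -/
def up (p : Prog (Var m) C) : Prog (Var m) C :=
  block [push .s true skip, copy .t .n .cnt,
    loop .cnt false (seq p (copy .t .wid .s)) (seq p (copy .t .wid .s)), drain .s]

/-- Move to the previous block and run `p`. -/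
def downStep (p : Prog (Var m) C) : Prog (Var m) C :=
  block [copy .t .wid .cnt', loop .cnt' false (pop .s skip skip skip) (pop .s skip skip skip), p]

/-- Run `p` for the first qubits of the blocks in descending order. -/
def down (p : Prog (Var m) C) : Prog (Var m) C :=
  atTop (block [copy .t .n .cnt, loop .cnt false (downStep p) (downStep p)])

variable {sub : C → Subroutine} {p : Prog (Var m) C} {f : Setup G → ℕ → List Bool}

/-- The final `drain` makes it irrelevant what `p` leaves on `Var.s`, so `s` is arbitrary up to `M`;
in the use for `down` it is `1`, the first qubit of block `0`. -/
theorem spec_atTop (δ : Setup G) {M t : ℕ} (hM : δ.Bounded M) {out out' : List Bool} {s : ℕ}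
    (hs : s ≤ M)
    (h : Spec sub p (δ.env m (1 + δ.N * (δ.w + 1)) [] [] out).get
      (δ.env m s [] [] out').get t) :
    Spec sub (atTop p) (δ.env m 0 [] [] out).get (δ.env m 0 [] [] out').get
      (t + 20 * (M + 1) ^ 2) := by
  have hw := hM.w_lt
  have hN := hM.N_le
  have hloop := Spec.loop_forall (sub := sub) (k := Var.cnt) (r := copy .t .wid .s)
    (t := 5 * M + 2) (fun i => (δ.env m (1 + i * (δ.w + 1)) [] [] out).get)
    (List.replicate δ.N true) (by
      intro i _ l'
      simp only [Store.update_cnt]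
      apply Spec.mono
      · apply Spec.congr (Spec.copy (by simp) (by simp) (by simp) (by rfl))
        simp only [Store.update_s, Store.get_s, Store.get_wid, Setup.env, List.reverse_replicate,
          List.replicate_append_replicate]
        ring_nf
      · simp [Setup.env]
        omega)
  simp only [Store.update_cnt, zero_mul, add_zero, List.length_replicate, Setup.env]
    at hloop
  apply Spec.mono
  · apply Spec.cons Spec.push
    simp only [Store.update_s]
    apply Spec.cons (Spec.copy (by simp) (by simp) (by simp) (by rfl))
    simp only [Store.update_cnt, Store.get_cnt, Store.get_n, Setup.env, List.reverse_replicate,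
      List.append_nil, Store.get_s]
    apply Spec.cons hloop
    apply Spec.cons h
    apply Spec.last
    apply Spec.congr Spec.drain
    rw [Store.update_s]
    rfl
  · simp only [Store.get_n, Setup.env, List.length_replicate, Store.get_s]
    have := Nat.mul_le_mul_left (5 * M + 2 + 1) hN
    nlinarith

theorem Writes.atTop (hp : Writes sub p f) :
    WritesTop sub (atTop p) fun δ => f δ (1 + δ.N * (δ.w + 1)) := by
  obtain ⟨c, hc⟩ := hp.spec
  refine ⟨⟨c + 20, fun δ M hM out => ?_⟩, ?_⟩
  · have := hM.le_top
    refine (spec_atTop δ hM (by omega) (hc δ M hM _ le_rfl [] [] out)).mono ?_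
    rw [← add_mul]
    exact Nat.mul_le_mul_left _ (Nat.pow_le_pow_right (by omega) (by omega))
  · simp [Prog.atTop, block, Safe, Avoids, copy, move, move₂, drain, hp.safe]

theorem Writes.up (hp : Writes sub p f) :
    WritesTop sub (up p) fun δ => upText (f δ) (δ.w + 1) δ.N := by
  obtain ⟨c, hc⟩ := hp.spec
  refine ⟨⟨c + 20, fun δ M hM out => ?_⟩, ?_⟩
  · have hw := hM.w_lt
    have hN := hM.N_le
    have htop := hM.le_top
    have hloop := Spec.loop_forall (sub := sub) (k := Var.cnt) (r := .seq p (copy .t .wid .s))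
      (t := c * (M + 1) ^ 2 + (5 * M + 2))
      (fun i => (δ.env m (1 + i * (δ.w + 1)) [] []
        ((upText (f δ) (δ.w + 1) i).reverse ++ out)).get)
      (List.replicate δ.N true) (by
        intro i hi l'
        rw [List.length_replicate] at hi
        simp only [Store.update_cnt]
        apply Spec.mono
        · apply Spec.seq
          · exact hc δ M hM (1 + i * (δ.w + 1))
              (Nat.add_le_add_left (Nat.mul_le_mul_right _ hi.le) _) l' [] _
          · apply Spec.congr (Spec.copy (by simp) (by simp) (by simp) (by rfl))
            simp only [Store.update_s, Store.get_s, Store.get_wid, Setup.env,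
              List.reverse_replicate, List.replicate_append_replicate, upText_succ,
              List.reverse_append, List.append_assoc]
            ring_nf
        · simp [Setup.env]
          omega)
    simp only [Store.update_cnt, zero_mul, add_zero, List.length_replicate,
      Setup.env] at hloop
    apply Spec.mono
    · apply Spec.cons Spec.push
      simp only [Store.update_s]
      apply Spec.cons (Spec.copy (by simp) (by simp) (by simp) (by rfl))
      simp only [Store.update_cnt, Store.get_cnt, Store.get_n, Setup.env, List.reverse_replicate,
        List.append_nil, Store.get_s]
      apply Spec.cons hloop
      apply Spec.last
      apply Spec.congr Spec.drain
      rw [Store.update_s]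
      rfl
    · simp only [Store.get_n, Setup.env, List.length_replicate, Store.get_s]
      have h₁ := Nat.mul_le_mul_left (c * (M + 1) ^ 2 + (5 * M + 2) + 1) hN
      have h₂ : (c * (M + 1) ^ 2 + (5 * M + 2) + 1) * M + (5 * M + 2) + (M + 10) ≤
          (c + 20) * (M + 1) ^ 3 := by
        nlinarith [Nat.zero_le (c * (M + 1) ^ 2), Nat.zero_le (M ^ 3), Nat.zero_le (M ^ 2)]
      omega
  · simp [Prog.up, block, Safe, Avoids, copy, move, move₂, drain, hp.safe, hp.avoids]

theorem Writes.down (hp : Writes sub p f) :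
    WritesTop sub (down p) fun δ => downText (f δ) (δ.w + 1) δ.N δ.N := by
  obtain ⟨c, hc⟩ := hp.spec
  refine ⟨⟨c + 60, fun δ M hM out => ?_⟩, ?_⟩
  · have hw := hM.w_lt
    have hN := hM.N_le
    have htop := hM.le_top
    -- Stepping back one block is subtraction of `w + 1` in unary: one pop from `Var.s` for each bit
    -- of a copy of `wid`.
    have hpop (s : ℕ) (l' out) (hs : δ.w + 1 ≤ s) : Spec sub
        (loop .cnt' false (pop .s skip skip skip) (pop .s skip skip skip))
        (δ.env m s l' (List.replicate (δ.w + 1) true) out).get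
        (δ.env m (s - (δ.w + 1)) l' [] out).get (2 * M + 1) := by
      have := Spec.loop_forall (sub := sub) (k := Var.cnt') (r := pop .s skip skip skip)
        (t := 1) (fun i => (δ.env m (s - i) l' [] out).get)
        (List.replicate (δ.w + 1) true) (by
          intro i hi l''
          rw [List.length_replicate] at hi
          simp only [Store.update_cnt']
          apply Spec.pop_true (l := List.replicate (s - (i + 1)) true)
          · simp only [Store.get_s, Setup.env, ← List.replicate_succ]
            congr 1
            omega
          · rw [Store.update_s]
            exact Spec.skip)
      simp only [Store.update_cnt', List.length_replicate] at this
      exact this.mono (by omega)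
    have hloop := Spec.loop_forall (sub := sub) (k := Var.cnt) (r := downStep p)
      (t := (5 * M + 2) + ((2 * M + 1) + c * (M + 1) ^ 2))
      (fun i => (δ.env m (1 + (δ.N - i) * (δ.w + 1)) [] []
        ((downText (f δ) (δ.w + 1) δ.N i).reverse ++ out)).get)
      (List.replicate δ.N true) (by
        intro i hi l'
        rw [List.length_replicate] at hi
        simp only [Store.update_cnt]
        have e : 1 + (δ.N - i) * (δ.w + 1) - (δ.w + 1) = 1 + (δ.N - (i + 1)) * (δ.w + 1) := by
          rw [show δ.N - i = δ.N - (i + 1) + 1 by omega, Nat.succ_mul]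
          omega
        have h₁ := hpop (1 + (δ.N - i) * (δ.w + 1)) l'
          ((downText (f δ) (δ.w + 1) δ.N i).reverse ++ out) (by
            rw [show δ.N - i = δ.N - (i + 1) + 1 by omega, Nat.succ_mul]
            omega)
        rw [e] at h₁
        apply Spec.mono
        · apply Spec.cons (Spec.copy (by simp) (by simp) (by simp) (by rfl))
          simp only [Store.update_cnt', Store.get_cnt', Store.get_wid]
          simp only [Setup.env, List.reverse_replicate, List.append_nil]
          apply Spec.cons h₁
          apply Spec.last
          refine (hc δ M hM (1 + (δ.N - (i + 1)) * (δ.w + 1))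
            (Nat.add_le_add_left (Nat.mul_le_mul_right _ (Nat.sub_le _ _)) _) l' [] _).congr ?_
          rw [downText_succ, List.reverse_append, List.append_assoc]
          rfl
        · simp [Setup.env]
          omega)
    simp only [Store.update_cnt, List.length_replicate, Nat.sub_zero,
      Setup.env] at hloop
    apply Spec.mono
    · apply spec_atTop (s := 1) δ hM (by omega)
      apply Spec.cons (Spec.copy (by simp) (by simp) (by simp) (by rfl))
      simp only [Store.update_cnt, Store.get_cnt, Store.get_n]
      simp only [Setup.env, List.reverse_replicate, List.append_nil]
      apply Spec.last
      apply Spec.congr hloop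
      simp
    · simp only [Store.get_n, Setup.env, List.length_replicate]
      have h₁ := Nat.mul_le_mul_left ((5 * M + 2) + ((2 * M + 1) + c * (M + 1) ^ 2) + 1) hN
      have h₂ : ((5 * M + 2) + ((2 * M + 1) + c * (M + 1) ^ 2) + 1) * M + (5 * M + 2) + 10 +
          20 * (M + 1) ^ 2 ≤ (c + 60) * (M + 1) ^ 3 := by
        nlinarith [Nat.zero_le (c * (M + 1) ^ 2), Nat.zero_le (M ^ 3), Nat.zero_le (M ^ 2)]
      omega
  · simp [Prog.down, Prog.atTop, downStep, block, Safe, Avoids, copy, move, move₂, drain,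
      hp.safe, hp.avoids]

end Prog

end CleanQubit

/-! ### The combined circuit and its description. -/

namespace CleanQubit

variable {G : GateSet}

/-- The circuit `L` on the qubits given by `e`. -/
def place {a w : ℕ} (L : List (PlacedGate G a)) (e : Fin a ↪ Fin w) : List (PlacedGate G w) :=
  L.map fun P => ⟨P.idx, P.wires.trans e⟩

/-- Description of a series of gates. -/
def encodeList {w : ℕ} (L : List (PlacedGate G w)) : List Bool :=
  (L.map PlacedGate.encode).flatten

theorem encodeList_append {w : ℕ} (L L' : List (PlacedGate G w)) :
    encodeList (L ++ L') = encodeList L ++ encodeList L' := by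
  simp [encodeList]

theorem encodeList_place {a w : ℕ} (L : List (PlacedGate G a)) (e : Fin a ↪ Fin w) :
    encodeList (place L e) = emitText L fun j => e j := by
  simp [encodeList, place, emitText, PlacedGate.encode_eq, Function.comp_def]

theorem encodeList_flatMap {w : ℕ} {α : Type} (l : List α) (f : α → List (PlacedGate G w)) :
    encodeList (l.flatMap f) = (l.map fun x => encodeList (f x)).flatten := by
  induction l with
  | nil => rfl
  | cons x l ih => rw [List.flatMap_cons, encodeList_append, ih]; rfl

/-- The circuits `f 0, …, f (N - 1)` in a row. -/
def ascend {α : Type} {N : ℕ} (f : Fin N → List α) : List α := (List.finRange N).flatMap f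

/-- The circuits `f (N - 1), …, f 0` in a row. -/
def descend {α : Type} {N : ℕ} (f : Fin N → List α) : List α :=
  (List.finRange N).flatMap fun i => f i.rev

theorem map_finRange_eq {β : Type} {N : ℕ} (g : ℕ → β) :
    (List.finRange N).map (fun i : Fin N => g i) = (List.range N).map g := by
  apply List.ext_getElem <;> simp

theorem encodeList_ascend {w N W : ℕ} {f : Fin N → List (PlacedGate G w)} {g : ℕ → List Bool}
    (h : ∀ i, encodeList (f i) = g (1 + i * W)) : encodeList (ascend f) = upText g W N := by
  rw [ascend, encodeList_flatMap, upText]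
  simp only [h]
  rw [map_finRange_eq fun i => g (1 + i * W)]

theorem encodeList_descend {w N W : ℕ} {f : Fin N → List (PlacedGate G w)} {g : ℕ → List Bool}
    (h : ∀ i, encodeList (f i) = g (1 + i * W)) :
    encodeList (descend f) = downText g W N N := by
  rw [descend, encodeList_flatMap, downText]
  simp only [h, Fin.val_rev]
  rw [map_finRange_eq fun i => g (1 + (N - (i + 1)) * W)]

/-- Circuits over `G` that are meant to implement the Hadamard, `T`, NOT, controlled-NOT and
Toffoli gates and the inverses of the gates in `G`. -/
structure Gadgets (G : GateSet) where
  h : List (PlacedGate G 1)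
  t : List (PlacedGate G 1)
  x : List (PlacedGate G 1)
  cx : List (PlacedGate G 2)
  tof : List (PlacedGate G 3)
  inv : ∀ g, List (PlacedGate G (G.arity g))

/-- The series of gates which, on its own, is the `g`-th gate. -/
def GateSet.self (G : GateSet) (g : Fin G.size) : List (PlacedGate G (G.arity g)) :=
  [⟨g, Function.Embedding.refl _⟩]

/-- The circuit in which each gate `P` of `gs` is replaced by `tmpl P.idx`. -/
def subst (tmpl : ∀ g, List (PlacedGate G (G.arity g))) {w : ℕ} (gs : List (PlacedGate G w)) :
    List (PlacedGate G w) := gs.flatMap fun P => place (tmpl P.idx) P.wires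

/-- `k` copies of the circuit `L` in a row. -/
def power {α : Type} (k : ℕ) (L : List α) : List α := (List.replicate k L).flatten

namespace Setup

variable (δ : Setup G)

/-- The number of qubits of the combined circuit: a clean qubit, and `N` blocks that consist of an
ancilla and `w` further qubits, followed by another ancilla. -/
abbrev width : ℕ := δ.N * (δ.w + 1) + 2

/-- The qubits of a block, with the ancilla that follows it. -/
def block (i : Fin δ.N) : Fin (δ.w + 2) ↪ Fin δ.width where
  toFun j := ⟨1 + i * (δ.w + 1) + j, by
    have h : (i + 1) * (δ.w + 1) ≤ δ.N * (δ.w + 1) := Nat.mul_le_mul_right _ i.2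
    rw [Nat.succ_mul] at h
    have := j.2
    unfold width
    omega⟩
  inj' j j' h := by
    simp only [Fin.mk.injEq] at h
    exact Fin.ext (by omega)

/-- The `j`-th qubit of a block. -/
def inner : Fin δ.w ↪ Fin (δ.w + 2) where
  toFun j := ⟨1 + j, by omega⟩
  inj' j j' h := by
    simp only [Fin.mk.injEq] at h
    exact Fin.ext (by omega)

@[simp] theorem val_block (i : Fin δ.N) (j : Fin (δ.w + 2)) :
    (δ.block i j : ℕ) = 1 + i * (δ.w + 1) + j := rfl

@[simp] theorem val_inner (j : Fin δ.w) : (δ.inner j : ℕ) = 1 + j := rfl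

/-- The qubits on which the `i`-th copy acts. -/
def register (i : Fin δ.N) : Fin δ.w ↪ Fin δ.width := δ.inner.trans (δ.block i)

/-- The `i`-th ancilla. -/
def ancilla (i : ℕ) : Fin δ.width := Fin.ofNat _ (1 + i * (δ.w + 1))

theorem val_ancilla {i : ℕ} (hi : i ≤ δ.N) : (δ.ancilla i : ℕ) = 1 + i * (δ.w + 1) := by
  have := Nat.mul_le_mul_right (δ.w + 1) hi
  exact Nat.mod_eq_of_lt (by unfold width; omega)

/-- A single qubit. -/
def single {w : ℕ} (i : Fin w) : Fin 1 ↪ Fin w := ⟨fun _ => i, fun _ _ _ => Subsingleton.elim _ _⟩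

@[simp] theorem single_apply {w : ℕ} (i : Fin w) (j : Fin 1) : single i j = i := rfl

/-- Two qubits. -/
def pair {w : ℕ} (i j : Fin w) (h : i ≠ j) : Fin 2 ↪ Fin w :=
  ⟨![i, j], by
    intro a b
    fin_cases a <;> fin_cases b <;> simp [h, h.symm]⟩

@[simp] theorem pair_apply {w : ℕ} (i j : Fin w) (h : i ≠ j) (a : Fin 2) :
    pair i j h a = ![i, j] a := rfl

/-- Three qubits. -/
def triple {w : ℕ} (i j k : Fin w) (h : i ≠ j) (h' : i ≠ k) (h'' : j ≠ k) : Fin 3 ↪ Fin w :=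
  ⟨![i, j, k], by
    intro a b
    fin_cases a <;> fin_cases b <;> simp [h, h.symm, h', h'.symm, h'', h''.symm]⟩

@[simp] theorem triple_apply {w : ℕ} (i j k : Fin w) (h : i ≠ j) (h' : i ≠ k) (h'' : j ≠ k)
    (a : Fin 3) : triple i j k h h' h'' a = ![i, j, k] a := rfl

theorem inner_ne_zero (k : Fin δ.w) : 0 ≠ δ.inner k := by
  rw [Ne, Fin.ext_iff]
  simp
  omega

theorem inner_ne_last (k : Fin δ.w) : δ.inner k ≠ Fin.last _ := by
  rw [Ne, Fin.ext_iff]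
  have := k.2
  simp
  omega

theorem ancilla_ne_zero {i : ℕ} (hi : i ≤ δ.N) : δ.ancilla i ≠ 0 := by
  rw [Ne, Fin.ext_iff, δ.val_ancilla hi]
  simp

variable (T : Gadgets G)

/-- Toffoli gate in the `i`-th block, controlled by the ancilla and qubit `k` of the register. -/
def toffoli (k : Fin δ.w) (i : Fin δ.N) : List (PlacedGate G δ.width) :=
  place T.tof ((triple 0 (δ.inner k) (Fin.last _) (δ.inner_ne_zero k)
    (by simp) (δ.inner_ne_last k)).trans (δ.block i))

/-- The circuit that adds to each of the ancillas the conjunction of the qubits `k` of the previous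
registers. -/
def chain (k : Fin δ.w) : List (PlacedGate G δ.width) :=
  descend (δ.toffoli T k) ++ (place T.x (single (δ.ancilla 0)) ++ ascend (δ.toffoli T k))

/-- Add the last ancilla to the clean qubit. -/
def link : List (PlacedGate G δ.width) :=
  place T.cx (pair (δ.ancilla δ.N) 0 (δ.ancilla_ne_zero le_rfl))

/-- The circuit that adds to the clean qubit the conjunction of the qubits `k` of all registers. -/
def flipIf (k : Fin δ.w) : List (PlacedGate G δ.width) :=
  δ.link T ++ (δ.chain T k ++ (δ.link T ++ δ.chain T k))

/-- The first qubit of the original circuit. -/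
def zero : Fin δ.w := ⟨0, δ.o.pos⟩

/-- Apply the original circuit to a register, with the input and the output qubits negated. -/
def forward (i : Fin δ.N) : List (PlacedGate G δ.width) :=
  place T.x (single (δ.register i δ.zero)) ++
    (place (subst G.self δ.gs) (δ.register i) ++ place T.x (single (δ.register i δ.o)))

/-- Apply the inverse of the original circuit to a register. -/
def backward (i : Fin δ.N) : List (PlacedGate G δ.width) :=
  place T.x (single (δ.register i δ.o)) ++
    (place (subst T.inv δ.gs.reverse) (δ.register i) ++ place T.x (single (δ.register i δ.zero)))

/-- The gates of the combined circuit. -/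
def gates : List (PlacedGate G δ.width) :=
  place (T.h ++ power 7 T.t) (single 0) ++ (δ.flipIf T δ.zero ++ (place T.t (single 0) ++
    (ascend (δ.forward T) ++ (δ.flipIf T δ.o ++ (ascend (δ.backward T) ++
      (place (power 7 T.t) (single 0) ++ (δ.flipIf T δ.zero ++
        place (power 5 T.t ++ T.h) (single 0))))))))

/-- The combined circuit. -/
def circuit : Circuit G := ⟨δ.width, 0, δ.gates T⟩

end Setup

/-- Links the text produced by the rewriting program to the circuit whose operator is analysed:
`place` with `e` renumbers the qubits by the same shift `s + 1`. -/
theorem gatesText_eq (tmpl : ∀ g, List (PlacedGate G (G.arity g))) (rev : Bool) (s : ℕ) {w w' : ℕ}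
    (gs : List (PlacedGate G w)) (e : Fin w ↪ Fin w') (he : ∀ j, (e j : ℕ) = s + 1 + j) :
    gatesText tmpl rev s gs =
      encodeList (place (subst tmpl (bif rev then gs.reverse else gs)) e) := by
  rw [gatesText]
  generalize (bif rev then gs.reverse else gs) = L
  induction L with
  | nil => rfl
  | cons P L ih =>
    have e₁ : place (subst tmpl (P :: L)) e =
        place (tmpl P.idx) (P.wires.trans e) ++ place (subst tmpl L) e := by
      simp [place, subst, Function.Embedding.trans_assoc]
    rw [e₁, encodeList_append, ← ih, encodeList_place]
    simp [he]

namespace Setup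

variable (δ : Setup G) (T : Gadgets G)

/-- Description of the Toffoli gate in the block with first qubit `s`, for the control at `k`. -/
def toffoliText (k s : ℕ) : List Bool := emitText T.tof ![s, s + 1 + k, s + (δ.w + 1)]

theorem encodeList_toffoli (k : Fin δ.w) (i : Fin δ.N) :
    encodeList (δ.toffoli T k i) = δ.toffoliText T k (1 + i * (δ.w + 1)) := by
  rw [toffoli, encodeList_place, toffoliText]
  congr 1
  funext j
  fin_cases j <;> simp
  omega

/-- Description of `Setup.chain`. -/
def chainText (k : ℕ) : List Bool :=
  downText (δ.toffoliText T k) (δ.w + 1) δ.N δ.N ++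
    (emitText T.x ![1] ++ upText (δ.toffoliText T k) (δ.w + 1) δ.N)

theorem encodeList_chain (k : Fin δ.w) : encodeList (δ.chain T k) = δ.chainText T k := by
  rw [chain, encodeList_append, encodeList_append, encodeList_descend (δ.encodeList_toffoli T k),
    encodeList_ascend (δ.encodeList_toffoli T k), encodeList_place, chainText]
  congr 3
  funext j
  fin_cases j
  simp [δ.val_ancilla (Nat.zero_le _)]

/-- Description of `Setup.link`. -/
def linkText : List Bool := emitText T.cx ![1 + δ.N * (δ.w + 1), 0]

theorem encodeList_link : encodeList (δ.link T) = δ.linkText T := by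
  rw [link, encodeList_place, linkText]
  congr 1
  funext j
  fin_cases j <;> simp [δ.val_ancilla le_rfl]

/-- Description of `Setup.flipIf`. -/
def flipIfText (k : ℕ) : List Bool :=
  δ.linkText T ++ (δ.chainText T k ++ (δ.linkText T ++ δ.chainText T k))

/-- Description of `Setup.forward`. -/
def forwardText (s : ℕ) : List Bool :=
  emitText T.x ![s + 1] ++ (gatesText G.self false s δ.gs ++ emitText T.x ![s + 1 + δ.o])

theorem register_val (i : Fin δ.N) (j : Fin δ.w) :
    (δ.register i j : ℕ) = 1 + i * (δ.w + 1) + 1 + j := by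
  simp [register, add_assoc]

theorem encodeList_x (i : Fin δ.N) (j : Fin δ.w) {s : ℕ} (hs : s = (δ.register i j : ℕ)) :
    encodeList (place T.x (single (δ.register i j))) = emitText T.x ![s] := by
  rw [encodeList_place]
  congr 1
  funext j'
  fin_cases j'
  simp [hs]

theorem encodeList_forward (i : Fin δ.N) :
    encodeList (δ.forward T i) = δ.forwardText T (1 + i * (δ.w + 1)) := by
  rw [forward, encodeList_append, encodeList_append, forwardText,
    gatesText_eq _ _ _ _ (δ.register i) (δ.register_val i), δ.encodeList_x T i δ.o rfl,
    δ.encodeList_x T i δ.zero rfl, register_val, register_val]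
  rfl

/-- Description of `Setup.backward`. -/
def backwardText (s : ℕ) : List Bool :=
  emitText T.x ![s + 1 + δ.o] ++ (gatesText T.inv true s δ.gs ++ emitText T.x ![s + 1])

theorem encodeList_backward (i : Fin δ.N) :
    encodeList (δ.backward T i) = δ.backwardText T (1 + i * (δ.w + 1)) := by
  rw [backward, encodeList_append, encodeList_append, backwardText,
    gatesText_eq _ _ _ _ (δ.register i) (δ.register_val i), δ.encodeList_x T i δ.o rfl,
    δ.encodeList_x T i δ.zero rfl, register_val, register_val]
  rfl

theorem encodeList_flipIf (k : Fin δ.w) : encodeList (δ.flipIf T k) = δ.flipIfText T k := by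
  simp only [flipIf, flipIfText, encodeList_append, encodeList_link, encodeList_chain]

theorem encodeList_single {w : ℕ} (L : List (PlacedGate G 1)) (i : Fin w) :
    encodeList (place L (single i)) = emitText L ![(i : ℕ)] := by
  rw [encodeList_place]
  congr 1
  funext j
  fin_cases j
  rfl

/-- The right-hand side mentions only constants, `δ.o` and texts indexed by the first qubit of a
block, which is the form the programs can write; no proof that qubits are distinct occurs in it. -/
theorem encodeList_gates : encodeList (δ.gates T) =
    emitText (T.h ++ power 7 T.t) ![0] ++ (δ.flipIfText T 0 ++ (emitText T.t ![0] ++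
      (upText (δ.forwardText T) (δ.w + 1) δ.N ++ (δ.flipIfText T δ.o ++
        (upText (δ.backwardText T) (δ.w + 1) δ.N ++ (emitText (power 7 T.t) ![0] ++
          (δ.flipIfText T 0 ++ emitText (power 5 T.t ++ T.h) ![0]))))))) := by
  simp only [gates, encodeList_append, encodeList_flipIf, encodeList_single,
    encodeList_ascend (δ.encodeList_forward T), encodeList_ascend (δ.encodeList_backward T)]
  rfl

end Setup

end CleanQubit

/-! ### Uniform generation of the combined circuits. -/

namespace CleanQubit

set_option linter.unusedSectionVars false

open Turing

namespace Prog

theorem length_loopDen_le {K : Type} [DecidableEq K] (k₀ k : K) (s : Bool)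
    {f g : (K → List Bool) → K → List Bool} {cf cg : (K → List Bool) → ℕ}
    (hf : ∀ S, (f S k₀).length ≤ (S k₀).length + cf S)
    (hg : ∀ S, (g S k₀).length ≤ (S k₀).length + cg S)
    (hfg : ∀ S, f S k = S k ∧ g S k = S k) (l : List Bool) (S : K → List Bool)
    (hl : l.length ≤ (S k).length) :
    (loopDen k s f g l S k₀).length ≤ (S k₀).length + loopCost k s f g cf cg l S := by
  have hup : ∀ (l : List Bool) (S : K → List Bool), l.length ≤ (S k).length →
      (Function.update S k l k₀).length ≤ (S k₀).length := by
    intro l S hl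
    by_cases h : k₀ = k
    · subst h
      simpa using hl
    · rw [Function.update_of_ne h]
  induction l generalizing S with
  | nil => exact (hup [] S (Nat.zero_le _)).trans (Nat.le_add_right _ _)
  | cons a l ih =>
    have h₀ := hup l S (Nat.le_of_succ_le hl)
    cases a
    · rw [loopDen, loopCost]
      split
      · omega
      · have h₁ := ih (f (Function.update S k l)) (by rw [(hfg _).1, Function.update_self])
        have h₂ := hf (Function.update S k l)
        omega
    · rw [loopDen, loopCost]
      have h₁ := ih (g (Function.update S k l)) (by rw [(hfg _).2, Function.update_self])
      have h₂ := hg (Function.update S k l)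
      omega

/-- Each push costs a step, and the cost of a call includes the length of the output it delivers, so
no stack can grow by more than the time spent. -/
theorem length_den_le {K C : Type} [DecidableEq K] [DecidableEq C] {sub : C → Subroutine}
    {p : Prog K C} (hp : p.WF sub) (S : K → List Bool) (k₀ : K) :
    (den sub p S k₀).length ≤ (S k₀).length + cost sub p S := by
  have hup : ∀ (l : List Bool) (S : K → List Bool) (k : K) (c : ℕ), l.length ≤ (S k).length + c →
      (Function.update S k l k₀).length ≤ (S k₀).length + c := by
    intro l S k c hl
    by_cases h : k₀ = k
    · subst h
      simpa using hl
    · rw [Function.update_of_ne h]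
      omega
  induction p generalizing S with
  | skip => exact Nat.le_add_right _ _
  | push k a p ih =>
    have h₁ := ih hp (Function.update S k (a :: S k))
    have h₂ := hup (a :: S k) S k 1 (by simp)
    rw [den, cost]
    omega
  | seq p q ih ih' =>
    have h₁ := ih hp.1 S
    have h₂ := ih' hp.2 (den sub p S)
    rw [den, cost]
    omega
  | pop k p q r ih ih' ih'' =>
    rcases hS : S k with _ | ⟨_ | _, l⟩
    · have h₁ := ih hp.1 S
      simp only [den, cost, hS]
      omega
    · have h₁ := ih' hp.2.1 (Function.update S k l)
      have h₂ := hup l S k 0 (by simp [hS])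
      simp only [den, cost, hS]
      omega
    · have h₁ := ih'' hp.2.2 (Function.update S k l)
      have h₂ := hup l S k 0 (by simp [hS])
      simp only [den, cost, hS]
      omega
  | loop k s q r ih ih' =>
    exact length_loopDen_le k₀ k s (ih hp.1) (ih' hp.2.1) hp.2.2 (S k) S le_rfl
  | call c k k' =>
    have h₁ := hup [] S k 0 (Nat.zero_le _)
    have h₂ : ∀ l : List Bool, (Function.update (Function.update S k []) k'
        (l ++ Function.update S k [] k') k₀).length ≤
          (Function.update S k [] k₀).length + l.length := by
      intro l
      by_cases h : k₀ = k'
      · subst h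
        simp [Nat.add_comm]
      · rw [Function.update_of_ne h]
        omega
    have h₃ := h₂ ((sub c).fn (S k).reverse).reverse
    rw [List.length_reverse] at h₃
    rw [den, cost]
    omega

variable {G : GateSet} {m : ℕ} {C : Type} [DecidableEq C] {sub : C → Subroutine}

theorem Writes.congr {p : Prog (Var m) C} {f g : Setup G → ℕ → List Bool} (hp : Writes sub p f)
    (h : ∀ δ s, f δ s = g δ s) : Writes sub p g := by
  rwa [show f = g from funext fun δ => funext fun s => h δ s] at hp

theorem WritesTop.congr {p : Prog (Var m) C} {f g : Setup G → List Bool} (hp : WritesTop sub p f)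
    (h : ∀ δ, f δ = g δ) : WritesTop sub p g := by
  rwa [show f = g from funext fun δ => h δ] at hp

/-- Write the description of the Toffoli gate in a block, with the control given by `x`. -/
def toffoliProg (hm : 3 ≤ m) (T : Gadgets G) (x : List (Var m) × ℕ) : Prog (Var m) C :=
  emitAt hm T.tof ![([.s], 0), x, ([.s, .wid], 0)]

/-- Write the description of a circuit on one qubit, given by `x`. -/
def oneProg (hm : 3 ≤ m) (L : List (PlacedGate G 1)) (x : List (Var m) × ℕ) : Prog (Var m) C :=
  emitAt (by omega) L ![x]

/-- Write the description of `Setup.chain`. -/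
def chainProg (hm : 3 ≤ m) (T : Gadgets G) (x : List (Var m) × ℕ) : Prog (Var m) C :=
  seq (down (toffoliProg hm T x)) (seq (oneProg hm T.x ([], 1)) (up (toffoliProg hm T x)))

/-- Write the description of `Setup.link`. -/
def linkProg (hm : 3 ≤ m) (T : Gadgets G) : Prog (Var m) C :=
  atTop (emitAt (by omega) T.cx ![([.s], 0), ([], 0)])

/-- Write the description of `Setup.flipIf`. -/
def flipIfProg (hm : 3 ≤ m) (T : Gadgets G) (x : List (Var m) × ℕ) : Prog (Var m) C :=
  seq (linkProg hm T) (seq (chainProg hm T x) (seq (linkProg hm T) (chainProg hm T x)))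

/-- Write the description of `Setup.forward`. -/
def forwardProg (hm : 3 ≤ m) (har : ∀ g, G.arity g ≤ m) (T : Gadgets G) : Prog (Var m) C :=
  seq (oneProg hm T.x ([.s], 1)) (seq (gates har G.self false) (oneProg hm T.x ([.s, .o], 1)))

/-- Write the description of `Setup.backward`. -/
def backwardProg (hm : 3 ≤ m) (har : ∀ g, G.arity g ≤ m) (T : Gadgets G) : Prog (Var m) C :=
  seq (oneProg hm T.x ([.s, .o], 1)) (seq (gates har T.inv true) (oneProg hm T.x ([.s], 1)))

/-- Write the description of `Setup.gates`. -/
def gatesProg (hm : 3 ≤ m) (har : ∀ g, G.arity g ≤ m) (T : Gadgets G) : Prog (Var m) C :=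
  seq (oneProg hm (T.h ++ power 7 T.t) ([], 0)) (seq (flipIfProg hm T ([.s], 1))
    (seq (oneProg hm T.t ([], 0)) (seq (up (forwardProg hm har T))
      (seq (flipIfProg hm T ([.s, .o], 1)) (seq (up (backwardProg hm har T))
        (seq (oneProg hm (power 7 T.t) ([], 0)) (seq (flipIfProg hm T ([.s], 1))
          (oneProg hm (power 5 T.t ++ T.h) ([], 0)))))))))

/-- Write the description of the width and the output qubit. -/
def headerProg : Prog (Var m) C :=
  atTop (block [copy .t .s .out, push .out true skip, push .out false skip, push .out false skip])

theorem writes_oneProg (hm : 3 ≤ m) (L : List (PlacedGate G 1)) {x : List (Var m) × ℕ}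
    (hx : ∀ k ∈ x.1, k = .s ∨ k = .wid ∨ k = .o) {f : Setup G → ℕ → ℕ}
    (hf : ∀ δ s, numVal (δ.env m s [] [] []).get x = f δ s) :
    Writes sub (oneProg hm L x) fun δ s => emitText L ![f δ s] := by
  refine (writes_emitAt _ L ![x] (by simpa using hx)).congr fun δ s => ?_
  congr 1
  funext j
  fin_cases j
  exact hf δ s

theorem writes_toffoliProg (hm : 3 ≤ m) (T : Gadgets G) {x : List (Var m) × ℕ}
    (hx : ∀ k ∈ x.1, k = .s ∨ k = .wid ∨ k = .o) {k : Setup G → ℕ}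
    (hk : ∀ δ s, numVal (δ.env m s [] [] []).get x = s + 1 + k δ) :
    Writes sub (toffoliProg hm T x) fun δ => δ.toffoliText T (k δ) := by
  refine (writes_emitAt hm T.tof _ ?_).congr fun δ s => ?_
  · intro j
    fin_cases j
    · simp
    · exact hx
    · simp
  · rw [Setup.toffoliText]
    congr 1
    funext j
    fin_cases j
    · simp [numVal, Setup.env]
    · exact hk δ s
    · simp [numVal, Setup.env]

theorem writesTop_chainProg (hm : 3 ≤ m) (T : Gadgets G) {x : List (Var m) × ℕ}
    (hx : ∀ k ∈ x.1, k = .s ∨ k = .wid ∨ k = .o) {k : Setup G → ℕ}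
    (hk : ∀ δ s, numVal (δ.env m s [] [] []).get x = s + 1 + k δ) :
    WritesTop sub (chainProg hm T x) fun δ => δ.chainText T (k δ) := by
  have h := writes_toffoliProg (sub := sub) hm T hx hk
  exact h.down.seq (((writes_oneProg hm T.x (by simp) (f := fun _ _ => 1)
    (fun _ _ => rfl)).top).seq h.up)

theorem writesTop_linkProg (hm : 3 ≤ m) (T : Gadgets G) :
    WritesTop sub (linkProg hm T) fun δ => δ.linkText T := by
  refine (writes_emitAt _ T.cx _ ?_).atTop.congr fun δ => ?_
  · intro j
    fin_cases j <;> simp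
  · rw [Setup.linkText]
    congr 1
    funext j
    fin_cases j <;> simp [numVal, Setup.env]

theorem writesTop_flipIfProg (hm : 3 ≤ m) (T : Gadgets G) {x : List (Var m) × ℕ}
    (hx : ∀ k ∈ x.1, k = .s ∨ k = .wid ∨ k = .o) {k : Setup G → ℕ}
    (hk : ∀ δ s, numVal (δ.env m s [] [] []).get x = s + 1 + k δ) :
    WritesTop sub (flipIfProg hm T x) fun δ => δ.flipIfText T (k δ) :=
  (writesTop_linkProg hm T).seq ((writesTop_chainProg hm T hx hk).seq
    ((writesTop_linkProg hm T).seq (writesTop_chainProg hm T hx hk)))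

theorem numVal_s (δ : Setup G) (s : ℕ) : numVal (δ.env m s [] [] []).get ([.s], 1) = s + 1 := by
  simp [numVal, Setup.env, Nat.add_comm]

theorem numVal_s_o (δ : Setup G) (s : ℕ) :
    numVal (δ.env m s [] [] []).get ([.s, .o], 1) = s + 1 + δ.o := by
  simp [numVal, Setup.env]
  omega

theorem writesTop_gatesProg (hm : 3 ≤ m) (har : ∀ g, G.arity g ≤ m) (T : Gadgets G) :
    WritesTop sub (gatesProg hm har T) fun δ => encodeList (δ.gates T) := by
  have hc (L : List (PlacedGate G 1)) :
      WritesTop sub (oneProg hm L ([], 0)) fun _ : Setup G => emitText L ![0] :=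
    (writes_oneProg hm L (by simp) (f := fun _ _ => 0) fun _ _ => rfl).top
  have hz : Writes sub (oneProg hm T.x ([.s], 1)) fun _ : Setup G => fun s =>
      emitText T.x ![s + 1] := writes_oneProg hm T.x (by simp) numVal_s
  have ho : Writes sub (oneProg hm T.x ([.s, .o], 1)) fun (δ : Setup G) s =>
      emitText T.x ![s + 1 + δ.o] := writes_oneProg hm T.x (by simp) numVal_s_o
  have hP : WritesTop sub (flipIfProg hm T ([.s], 1)) fun δ => δ.flipIfText T 0 :=
    writesTop_flipIfProg hm T (by simp) numVal_s
  have hR : WritesTop sub (flipIfProg hm T ([.s, .o], 1)) fun δ => δ.flipIfText T δ.o :=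
    writesTop_flipIfProg hm T (by simp) numVal_s_o
  have hF : Writes sub (forwardProg hm har T) fun δ => δ.forwardText T :=
    hz.seq ((writes_gates har G.self false).seq ho)
  have hB : Writes sub (backwardProg hm har T) fun δ => δ.backwardText T :=
    ho.seq ((writes_gates har T.inv true).seq hz)
  refine ((hc _).seq (hP.seq ((hc _).seq (hF.up.seq (hR.seq (hB.up.seq ((hc _).seq
    (hP.seq (hc _))))))))).congr fun δ => ?_
  rw [Setup.encodeList_gates]

theorem writesTop_headerProg : WritesTop (m := m) (G := G) sub headerProg
    fun δ => unaryCode δ.width ++ unaryCode 0 := by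
  have h : Writes (m := m) (G := G) sub
      (block [copy .t .s .out, push .out true skip, push .out false skip, push .out false skip])
      fun _ s => unaryCode (s + 1) ++ unaryCode 0 := by
    refine ⟨⟨10, fun δ M hM s hs n n' out => ?_⟩, ?_, ?_, ?_⟩
    · have := hM.le_top
      apply Spec.mono
      · apply Spec.cons (Spec.copy (by simp) (by simp) (by simp) (by rfl))
        simp only [Store.update_out]
        apply Spec.cons Spec.push
        simp only [Store.update_out, Store.get_out]
        apply Spec.cons Spec.push
        simp only [Store.update_out, Store.get_out]
        apply Spec.last
        apply Spec.congr Spec.push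
        simp [Setup.env, unaryCode, List.replicate_succ']
      · simp only [Store.get_s, Setup.env, List.length_replicate]
        nlinarith
    · simp [block, Safe, Avoids, copy, move, move₂]
    · simp [block, Avoids, copy, move, move₂]
    · simp [block, Avoids, copy, move, move₂]
  refine h.atTop.congr fun δ => ?_
  congr 2
  unfold Setup.width
  omega

/-- Write the description of the combined circuit, given a string on the stack `Var.x`, if the
subroutines `false` and `true` compute the description of the original circuit and the number of
copies less one. -/
def buildProg (hm : 3 ≤ m) (har : ∀ g, G.arity g ≤ m) (T : Gadgets G) : Prog (Var m) Bool := block [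
  move₂ .x .a .b, call false .a .d, call true .b .n, push .n true skip, move .d .r,
  readUnary .r .wid, push .wid true skip, readUnary .r .o, move .r .f, move .f .d,
  seq headerProg (gatesProg hm har T), drain .d, drain .n, drain .wid, drain .o]

theorem spec_buildProg {sub : Bool → Subroutine} (hm : 3 ≤ m) (har : ∀ g, G.arity g ≤ m)
    (T : Gadgets G) : ∃ c, ∀ (v : List Bool) (Q : Circuit G) (n M : ℕ),
      (sub false).fn v = Q.encode → (sub true).fn v = List.replicate n true →
      v.length ≤ M → Q.encode.length ≤ M → 1 + (n + 2) * (Q.width + 1) ≤ M →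
      Spec sub (buildProg hm har T) (Store.get {Store.empty with x := v})
        (Store.get {Store.empty with
          out := (Setup.circuit ⟨Q.width, n + 1, Q.out, Q.gates⟩ T).encode.reverse})
        (c * (M + 1) ^ 3 + (sub false).cost v + (sub true).cost v) := by
  have hw := (writesTop_headerProg (m := m) (G := G) (sub := sub)).seq
    (writesTop_gatesProg (sub := sub) hm har T)
  obtain ⟨c, hc⟩ := hw.spec
  refine ⟨c + 40, fun v Q n M hQ hn hv hM hM' => ?_⟩
  have hlen : Q.encode.length =
      Q.width + 1 + (Q.out + 1) + (Q.gates.map PlacedGate.encode).flatten.length := by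
    simp only [Circuit.encode, unaryCode, List.length_append, List.length_replicate,
      List.length_singleton]
  -- The subroutine delivers `n`, and one push makes it `N = n + 1`. Likewise the stack `wid` gets
  -- the width plus one, the distance between the first qubits of consecutive blocks.
  have hmain := hc ⟨Q.width, n + 1, Q.out, Q.gates⟩ M ⟨hM', by dsimp only; omega⟩ []
  have htext : unaryCode (Setup.width (G := G) ⟨Q.width, n + 1, Q.out, Q.gates⟩) ++ unaryCode 0 ++
      encodeList (Setup.gates ⟨Q.width, n + 1, Q.out, Q.gates⟩ T) =
        (Setup.circuit ⟨Q.width, n + 1, Q.out, Q.gates⟩ T).encode := rfl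
  rw [htext] at hmain
  simp only [Setup.env, List.append_nil, List.replicate_zero] at hmain
  apply Spec.mono
  · apply Spec.cons (Spec.move₂ (by simp) (by simp) (by simp))
    simp only [Store.update_x, Store.update_a, Store.update_b, Store.get_x, Store.get_a,
      Store.get_b]
    apply Spec.cons Spec.call
    simp only [Store.update_a, Store.update_d, Store.get_a, Store.get_d]
    apply Spec.cons Spec.call
    simp only [Store.update_b, Store.update_n, Store.get_b, Store.get_n]
    apply Spec.cons Spec.push
    simp only [Store.update_n, Store.get_n]
    apply Spec.cons (Spec.move (by simp))
    simp only [Store.update_d, Store.update_r, Store.get_d, Store.get_r]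
    simp only [Store.empty, List.append_nil, List.reverse_reverse, List.reverse_replicate, hQ, hn,
      ← List.replicate_succ]
    apply Spec.cons (Spec.readUnary (by simp) (n := Q.width)
      (l := unaryCode Q.out ++ (Q.gates.map PlacedGate.encode).flatten)
      (by simp [Circuit.encode, unaryCode]))
    simp only [Store.update_r, Store.update_wid, Store.get_wid, List.append_nil]
    apply Spec.cons Spec.push
    simp only [Store.update_wid, Store.get_wid, ← List.replicate_succ]
    apply Spec.cons (Spec.readUnary (by simp) (n := Q.out)
      (l := (Q.gates.map PlacedGate.encode).flatten) (by simp [unaryCode]))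
    simp only [Store.update_r, Store.update_o, Store.get_o, List.append_nil]
    apply Spec.cons (Spec.move (by simp))
    simp only [Store.update_r, Store.update_f, Store.get_r, Store.get_f, List.append_nil]
    apply Spec.cons (Spec.move (by simp))
    simp only [Store.update_d, Store.update_f, Store.get_d, Store.get_f, List.append_nil,
      List.reverse_reverse]
    apply Spec.cons hmain
    apply Spec.cons Spec.drain
    simp only [Store.update_d]
    apply Spec.cons Spec.drain
    simp only [Store.update_n]
    apply Spec.cons Spec.drain
    simp only [Store.update_wid]
    apply Spec.last
    apply Spec.congr Spec.drain
    simp only [Store.update_o]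
  · simp only [Store.get_x, Store.get_a, Store.get_b, Store.get_d, Store.get_n, Store.get_r,
      Store.get_f, Store.get_wid, Store.get_o, Store.empty, List.length_reverse,
      List.length_replicate, List.append_nil, List.reverse_reverse, hQ, hn]
    have h₁ : n ≤ M := by nlinarith
    have h₂ : M + 1 ≤ (M + 1) ^ 3 := Nat.le_self_pow (by omega) _
    have h₃ : (c + 40) * (M + 1) ^ 3 = c * (M + 1) ^ 3 + 40 * (M + 1) ^ 3 := by ring
    omega

theorem safe_buildProg (hm : 3 ≤ m) (har : ∀ g, G.arity g ≤ m) (T : Gadgets G)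
    (sub : Bool → Subroutine) : (buildProg hm har T).Safe := by
  have h₁ := (writesTop_headerProg (m := m) (G := G) (sub := sub)).safe
  have h₂ := (writesTop_gatesProg (sub := sub) hm har T).safe
  simp [buildProg, block, Safe, Avoids, move, move₂, readUnary, drain, h₁, h₂]

end Prog

/-- `buildProg` calls the machines for `Q` and `p` and rewrites what they deliver. It leaves the
description reversed on `Var.out`, and a last `move` to `Var.fin` sets it right. Only the texts of
`T` and the gate set enter the program itself, and these are fixed. -/
theorem PolyTimeUniform.combine {G : GateSet} {Q : List Bool → Circuit G}
    (hQ : PolyTimeUniform Q) {p : ℕ → ℕ+} (hp : PolyBounded p) (T : Gadgets G) :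
    PolyTimeUniform fun x =>
      Setup.circuit ⟨(Q x).width, p x.length + 1, (Q x).out, (Q x).gates⟩ T := by
  obtain ⟨s, P, hs, hP, hP'⟩ := exists_subroutine hQ id id (fun l => by simp)
  simp only [id] at hs
  obtain ⟨s', P', hs', hR, hR'⟩ := exists_subroutine_of_polyBounded hp
  -- The number of stacks for qubits must be fixed in advance: enough for a Toffoli gate and for
  -- every gate of the finite set.
  have har : ∀ g, G.arity g ≤ 3 + ∑ g, G.arity g := fun g =>
    (Finset.single_le_sum (f := fun g => G.arity g) (fun _ _ => Nat.zero_le _)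
      (Finset.mem_univ g)).trans (Nat.le_add_left _ _)
  set sub : Bool → Subroutine := fun b => bif b then s' else s
  obtain ⟨c, hc⟩ := Prog.spec_buildProg (sub := sub) (Nat.le_add_right 3 _) har T
  -- `B` dominates the length of the input, the length of the description of `Q x`, and the number
  -- $1+(p+2)(w+1)$ required by `Setup.Bounded`. The width is bounded through the description, which
  -- contains it in unary.
  set B : Polynomial ℕ := Polynomial.X + P + (1 + (P' + 2) * (P + 1)) with hB
  set R : Polynomial ℕ := Polynomial.C c * (B + 1) ^ 3 + P + P' with hRdef
  have hsafe := Prog.safe_buildProg (Nat.le_add_right 3 _) har T sub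
  have key (x : List Bool) := hc x (Q x) (p x.length) (B.eval x.length) (hs x) (hs' x)
    (by simp [hB]; omega)
    (by
      have := hP' x
      rw [hs] at this
      simp [hB]
      omega)
    (by
      have h₁ := hP' x
      rw [hs] at h₁
      have h₂ : (Q x).width ≤ P.eval x.length := by
        refine le_trans ?_ h₁
        simp [Circuit.encode, unaryCode]
      have h₃ := hR' x.length
      have := Nat.mul_le_mul (Nat.add_le_add_right h₃ 2) (Nat.add_le_add_right h₂ 1)
      simp [hB]
      omega)
  have hcost (x : List Bool) : Prog.cost sub (Prog.buildProg (Nat.le_add_right 3 _) har T)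
      (Store.get {Store.empty with x := x}) ≤ R.eval x.length := by
    refine (key x).cost_le.trans ?_
    have h₁ := hP x
    have h₂ := hR x
    simp only [hRdef, Polynomial.eval_add, Polynomial.eval_mul, Polynomial.eval_C,
      Polynomial.eval_pow, Polynomial.eval_one]
    exact Nat.add_le_add (Nat.add_le_add_left h₁ _) h₂
  have htotal (x : List Bool) : Prog.Spec sub
      (.seq (Prog.buildProg (Nat.le_add_right 3 _) har T) (Prog.move .out .fin))
      (Store.get {Store.empty with x := x})
      (Store.get {Store.empty with fin :=
        (Setup.circuit ⟨(Q x).width, p x.length + 1, (Q x).out, (Q x).gates⟩ T).encode})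
      (3 * R.eval x.length + 1) := by
    -- The length of the result, needed for the cost of the last `move`, is bounded by the time
    -- taken to write it.
    have h₁ := Prog.length_den_le (sub := sub) hsafe.wf (Store.get {Store.empty with x := x}) .out
    rw [(key x).den_eq] at h₁
    simp only [Store.get_out, Store.empty, List.length_nil, zero_add] at h₁
    have h₂ := h₁.trans (hcost x)
    apply Prog.Spec.mono
    · apply Prog.Spec.seq ⟨(key x).den_eq, hcost x⟩
      apply Prog.Spec.congr (Prog.Spec.move (by simp))
      simp [Store.empty]
    · simp only [Store.get_out]
      omega
  refine Prog.nonempty_computable sub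
    (.seq (Prog.buildProg (Nat.le_add_right 3 _) har T) (Prog.move .out .fin))
    (Prog.Safe.wf ⟨hsafe, by simp [Prog.move, Prog.Safe, Prog.Avoids]⟩) .x .fin
    (fun x => ?_) (3 * R + 1) (fun x => ?_)
  · rw [Store.only_x, Store.only_fin]
    exact (htotal x).den_eq
  · rw [Store.only_x]
    refine (htotal x).cost_le.trans ?_
    simp

end CleanQubit

/-! ### Operators on subsets of the qubits, and tensor powers. -/

namespace CleanQubit

open Matrix Kronecker

section Lift

variable {ι ι' κ : Type} [Fintype ι] [Fintype ι'] [Fintype κ] [DecidableEq ι] [DecidableEq ι']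
  [DecidableEq κ]

set_option linter.unusedSectionVars false

/-- An assignment of bits to `κ` as one to `ι` and one to the complement. -/
noncomputable def splitEquiv (e : ι ↪ κ) :
    (κ → Bool) ≃ (ι → Bool) × ({q // ¬ q ∈ Set.range e} → Bool) :=
  (Equiv.piEquivPiSubtypeProd (fun q => q ∈ Set.range e) fun _ => Bool).trans
    (((Equiv.ofInjective e e.injective).symm.arrowCongr (Equiv.refl Bool)).prodCongr
      (Equiv.refl _))

theorem splitEquiv_fst (e : ι ↪ κ) (x : κ → Bool) : (splitEquiv e x).1 = x ∘ e := rfl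

theorem splitEquiv_snd (e : ι ↪ κ) (x : κ → Bool) : (splitEquiv e x).2 = fun q => x q.1 := rfl

/-- The operator on the qubits `κ` that acts as `A` on the qubits given by `e`. -/
noncomputable def lift (e : ι ↪ κ) (A : Matrix (ι → Bool) (ι → Bool) ℂ) : Matrix (κ → Bool) (κ → Bool) ℂ :=
  (A ⊗ₖ (1 : Matrix ({q // ¬ q ∈ Set.range e} → Bool) _ ℂ)).submatrix (splitEquiv e)
    (splitEquiv e)

open Classical in
theorem lift_apply (e : ι ↪ κ) (A : Matrix (ι → Bool) (ι → Bool) ℂ) (i j : κ → Bool) :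
    lift e A i j = if ∀ q, q ∉ Set.range e → i q = j q then A (i ∘ e) (j ∘ e) else 0 := by
  simp [lift, splitEquiv_fst, splitEquiv_snd, Matrix.one_apply, funext_iff, -Set.mem_range]

variable (e : ι ↪ κ) (A B : Matrix (ι → Bool) (ι → Bool) ℂ)

theorem lift_mul : lift e (A * B) = lift e A * lift e B := by
  rw [lift, lift, lift, Matrix.submatrix_mul_equiv, ← Matrix.mul_kronecker_mul, Matrix.one_mul]

theorem lift_one : lift e (1 : Matrix (ι → Bool) (ι → Bool) ℂ) = 1 := by
  rw [lift, Matrix.one_kronecker_one, Matrix.submatrix_one_equiv]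

theorem lift_add : lift e (A + B) = lift e A + lift e B := by
  rw [lift, Matrix.add_kronecker, Matrix.submatrix_add]
  rfl

theorem lift_smul (c : ℂ) : lift e (c • A) = c • lift e A := by
  rw [lift, Matrix.smul_kronecker, Matrix.submatrix_smul]
  rfl

theorem lift_sub : lift e (A - B) = lift e A - lift e B := by
  rw [sub_eq_add_neg, ← neg_one_smul ℂ, lift_add, lift_smul, neg_one_smul, ← sub_eq_add_neg]

theorem lift_conjTranspose : lift e Aᴴ = (lift e A)ᴴ := by
  rw [lift, lift, Matrix.conjTranspose_submatrix, Matrix.conjTranspose_kronecker,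
    Matrix.conjTranspose_one]

/-- Tensoring with an identity multiplies the trace by its dimension. Multiplying both sides by
powers of two avoids a subtraction in the exponent. -/
theorem trace_lift :
    2 ^ Fintype.card ι * trace (lift e A) = 2 ^ Fintype.card κ * trace A := by
  have h : Fintype.card (ι → Bool) * Fintype.card ({q // ¬ q ∈ Set.range e} → Bool) =
      Fintype.card (κ → Bool) := by
    rw [← Fintype.card_prod, Fintype.card_congr (splitEquiv e)]
  have h' : trace (lift e A) =
      trace A * Fintype.card ({q // ¬ q ∈ Set.range e} → Bool) := by
    rw [← Matrix.trace_one, ← Matrix.trace_kronecker]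
    exact Fintype.sum_equiv (splitEquiv e) _ _ fun _ => rfl
  have h'' : (2 : ℂ) ^ Fintype.card κ =
      2 ^ Fintype.card ι * (Fintype.card ({q // ¬ q ∈ Set.range e} → Bool) : ℂ) := by
    have := congrArg (Nat.cast (R := ℂ)) h
    rw [Fintype.card_fun, Fintype.card_fun (β := Bool) (α := κ), Fintype.card_bool] at this
    push_cast at this ⊢
    exact this.symm
  rw [h', h'']
  ring

theorem lift_lift (f : ι' ↪ ι) (A : Matrix (ι' → Bool) (ι' → Bool) ℂ) :
    lift e (lift f A) = lift (f.trans e) A := by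
  classical
  ext i j
  rw [lift_apply, lift_apply, lift_apply, ← ite_and]
  refine if_congr ⟨fun h q hq => ?_, fun h => ⟨fun q hq => h q ?_, fun q hq => h (e q) ?_⟩⟩ rfl rfl
  · by_cases h' : q ∈ Set.range e
    · obtain ⟨q, rfl⟩ := h'
      exact h.2 q fun ⟨a, ha⟩ => hq ⟨a, by simp [ha]⟩
    · exact h.1 q h'
  · rintro ⟨a, rfl⟩
    exact hq ⟨f a, rfl⟩
  · rintro ⟨a, ha⟩
    exact hq ⟨a, e.injective ha⟩

open Classical in
theorem lift_mul_lift_apply (f : ι' ↪ κ) (hef : ∀ a b, e a ≠ f b)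
    (B : Matrix (ι' → Bool) (ι' → Bool) ℂ) (i j : κ → Bool) :
    (lift e A * lift f B) i j = if ∀ q, q ∉ Set.range e → q ∉ Set.range f → i q = j q then
      A (i ∘ e) (j ∘ e) * B (i ∘ f) (j ∘ f) else 0 := by
  -- Only one intermediate basis state can contribute: it agrees with `j` on the range of `e`, where
  -- the second factor does nothing, and with `i` elsewhere, where the first does nothing.
  rw [Matrix.mul_apply, Finset.sum_eq_single fun q => if q ∈ Set.range e then j q else i q]
  · have h₁ : (fun q => if q ∈ Set.range e then j q else i q) ∘ e = j ∘ e := by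
      funext a
      simp
    have h₂ : (fun q => if q ∈ Set.range e then j q else i q) ∘ f = i ∘ f := by
      funext a
      simp [hef]
    rw [lift_apply, lift_apply, h₁, h₂, if_pos (fun q hq => (if_neg hq).symm)]
    split_ifs with h h' h'
    · rfl
    · exact absurd (fun q hq hq' => by simpa only [if_neg hq] using h q hq') h'
    · refine absurd (fun q hq => ?_) h
      split_ifs with hq'
      · rfl
      · exact h' q hq' hq
    · rw [mul_zero]
  · intro k _ hk
    rw [lift_apply, lift_apply]
    split_ifs with h h'
    · refine absurd (funext fun q => ?_) hk
      split_ifs with hq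
      · refine h' q ?_
        rintro ⟨b, rfl⟩
        obtain ⟨a, ha⟩ := hq
        exact hef a b ha
      · exact (h q hq).symm
    · rw [mul_zero]
    · rw [zero_mul]
    · rw [zero_mul]
  · simp

theorem commute_lift (f : ι' ↪ κ) (hef : ∀ a b, e a ≠ f b)
    (B : Matrix (ι' → Bool) (ι' → Bool) ℂ) : Commute (lift e A) (lift f B) := by
  classical
  ext i j
  rw [lift_mul_lift_apply e A f hef, lift_mul_lift_apply f B e fun a b => (hef b a).symm]
  refine if_congr ⟨fun h q hq hq' => h q hq' hq, fun h q hq hq' => h q hq' hq⟩ (mul_comm _ _) rfl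

theorem lift_diagonal (d : (ι → Bool) → ℂ) :
    lift e (diagonal d) = diagonal fun x => d (x ∘ e) := by
  classical
  ext i j
  rw [lift_apply]
  by_cases h : i = j
  · simp [h]
  · rw [diagonal_apply_ne _ h]
    split_ifs with h'
    · refine diagonal_apply_ne _ fun h'' => h (funext fun q => ?_)
      by_cases hq : q ∈ Set.range e
      · obtain ⟨a, rfl⟩ := hq
        exact congrFun h'' a
      · exact h' q hq
    · rfl

end Lift

section Tensor

variable {ν ι : Type} [Fintype ν] [Fintype ι] [DecidableEq ν] [DecidableEq ι]

set_option linter.unusedSectionVars false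

/-- The tensor product of a family of operators. -/
def tens (A : ν → Matrix (ι → Bool) (ι → Bool) ℂ) :
    Matrix (ν × ι → Bool) (ν × ι → Bool) ℂ :=
  fun i j => ∏ n, A n (fun q => i (n, q)) fun q => j (n, q)

theorem tens_mul (A B : ν → Matrix (ι → Bool) (ι → Bool) ℂ) :
    tens A * tens B = tens fun n => A n * B n := by
  ext i j
  simp only [tens, Matrix.mul_apply, ← Finset.prod_mul_distrib]
  rw [Finset.prod_univ_sum, Fintype.piFinset_univ]
  exact Fintype.sum_equiv (Equiv.curry ν ι Bool) _ _ fun k => rfl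

theorem trace_tens (A : ν → Matrix (ι → Bool) (ι → Bool) ℂ) :
    trace (tens A) = ∏ n, trace (A n) := by
  simp only [tens, trace, Matrix.diag_apply]
  rw [Finset.prod_univ_sum, Fintype.piFinset_univ]
  exact Fintype.sum_equiv (Equiv.curry ν ι Bool) _ _ fun k => rfl

theorem tens_conjTranspose (A : ν → Matrix (ι → Bool) (ι → Bool) ℂ) :
    tens (fun n => (A n)ᴴ) = (tens A)ᴴ := by
  ext i j
  simp [tens, conjTranspose_apply]

theorem tens_diagonal (d : ν → (ι → Bool) → ℂ) :
    tens (fun n => diagonal (d n)) = diagonal fun x => ∏ n, d n fun q => x (n, q) := by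
  ext i j
  by_cases h : i = j
  · simp [tens, h]
  · rw [diagonal_apply_ne _ h]
    obtain ⟨⟨n, q⟩, hq⟩ := Function.ne_iff.mp h
    exact Finset.prod_eq_zero (Finset.mem_univ n) (diagonal_apply_ne _ fun h' => hq (congrFun h' q))

theorem tens_one : tens (fun _ : ν => (1 : Matrix (ι → Bool) (ι → Bool) ℂ)) = 1 := by
  simp only [← diagonal_one]
  rw [tens_diagonal]
  simp

/-- The qubits of the `n`-th factor. -/
def factor (n : ν) : ι ↪ ν × ι := ⟨fun q => (n, q), fun _ _ h => (Prod.mk.inj h).2⟩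

theorem lift_factor (n : ν) (A : Matrix (ι → Bool) (ι → Bool) ℂ) :
    lift (factor n) A = tens fun n' => if n' = n then A else 1 := by
  classical
  ext i j
  rw [lift_apply, tens]
  by_cases h : ∀ n', n' ≠ n → (fun q => i (n', q)) = fun q => j (n', q)
  · rw [if_pos, Finset.prod_eq_single n]
    · rw [if_pos rfl]
      rfl
    · intro n' _ hn'
      rw [if_neg hn', h n' hn', Matrix.one_apply_eq]
    · simp
    · rintro ⟨n', q⟩ hq
      refine congrFun (h n' ?_) q
      rintro rfl
      exact hq ⟨q, rfl⟩
  · push Not at h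
    obtain ⟨n', hn', h⟩ := h
    rw [if_neg, Finset.prod_eq_zero (Finset.mem_univ n')]
    · rw [if_neg hn', Matrix.one_apply_ne h]
    · intro h'
      refine h (funext fun q => h' (n', q) ?_)
      rintro ⟨q', hq'⟩
      exact hn' (Prod.mk.inj hq').1.symm

end Tensor

section Operators

variable {G : GateSet} {a w : ℕ}

theorem toMatrix_eq (P : PlacedGate G w) : P.toMatrix = lift P.wires (G.gate P.idx).2 := by
  classical
  ext i j
  rw [lift_apply, PlacedGate.toMatrix]
  congr

theorem foldl_toMatrix (L : List (PlacedGate G w)) (M : Matrix (Bits w) (Bits w) ℂ) :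
    L.foldl (fun M P => P.toMatrix * M) M = opOf L * M := by
  induction L generalizing M with
  | nil => simp [opOf]
  | cons P L ih =>
    rw [opOf, List.foldl_cons, List.foldl_cons, ih, ih (P.toMatrix * 1), Matrix.mul_one,
      Matrix.mul_assoc]

theorem opOf_nil : opOf ([] : List (PlacedGate G w)) = 1 := rfl

theorem opOf_append (L L' : List (PlacedGate G w)) : opOf (L ++ L') = opOf L' * opOf L := by
  rw [opOf, List.foldl_append, foldl_toMatrix]
  rfl

theorem opOf_cons (P : PlacedGate G w) (L : List (PlacedGate G w)) :
    opOf (P :: L) = opOf L * P.toMatrix := by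
  rw [opOf, List.foldl_cons, foldl_toMatrix, Matrix.mul_one]

theorem opOf_singleton (P : PlacedGate G w) : opOf [P] = P.toMatrix := by
  rw [opOf_cons, opOf_nil, Matrix.one_mul]

theorem opOf_place (L : List (PlacedGate G a)) (e : Fin a ↪ Fin w) :
    opOf (place L e) = lift e (opOf L) := by
  induction L with
  | nil => rw [opOf_nil, lift_one]; rfl
  | cons P L ih =>
    have : place (P :: L) e = ⟨P.idx, P.wires.trans e⟩ :: place L e := rfl
    rw [this, opOf_cons, opOf_cons, ih, lift_mul, toMatrix_eq, toMatrix_eq, lift_lift]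

theorem opOf_power (k : ℕ) (L : List (PlacedGate G w)) : opOf (power k L) = opOf L ^ k := by
  induction k with
  | zero => simp [power, opOf_nil]
  | succ k ih =>
    rw [power, List.replicate_succ, List.flatten_cons, opOf_append, pow_succ, ← ih]
    rfl

theorem lift_refl {ι : Type} [Fintype ι] [DecidableEq ι] (A : Matrix (ι → Bool) (ι → Bool) ℂ) :
    lift (Function.Embedding.refl ι) A = A := by
  classical
  ext i j
  rw [lift_apply, if_pos (by simp)]
  rfl

theorem opOf_self (g : Fin G.size) : opOf (G.self g) = (G.gate g).2 := by
  rw [GateSet.self, opOf_singleton, toMatrix_eq, lift_refl]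

theorem opOf_subst_self (gs : List (PlacedGate G w)) : opOf (subst G.self gs) = opOf gs := by
  induction gs with
  | nil => rfl
  | cons P gs ih =>
    have : subst G.self (P :: gs) = place (G.self P.idx) P.wires ++ subst G.self gs := rfl
    rw [this, opOf_append, ih, opOf_place, opOf_self, opOf_cons, toMatrix_eq]

/-- $(U_n\cdots U_1)^\dagger=U_1^\dagger\cdots U_n^\dagger$: the order is reversed and each gate is
replaced by a circuit for its inverse on the same qubits. -/
theorem opOf_subst_inv {inv : ∀ g, List (PlacedGate G (G.arity g))}
    (hinv : ∀ g, opOf (inv g) = (G.gate g).2ᴴ) (gs : List (PlacedGate G w)) :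
    opOf (subst inv gs.reverse) = (opOf gs)ᴴ := by
  induction gs with
  | nil => exact (conjTranspose_one).symm
  | cons P gs ih =>
    have : subst inv (P :: gs).reverse =
        subst inv gs.reverse ++ place (inv P.idx) P.wires := by
      simp [subst]
    rw [this, opOf_append, ih, opOf_place, hinv, opOf_cons, toMatrix_eq, conjTranspose_mul,
      lift_conjTranspose]

theorem conjTranspose_mul_opOf (gs : List (PlacedGate G w)) : (opOf gs)ᴴ * opOf gs = 1 := by
  induction gs with
  | nil => simp [opOf_nil]
  | cons P gs ih =>
    rw [opOf_cons, conjTranspose_mul, Matrix.mul_assoc, ← Matrix.mul_assoc _ (opOf gs), ih,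
      Matrix.one_mul, toMatrix_eq, ← lift_conjTranspose, ← lift_mul]
    have := (Matrix.mem_unitaryGroup_iff'.mp (G.unitary P.idx))
    rw [← Matrix.star_eq_conjTranspose, this, lift_one]

/-- Circuits on the factors of a tensor product, one after the other. -/
theorem opOf_ascend {N : ℕ} (E : Fin N × Fin a ↪ Fin w) {f : Fin N → List (PlacedGate G w)}
    {A : Fin N → Matrix (Bits a) (Bits a) ℂ}
    (hf : ∀ n, opOf (f n) = lift ((factor n).trans E) (A n)) :
    opOf (ascend f) = lift E (tens A) := by
  -- Induction on the list of factors treated so far; the others carry the identity. Absence of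
  -- repetitions guarantees that each factor is acted on just once.
  have key : ∀ l : List (Fin N), l.Nodup →
      opOf (l.flatMap f) = lift E (tens fun n => if n ∈ l then A n else 1) := by
    intro l hl
    induction l with
    | nil => simp [opOf_nil, tens_one, lift_one]
    | cons x l ih =>
      rw [List.nodup_cons] at hl
      rw [List.flatMap_cons, opOf_append, ih hl.2, hf, ← lift_lift, ← lift_mul, lift_factor,
        tens_mul]
      congr 2
      funext n
      by_cases h : n = x
      · subst h
        simp [hl.1]
      · simp [h]
  rw [ascend, key _ (List.nodup_finRange N)]
  simp

end Operators

end CleanQubit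

/-! ### Conjunctions of many bits with ancillas in an arbitrary state. -/

namespace CleanQubit

set_option linter.unusedSectionVars false

open Matrix

section Toggle

variable {κ ι : Type} [Fintype ι] [Fintype κ] [DecidableEq ι] [DecidableEq κ]

/-- The operator that takes the basis state `x` to the basis state `F x`. -/
def permMat (F : (κ → Bool) → κ → Bool) : Matrix (κ → Bool) (κ → Bool) ℂ :=
  fun i j => if i = F j then 1 else 0

theorem permMat_mul (F F' : (κ → Bool) → κ → Bool) :
    permMat F * permMat F' = permMat (F ∘ F') := by
  ext i j
  rw [Matrix.mul_apply, Finset.sum_eq_single (F' j)]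
  · simp [permMat]
  · intro k _ hk
    simp [permMat, hk]
  · simp

/-- Add the bit `g x` to the bit `t` of `x`. -/
def toggle (t : κ) (g : (κ → Bool) → Bool) (x : κ → Bool) : κ → Bool :=
  Function.update x t (xor (x t) (g x))

theorem toggle_self (t : κ) (g : (κ → Bool) → Bool) (x : κ → Bool) :
    toggle t g x t = xor (x t) (g x) := Function.update_self ..

theorem toggle_of_ne {t q : κ} (h : q ≠ t) (g : (κ → Bool) → Bool) (x : κ → Bool) :
    toggle t g x q = x q := Function.update_of_ne h ..

theorem lift_toggle (e : ι ↪ κ) (t : ι) (g : (ι → Bool) → Bool) :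
    lift e (permMat (toggle t g)) = permMat (toggle (e t) fun x => g (x ∘ e)) := by
  classical
  ext i j
  rw [lift_apply, permMat, permMat, ← ite_and]
  refine if_congr ⟨fun h => funext fun q => ?_, fun h => ⟨fun q hq => ?_, funext fun q => ?_⟩⟩
    rfl rfl
  · by_cases hq : q ∈ Set.range e
    · obtain ⟨a, rfl⟩ := hq
      have := congrFun h.2 a
      by_cases ha : a = t
      · subst ha
        simpa [toggle_self] using this
      · rw [toggle_of_ne ha] at this
        rwa [toggle_of_ne (e.injective.ne ha)]
    · rw [toggle_of_ne fun h' => hq ⟨t, h'.symm⟩]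
      exact h.1 q hq
  · rw [h, toggle_of_ne fun h' => hq ⟨t, h'.symm⟩]
  · rw [h]
    by_cases ha : q = t
    · subst ha
      simp [toggle_self]
    · simp [toggle_of_ne ha, toggle_of_ne (e.injective.ne ha)]

/-- A conditional negation is the sum of the negation, if the condition holds, and the identity,
if it does not. -/
theorem permMat_toggle (t : κ) (g : (κ → Bool) → Bool)
    (hg : ∀ x b, g (Function.update x t b) = g x) :
    permMat (toggle t g) =
      1 + diagonal (fun x => if g x then 1 else 0) * (permMat (toggle t fun _ => true) - 1) := by
  ext i j
  simp only [Matrix.add_apply, Matrix.diagonal_mul, Matrix.sub_apply, permMat, Matrix.one_apply]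
  have h : toggle t g j = if g j then toggle t (fun _ => true) j else j := by
    funext q
    by_cases hq : q = t
    · subst hq
      by_cases h : g j <;> simp [toggle_self, h]
    · by_cases h : g j <;> simp [toggle_of_ne hq, h]
  rw [h]
  by_cases hi : i = j
  · subst hi
    by_cases h : g i <;> simp [h]
  · by_cases hi' : i = toggle t (fun _ => true) j
    · have : g i = g j := by rw [hi', toggle, hg]
      rw [this]
      by_cases h : g j
      · simp [h, hi, ← hi']
      · simp [h, hi]
    · by_cases h : g j <;> simp [h, hi, hi']

end Toggle

section Chain

variable {κ : Type} [Fintype κ] [DecidableEq κ]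

/-- The conjunction of the first `n` of the bits `b`. -/
def conj (b : ℕ → κ) (x : κ → Bool) : ℕ → Bool
  | 0 => true
  | n + 1 => conj b x n && x (b n)

theorem conj_congr {b : ℕ → κ} {x y : κ → Bool} {n : ℕ} (h : ∀ j < n, x (b j) = y (b j)) :
    conj b x n = conj b y n := by
  induction n with
  | zero => rfl
  | succ n ih => rw [conj, conj, ih fun j hj => h j (by omega), h n (by omega)]

theorem conj_eq_true {b : ℕ → κ} {x : κ → Bool} {n : ℕ} :
    conj b x n = true ↔ ∀ j < n, x (b j) = true := by
  induction n with
  | zero => simp [conj]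
  | succ n ih =>
    rw [conj, Bool.and_eq_true, ih]
    exact ⟨fun h j hj => (Nat.lt_succ_iff_lt_or_eq.mp hj).elim (h.1 j) fun h' => h' ▸ h.2,
      fun h => ⟨fun j hj => h j (by omega), h n (by omega)⟩⟩

/-- The functions `t (n - 1), …, t 0, f, t 0, …, t (n - 1)` in a row. -/
def nest {α : Type} (f : α → α) (t : ℕ → α → α) : ℕ → α → α
  | 0 => f
  | n + 1 => t n ∘ nest f t n ∘ t n

variable (a b : ℕ → κ)

/-- The effect of `Setup.chain` on basis states. -/
def chainFun : ℕ → (κ → Bool) → κ → Bool :=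
  nest (toggle (a 0) fun _ => true) fun n => toggle (a (n + 1)) fun x => x (a n) && x (b n)

variable {a b} {N : ℕ} (ha : ∀ i ≤ N, ∀ j ≤ N, a i = a j → i = j)
  (hab : ∀ i ≤ N, ∀ j < N, a i ≠ b j)
include ha hab

/-- In the inductive step $a_{n+1}$ receives $a_n b_n$ before the inner chain and $(a_n\oplus
c_n)b_n$ after it, where $c_n$ is the conjunction of the first $n$ bits. The unknown $a_n$ cancels
and $c_n b_n=c_{n+1}$ is added. -/
theorem chainFun_apply {n : ℕ} (hn : n ≤ N) (x : κ → Bool) :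
    (∀ i ≤ n, chainFun a b n x (a i) = xor (x (a i)) (conj b x i)) ∧
      ∀ q, (∀ i ≤ n, q ≠ a i) → chainFun a b n x q = x q := by
  induction n generalizing x with
  | zero =>
    have e : chainFun a b 0 = toggle (a 0) fun _ => true := rfl
    rw [e]
    refine ⟨fun i hi => ?_, fun q hq => toggle_of_ne (hq 0 le_rfl) _ _⟩
    obtain rfl : i = 0 := by omega
    exact toggle_self _ _ _
  | succ n ih =>
    set y := toggle (a (n + 1)) (fun x => x (a n) && x (b n)) x with hy
    obtain ⟨h₁, h₂⟩ := ih (by omega) y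
    have e : chainFun a b (n + 1) x =
        toggle (a (n + 1)) (fun x => x (a n) && x (b n)) (chainFun a b n y) := rfl
    have hne : ∀ i ≤ n, a i ≠ a (n + 1) := fun i hi h => by
      have := ha i (by omega) (n + 1) hn h
      omega
    have hconj : ∀ i ≤ n + 1, conj b y i = conj b x i := fun i hi => conj_congr fun j hj =>
      toggle_of_ne (hab (n + 1) hn j (by omega)).symm _ _
    rw [e]
    refine ⟨fun i hi => ?_, fun q hq => ?_⟩
    · rcases Nat.le_succ_iff_eq_or_le.mp hi with rfl | hi
      · have h₃ := h₂ (a (n + 1)) fun i hi => (hne i hi).symm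
        have h₄ := h₁ n le_rfl
        have h₅ := h₂ (b n) fun i hi => (hab i (by omega) n hn).symm
        rw [hy, toggle_of_ne (hne n le_rfl), ← hy, hconj n (by omega)] at h₄
        rw [hy, toggle_of_ne (hab (n + 1) hn n hn).symm, ← hy] at h₅
        rw [toggle_self, h₃, h₄, h₅, hy, toggle_self, conj]
        generalize x (a (n + 1)) = u
        generalize x (a n) = v
        generalize x (b n) = p
        generalize conj b x n = q
        revert u v p q
        decide
      · rw [toggle_of_ne (hne i hi), h₁ i hi, hconj i (by omega), hy, toggle_of_ne (hne i hi)]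
    · rw [toggle_of_ne (hq (n + 1) le_rfl), h₂ q fun i hi => hq i (by omega), hy,
        toggle_of_ne (hq (n + 1) le_rfl)]

/-- The target receives $a_N$ first and $a_N\oplus c_N$ after the chain, in sum the conjunction
$c_N$. The second chain adds the same conjunctions to the ancillas as the first, since the bits `b`
have not changed, and so restores them. -/
theorem chainFun_link {c : κ} (hc : ∀ i ≤ N, c ≠ a i) (hc' : ∀ j < N, c ≠ b j) :
    chainFun a b N ∘ toggle c (fun x => x (a N)) ∘ chainFun a b N ∘ toggle c (fun x => x (a N)) =
      toggle c fun x => conj b x N := by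
  funext x
  set y := toggle c (fun x => x (a N)) x with hy
  set z := toggle c (fun x => x (a N)) (chainFun a b N y) with hz
  change chainFun a b N z = _
  obtain ⟨h₁, h₂⟩ := chainFun_apply ha hab le_rfl y
  obtain ⟨h₃, h₄⟩ := chainFun_apply ha hab le_rfl z
  have hyb : ∀ j < N, y (b j) = x (b j) := fun j hj => toggle_of_ne (hc' j hj).symm _ _
  have hzb : ∀ j < N, z (b j) = x (b j) := fun j hj => by
    rw [hz, toggle_of_ne (hc' j hj).symm, h₂ _ fun i hi => (hab i hi j hj).symm, hyb j hj]
  funext q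
  by_cases hq : ∃ i ≤ N, q = a i
  · obtain ⟨i, hi, rfl⟩ := hq
    rw [h₃ i hi, hz, toggle_of_ne (hc i hi).symm, h₁ i hi, toggle_of_ne (hc i hi).symm, hy,
      toggle_of_ne (hc i hi).symm, ← hy, ← hz,
      conj_congr (y := x) fun j hj => hyb j (by omega),
      conj_congr (x := z) (y := x) fun j hj => hzb j (by omega), Bool.xor_assoc, Bool.xor_self,
      Bool.xor_false]
  · push Not at hq
    rw [h₄ q hq]
    by_cases hqc : q = c
    · subst hqc
      rw [hz, toggle_self, h₂ _ hc, h₁ N le_rfl, hy, toggle_self, toggle_of_ne (hc N le_rfl).symm,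
        ← hy, conj_congr (y := x) hyb, toggle_self]
      generalize x q = u
      generalize x (a N) = v
      generalize conj b x N = p
      revert u v p
      decide
    · rw [hz, toggle_of_ne hqc, h₂ q hq, hy, toggle_of_ne hqc, toggle_of_ne hqc]

end Chain

section Circuits

variable {G : GateSet} {w : ℕ}

theorem ascend_succ {α : Type} {N : ℕ} (f : Fin (N + 1) → List α) :
    ascend f = ascend (fun i : Fin N => f i.castSucc) ++ f (Fin.last N) := by
  simp [ascend, List.finRange_succ_last, List.flatMap_map]

theorem descend_succ {α : Type} {N : ℕ} (f : Fin (N + 1) → List α) :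
    descend f = f (Fin.last N) ++ descend fun i : Fin N => f i.castSucc := by
  simp [descend, List.finRange_succ, List.flatMap_map, Fin.rev_succ]

theorem opOf_nest {N : ℕ} {f : Fin N → List (PlacedGate G w)} {L : List (PlacedGate G w)}
    {t : ℕ → Bits w → Bits w} {F : Bits w → Bits w} (hf : ∀ i, opOf (f i) = permMat (t i))
    (hL : opOf L = permMat F) :
    opOf (descend f ++ (L ++ ascend f)) = permMat (nest F t N) := by
  induction N with
  | zero => simpa [descend, ascend, nest] using hL
  | succ N ih =>
    have := ih (f := fun i => f i.castSucc) fun i => hf i.castSucc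
    have e : descend f ++ (L ++ ascend f) = f (Fin.last N) ++
        ((descend (fun i : Fin N => f i.castSucc) ++ (L ++ ascend fun i : Fin N => f i.castSucc)) ++
          f (Fin.last N)) := by
      rw [ascend_succ, descend_succ]
      simp
    rw [e, opOf_append, opOf_append, this, hf, permMat_mul, permMat_mul]
    rfl

/-- The circuits implement the gates that they are meant to. -/
structure Gadgets.Valid (T : Gadgets G) : Prop where
  h : opOf T.h = hGate
  t : opOf T.t = tGate
  x : opOf T.x = permMat (toggle 0 fun _ => true)
  cx : opOf T.cx = permMat (toggle 1 fun x => x 0)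
  tof : opOf T.tof = permMat (toggle 2 fun x => x 0 && x 1)
  inv : ∀ g, opOf (T.inv g) = (G.gate g).2ᴴ

namespace Setup

variable (δ : Setup G) {T : Gadgets G} (hT : T.Valid)
include hT

/-- Translates the circuit into `chainFun_link`. The ancilla at the end of one block is the first
ancilla of the next, so the Toffoli gates of the blocks form a single ladder; the rest is checking
that the qubits involved are distinct. -/
theorem opOf_flipIf (k : Fin δ.w) : opOf (δ.flipIf T k) =
    permMat (toggle 0 fun x => decide (∀ i, x (δ.register i k) = true)) := by
  set b : ℕ → Fin δ.width := fun i => Fin.ofNat _ (1 + i * (δ.w + 1) + 1 + k) with hb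
  have hwidth (i : ℕ) (hi : i < δ.N) : 1 + i * (δ.w + 1) + (δ.w + 1) < δ.width := by
    have h : (i + 1) * (δ.w + 1) ≤ δ.N * (δ.w + 1) := Nat.mul_le_mul_right _ hi
    rw [Nat.succ_mul] at h
    unfold width
    omega
  have hbv (i : Fin δ.N) : b i = δ.register i k := by
    apply Fin.ext
    rw [register_val, hb]
    have := hwidth i i.2
    exact Nat.mod_eq_of_lt (by omega)
  have hav (i : Fin δ.N) : δ.ancilla i = δ.block i 0 := by
    apply Fin.ext
    rw [δ.val_ancilla i.2.le, val_block]
    simp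
  have hav' (i : Fin δ.N) : δ.ancilla (i + 1) = δ.block i (Fin.last _) := by
    apply Fin.ext
    rw [δ.val_ancilla i.2, val_block, Fin.val_last, Nat.succ_mul]
    omega
  have ha : ∀ i ≤ δ.N, ∀ j ≤ δ.N, δ.ancilla i = δ.ancilla j → i = j := by
    intro i hi j hj h
    rw [Fin.ext_iff, δ.val_ancilla hi, δ.val_ancilla hj] at h
    exact Nat.eq_of_mul_eq_mul_right (Nat.succ_pos δ.w) (Nat.add_left_cancel h)
  have hab : ∀ i ≤ δ.N, ∀ j < δ.N, δ.ancilla i ≠ b j := by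
    intro i hi j hj h
    rw [hbv ⟨j, hj⟩, Fin.ext_iff, δ.val_ancilla hi, register_val] at h
    have hk := k.2
    -- Ancillas and register qubits are told apart by their residue modulo `w + 1`: here `0` against
    -- `1 + k`.
    have h' : i * (δ.w + 1) = j * (δ.w + 1) + (1 + k) := by
      dsimp only at h
      omega
    have h'' := congrArg (· % (δ.w + 1)) h'
    simp only [Nat.mul_mod_left, Nat.mul_add_mod_self_right] at h''
    rw [Nat.mod_eq_of_lt (by omega)] at h''
    omega
  have htof (i : Fin δ.N) : opOf (δ.toffoli T k i) = permMat (toggle (δ.ancilla (i + 1))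
      fun x => x (δ.ancilla i) && x (b i)) := by
    rw [toffoli, opOf_place, hT.tof, lift_toggle, hav, hav', hbv]
    rfl
  have hchain : opOf (δ.chain T k) = permMat (chainFun δ.ancilla b δ.N) := by
    refine opOf_nest (t := fun n => toggle (δ.ancilla (n + 1)) fun x => x (δ.ancilla n) && x (b n))
      htof ?_
    rw [opOf_place, hT.x, lift_toggle]
    rfl
  have hlink : opOf (δ.link T) = permMat (toggle 0 fun x => x (δ.ancilla δ.N)) := by
    rw [link, opOf_place, hT.cx, lift_toggle]
    rfl
  rw [flipIf, opOf_append, opOf_append, opOf_append, hchain, hlink, permMat_mul, permMat_mul,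
    permMat_mul, Function.comp_assoc, Function.comp_assoc, chainFun_link ha hab]
  · congr 2
    funext x
    rw [Bool.eq_iff_iff, conj_eq_true, decide_eq_true_iff]
    exact ⟨fun h i => hbv i ▸ h i i.2, fun h j hj => hbv ⟨j, hj⟩ ▸ h ⟨j, hj⟩⟩
  · exact fun i hi => (δ.ancilla_ne_zero hi).symm
  · intro j hj h
    rw [hbv ⟨j, hj⟩, Fin.ext_iff, register_val] at h
    simp at h
    omega

end Setup

end Circuits

end CleanQubit

/-! ### The operator of the combined circuit and its trace. -/

namespace CleanQubit

set_option linter.unusedSectionVars false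

open Matrix ComplexOrder

section OneQubit

/-- The negation, as an operator on one qubit. -/
def xGate : Matrix (Bits 1) (Bits 1) ℂ := permMat (toggle 0 fun _ => true)

/-- A basis state of one qubit. -/
def bit (b : Bool) : Bits 1 := fun _ => b

theorem bits_one (i : Bits 1) : i = bit (i 0) := by
  funext j
  rw [Subsingleton.elim j 0]
  rfl

theorem bit_inj {b c : Bool} : bit b = bit c ↔ b = c :=
  ⟨fun h => congrFun h 0, fun h => h ▸ rfl⟩

theorem sum_bits (f : Bits 1 → ℂ) : ∑ i, f i = f (bit false) + f (bit true) := by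
  rw [← (Equiv.funUnique (Fin 1) Bool).symm.sum_comp f, Fintype.sum_bool, add_comm]
  rfl

theorem mul_bits (A B : Matrix (Bits 1) (Bits 1) ℂ) (i j : Bits 1) :
    (A * B) i j = A i (bit false) * B (bit false) j + A i (bit true) * B (bit true) j := by
  rw [Matrix.mul_apply, sum_bits]

theorem ext_bits {A B : Matrix (Bits 1) (Bits 1) ℂ}
    (h : ∀ b c, A (bit b) (bit c) = B (bit b) (bit c)) : A = B := by
  ext i j
  rw [bits_one i, bits_one j, h]

/-- The entries of the Hadamard operator. -/
noncomputable abbrev hc : ℂ := 1 / ((Real.sqrt 2 : ℝ) : ℂ)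

/-- The phase of the `T` gate. -/
noncomputable abbrev ω : ℂ := Complex.exp (Complex.I * ((Real.pi : ℝ) : ℂ) / 4)

theorem hc_sq : hc ^ 2 = 1 / 2 := by
  rw [div_pow, ← Complex.ofReal_pow, Real.sq_sqrt (by norm_num)]
  norm_num

theorem ω_pow : ω ^ 4 = -1 := by
  rw [← Complex.exp_nat_mul, ← Complex.exp_pi_mul_I]
  congr 1
  push_cast
  ring

theorem hGate_apply (b c : Bool) : hGate (bit b) (bit c) = bif b && c then -hc else hc := by
  cases b <;> cases c <;> simp [hGate, bit, neg_div]

theorem tGate_pow (k : ℕ) :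
    tGate ^ k = diagonal fun i => if i 0 then ω ^ k else 1 := by
  rw [tGate, diagonal_pow]
  congr 1
  funext i
  simp only [Pi.pow_apply]
  split_ifs <;> simp

theorem tGate_pow_apply (k : ℕ) (b c : Bool) : (tGate ^ k) (bit b) (bit c) =
    if b = c then bif b then ω ^ k else 1 else 0 := by
  rw [tGate_pow]
  by_cases h : b = c
  · subst h
    rw [diagonal_apply_eq]
    cases b <;> simp [bit]
  · rw [diagonal_apply_ne _ (fun h' => h (bit_inj.mp h')), if_neg h]

theorem tGate_apply (b c : Bool) : tGate (bit b) (bit c) =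
    if b = c then bif b then ω else 1 else 0 := by
  have := tGate_pow_apply 1 b c
  rwa [pow_one, pow_one] at this

theorem xGate_apply (b c : Bool) : xGate (bit b) (bit c) = if b = c then 0 else 1 := by
  have : toggle 0 (fun _ => true) (bit c) = bit (!c) := by
    rw [bits_one (toggle _ _ _), toggle_self]
    simp [bit]
  rw [xGate, permMat, this]
  simp only [bit_inj]
  cases b <;> cases c <;> rfl

theorem zeroProj_apply (b c : Bool) :
    zeroProj (0 : Fin 1) (bit b) (bit c) = if b = false ∧ c = false then 1 else 0 := by
  simp only [zeroProj, diagonal_apply, bit_inj]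
  cases b <;> cases c <;> simp [bit]

theorem one_apply_bits (b c : Bool) :
    (1 : Matrix (Bits 1) (Bits 1) ℂ) (bit b) (bit c) = if b = c then 1 else 0 := by
  rw [Matrix.one_apply]
  simp only [bit_inj]

theorem zeroProj_mul_mul (A : Matrix (Bits 1) (Bits 1) ℂ) :
    zeroProj 0 * A * zeroProj 0 = A (bit false) (bit false) • zeroProj (0 : Fin 1) := by
  refine ext_bits fun b c => ?_
  simp only [mul_bits, zeroProj_apply, Matrix.smul_apply, smul_eq_mul]
  cases b <;> cases c <;> simp

theorem xGate_mul_xGate : xGate * xGate = 1 := by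
  refine ext_bits fun b c => ?_
  simp only [mul_bits, xGate_apply, one_apply_bits]
  cases b <;> cases c <;> simp

theorem xGate_mul_zeroProj_mul_xGate : xGate * zeroProj 0 * xGate = 1 - zeroProj (0 : Fin 1) := by
  refine ext_bits fun b c => ?_
  simp only [mul_bits, xGate_apply, one_apply_bits, Matrix.sub_apply, zeroProj_apply]
  cases b <;> cases c <;> simp

theorem hGate_mul_hGate : hGate * hGate = 1 := by
  have := hc_sq
  refine ext_bits fun b c => ?_
  simp only [mul_bits, hGate_apply, one_apply_bits]
  cases b <;> cases c <;> simp <;> linear_combination 2 * this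

theorem hGate_tGate_hGate : hGate * tGate ^ 4 * hGate = xGate := by
  have := hc_sq
  refine ext_bits fun b c => ?_
  simp only [mul_bits, hGate_apply, tGate_pow_apply, xGate_apply, ω_pow]
  cases b <;> cases c <;> simp <;> linear_combination 2 * this

/-- The entries that occur in the expansion of the operator of the combined circuit. -/
theorem corner_entries (z : Matrix (Bits 1) (Bits 1) ℂ) (hz : z = xGate - 1) :
    (hGate * tGate ^ 5 * (tGate ^ 7 * (tGate * (tGate ^ 7 * hGate)))) (bit false) (bit false) = 0 ∧
    (hGate * tGate ^ 5 * (z * (tGate ^ 7 * (tGate * (tGate ^ 7 * hGate)))))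
      (bit false) (bit false) +
    (hGate * tGate ^ 5 * (tGate ^ 7 * (tGate * (z * (tGate ^ 7 * hGate)))))
      (bit false) (bit false) +
    (hGate * tGate ^ 5 * (z * (tGate ^ 7 * (tGate * (z * (tGate ^ 7 * hGate))))))
      (bit false) (bit false) = 0 ∧
    (hGate * tGate ^ 5 * (tGate ^ 7 * (z * (tGate * (tGate ^ 7 * hGate)))))
      (bit false) (bit false) = 0 ∧
    (hGate * tGate ^ 5 * (z * (tGate ^ 7 * (z * (tGate * (tGate ^ 7 * hGate))))))
      (bit false) (bit false) = 0 ∧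
    (hGate * tGate ^ 5 * (tGate ^ 7 * (z * (tGate * (z * (tGate ^ 7 * hGate))))))
      (bit false) (bit false) = ω + ω ^ 3 ∧
    (hGate * tGate ^ 5 * (z * (tGate ^ 7 * (z * (tGate * (z * (tGate ^ 7 * hGate)))))))
      (bit false) (bit false) = -(ω + ω ^ 3 + ω ^ 2) := by
  have h₁ := hc_sq
  have h₂ := ω_pow
  have h₅ : ω ^ 5 = -ω := by linear_combination ω * h₂
  have h₇ : ω ^ 7 = -ω ^ 3 := by linear_combination ω ^ 3 * h₂
  have hz' (b c : Bool) : z (bit b) (bit c) = if b = c then -1 else 1 := by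
    rw [hz, Matrix.sub_apply, xGate_apply, one_apply_bits]
    cases b <;> cases c <;> simp
  simp only [mul_bits, hGate_apply, tGate_pow_apply, tGate_apply, hz', h₅, h₇]
  simp
  have h₁' : (((Real.sqrt 2 : ℝ) : ℂ)⁻¹) ^ 2 = 1 / 2 := by rw [← hc_sq, hc, one_div]
  have h₆ : ω ^ 6 = -ω ^ 2 := by linear_combination ω ^ 2 * h₂
  have h₈ : ω ^ 8 = 1 := by linear_combination (ω ^ 4 - 1) * h₂
  generalize ω = u at *
  refine ⟨?_, ?_, ?_, ?_, ?_, ?_⟩ <;> ring_nf <;> simp only [h₁', h₅, h₆, h₇, h₈] <;> ring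

end OneQubit

section Amplification

variable {κ : Type} [Fintype κ] [DecidableEq κ]

theorem zeroProj_eq_lift {w : ℕ} (c : Fin w) :
    zeroProj c = lift (Setup.single c) (zeroProj 0) := by
  rw [zeroProj, zeroProj, lift_diagonal]
  rfl

theorem zeroProj_mul_self {w : ℕ} (c : Fin w) : zeroProj c * zeroProj c = zeroProj c := by
  rw [zeroProj, diagonal_mul_diagonal]
  congr 1
  funext i
  split_ifs <;> simp

theorem zeroProj_conjTranspose {w : ℕ} (c : Fin w) : (zeroProj c)ᴴ = zeroProj c := by
  rw [zeroProj, diagonal_conjTranspose]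
  congr 1
  funext i
  simp only [Pi.star_apply]
  split_ifs <;> simp

theorem initState_one {w : ℕ} (hw : 0 < w) :
    initState w 1 = ((1 / 2 : ℂ) ^ (w - 1)) • zeroProj ⟨0, hw⟩ := by
  obtain ⟨w, rfl⟩ : ∃ w', w = w' + 1 := ⟨w - 1, by omega⟩
  rw [initState, zeroProj, ← diagonal_smul]
  congr 1
  funext i
  rw [Fin.prod_univ_succ]
  have : (⟨0, hw⟩ : Fin (w + 1)) = 0 := rfl
  simp [this]

theorem trace_mul_conjTranspose_re {n : Type} [Fintype n] (M : Matrix n n ℂ) :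
    0 ≤ (trace (M * Mᴴ)).re ∧ (trace (M * Mᴴ)).im = 0 := by
  classical
  have := (Matrix.posSemidef_self_mul_conjTranspose M).trace_nonneg
  rw [Complex.le_def] at this
  exact ⟨this.1, this.2.symm⟩

variable {w : ℕ} (c : Fin w)

/-- Conjugation by the negation of `c` fixes `B` and exchanges the projections onto $|0\rangle$ and
$|1\rangle$, so both have the same trace against `B`, and these add up to the trace of `B`. -/
theorem trace_zeroProj_mul {B : Matrix (Bits w) (Bits w) ℂ}
    (hB : Commute (lift (Setup.single c) xGate) B) :
    trace (zeroProj c * B) = trace B / 2 := by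
  set X := lift (Setup.single c) xGate with hX
  have h₁ : X * X = 1 := by rw [hX, ← lift_mul, xGate_mul_xGate, lift_one]
  have h₂ : X * zeroProj c * X = 1 - zeroProj c := by
    rw [hX, zeroProj_eq_lift, ← lift_mul, ← lift_mul, xGate_mul_zeroProj_mul_xGate, lift_sub,
      lift_one]
  have h₃ : trace (X * zeroProj c * X * B) = trace (zeroProj c * B) := by
    rw [Matrix.mul_assoc, Matrix.mul_assoc, trace_mul_comm, Matrix.mul_assoc, Matrix.mul_assoc,
      ← hB.eq, ← Matrix.mul_assoc X, h₁, Matrix.one_mul]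
  rw [h₂, Matrix.sub_mul, trace_sub, Matrix.one_mul] at h₃
  linear_combination -h₃ / 2

variable {S R : Matrix (Bits w) (Bits w) ℂ}

/-- The operator of the combined circuit, where the clean qubit is `c` and `S` and `R` project onto
the conditions for its negation. -/
noncomputable def amplifier (S R : Matrix (Bits w) (Bits w) ℂ) : Matrix (Bits w) (Bits w) ℂ :=
  lift (Setup.single c) (hGate * tGate ^ 5) * ((1 + S * lift (Setup.single c) (xGate - 1)) *
    (lift (Setup.single c) (tGate ^ 7) * ((1 + R * lift (Setup.single c) (xGate - 1)) *
      (lift (Setup.single c) tGate * ((1 + S * lift (Setup.single c) (xGate - 1)) *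
        lift (Setup.single c) (tGate ^ 7 * hGate))))))

/-- Expanding the three conditional negations gives words in `S` and `R`, each tensored with an
operator on the clean qubit whose $|0\rangle\langle 0|$ entry is known from `corner_entries`. The
exponents of $T$ add up to $20\equiv 4\pmod 8$ and $HT^4H=X$, so the term without negations
vanishes; the three terms in `S` alone cancel in sum. Since `S` and `R` need not commute, `RS` and
`SRS` remain separate. -/
theorem zeroProj_amplifier (hS : ∀ A, Commute (lift (Setup.single c) A) S)
    (hR : ∀ A, Commute (lift (Setup.single c) A) R) (hSS : S * S = S) :
    zeroProj c * amplifier c S R * zeroProj c =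
      zeroProj c * ((ω + ω ^ 3) • (R * S) - (ω + ω ^ 3 + ω ^ 2) • (S * (R * S))) := by
  obtain ⟨h₀, h₁, h₂, h₃, h₄, h₅⟩ := corner_entries _ rfl
  set z := xGate - 1
  have key (A M) (hM : ∀ A, Commute (lift (Setup.single c) A) M) :
      zeroProj c * (M * lift (Setup.single c) A) * zeroProj c =
        A (bit false) (bit false) • (zeroProj c * M) := by
    rw [zeroProj_eq_lift, ← Matrix.mul_assoc, (hM _).eq, Matrix.mul_assoc M, ← lift_mul,
      Matrix.mul_assoc M, ← lift_mul, zeroProj_mul_mul, lift_smul, Matrix.mul_smul]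
  have hS' (A Y) : lift (Setup.single c) A * (S * Y) = S * (lift (Setup.single c) A * Y) := by
    rw [← Matrix.mul_assoc, (hS A).eq, Matrix.mul_assoc]
  have hR' (A Y) : lift (Setup.single c) A * (R * Y) = R * (lift (Setup.single c) A * Y) := by
    rw [← Matrix.mul_assoc, (hR A).eq, Matrix.mul_assoc]
  have hSS' (Y) : S * (S * Y) = S * Y := by rw [← Matrix.mul_assoc, hSS]
  have hexp : amplifier c S R =
      1 * lift (Setup.single c)
        (hGate * tGate ^ 5 * (tGate ^ 7 * (tGate * (tGate ^ 7 * hGate)))) +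
      (S * lift (Setup.single c)
        (hGate * tGate ^ 5 * (z * (tGate ^ 7 * (tGate * (tGate ^ 7 * hGate))))) +
      S * lift (Setup.single c)
        (hGate * tGate ^ 5 * (tGate ^ 7 * (tGate * (z * (tGate ^ 7 * hGate))))) +
      S * lift (Setup.single c)
        (hGate * tGate ^ 5 * (z * (tGate ^ 7 * (tGate * (z * (tGate ^ 7 * hGate))))))) +
      R * lift (Setup.single c)
        (hGate * tGate ^ 5 * (tGate ^ 7 * (z * (tGate * (tGate ^ 7 * hGate))))) +
      S * R * lift (Setup.single c)
        (hGate * tGate ^ 5 * (z * (tGate ^ 7 * (z * (tGate * (tGate ^ 7 * hGate)))))) +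
      R * S * lift (Setup.single c)
        (hGate * tGate ^ 5 * (tGate ^ 7 * (z * (tGate * (z * (tGate ^ 7 * hGate)))))) +
      S * (R * S) * lift (Setup.single c)
        (hGate * tGate ^ 5 * (z * (tGate ^ 7 * (z * (tGate * (z * (tGate ^ 7 * hGate))))))) := by
    simp only [amplifier, lift_mul, Matrix.mul_add, Matrix.add_mul, Matrix.one_mul,
      Matrix.mul_assoc, hS', hR', hSS']
    abel
  rw [hexp]
  simp only [Matrix.mul_add, Matrix.add_mul]
  rw [key _ 1 fun _ => Commute.one_right _, key _ S hS, key _ S hS, key _ S hS, key _ R hR,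
    key _ (S * R) fun A => (hS A).mul_right (hR A), key _ (R * S) fun A => (hR A).mul_right (hS A),
    key _ (S * (R * S)) fun A => (hS A).mul_right ((hR A).mul_right (hS A)),
    ← add_smul, ← add_smul, h₀, h₁, h₂, h₃, h₄, h₅, Matrix.mul_sub, Matrix.mul_smul,
    Matrix.mul_smul]
  simp only [zero_smul, zero_add, add_zero, neg_smul]
  rw [sub_eq_add_neg]

/-- Here $\omega+\omega^3=i\sqrt2$, so the block is $B=i\sqrt2\,RS-i(\sqrt2+1)SRS$. In
$\mathrm{tr}(BB^\dagger)$ the coefficient of $\mathrm{tr}(SR)$ is $2$ and that of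
$\mathrm{tr}(SRSR)$ is $-2\sqrt2(\sqrt2+1)+(\sqrt2+1)^2=-1$. The final division by two accounts for
the projection of the clean qubit. -/
theorem trace_amplifier (hS : ∀ A, Commute (lift (Setup.single c) A) S)
    (hR : ∀ A, Commute (lift (Setup.single c) A) R) (hSS : S * S = S) (hRR : R * R = R)
    (hSh : Sᴴ = S) (hRh : Rᴴ = R) :
    trace (zeroProj c * (amplifier c S R * zeroProj c * (amplifier c S R)ᴴ)) =
      (2 * trace (S * R) - trace (S * R * (S * R))) / 2 := by
  have hω := ω_pow
  have hstar : star ω = -ω ^ 3 := by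
    have : star ω * ω = 1 := by
      rw [Complex.star_def, ← Complex.exp_conj, ← Complex.exp_add]
      simp [map_ofNat]
      rw [← Complex.exp_zero]
      congr 1
      ring
    linear_combination star ω * hω - ω ^ 3 * this
  -- Both coefficients are purely imaginary. Arguing with powers of `ω` and $\omega^4=-1$ alone
  -- keeps square roots out of the computation.
  have hβ : star (ω + ω ^ 3) = -(ω + ω ^ 3) := by
    rw [star_add, star_pow, hstar]
    linear_combination -(ω ^ 5 - ω) * hω
  have hβ' : star (ω + ω ^ 3 + ω ^ 2) = -(ω + ω ^ 3 + ω ^ 2) := by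
    rw [star_add, hβ, star_pow, hstar]
    linear_combination ω ^ 2 * hω
  set Z := zeroProj c with hZ
  set U := amplifier c S R with hU
  have hU' := zeroProj_amplifier c hS hR hSS
  rw [← hZ, ← hU] at hU'
  have hZZ := zeroProj_mul_self c
  have hZh := zeroProj_conjTranspose c
  rw [← hZ] at hZZ hZh
  have h₁ : trace (Z * (U * Z * Uᴴ)) = trace ((Z * U * Z) * (Z * U * Z)ᴴ) := by
    have : (Z * U * Z) * (Z * U * Z)ᴴ = Z * (U * Z * Uᴴ) * Z := by
      rw [conjTranspose_mul, conjTranspose_mul, hZh]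
      simp only [Matrix.mul_assoc]
      rw [← Matrix.mul_assoc Z Z, hZZ]
    rw [this, trace_mul_comm (Z * (U * Z * Uᴴ)) Z, ← Matrix.mul_assoc Z Z, hZZ]
  have h₂ : (((ω + ω ^ 3) • (R * S) - (ω + ω ^ 3 + ω ^ 2) • (S * (R * S))) *
      ((ω + ω ^ 3) • (R * S) - (ω + ω ^ 3 + ω ^ 2) • (S * (R * S)))ᴴ) =
      (-(ω + ω ^ 3) ^ 2) • (R * (S * R)) + ((ω + ω ^ 3) * (ω + ω ^ 3 + ω ^ 2)) •
        (R * (S * (R * S)) + S * (R * (S * R))) -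
          (ω + ω ^ 3 + ω ^ 2) ^ 2 • (S * (R * (S * (R * S)))) := by
    have hSS' (Y) : S * (S * Y) = S * Y := by rw [← Matrix.mul_assoc, hSS]
    simp only [conjTranspose_sub, conjTranspose_smul, conjTranspose_mul, hSh, hRh, hβ, hβ',
      Matrix.mul_sub, Matrix.sub_mul, Matrix.smul_mul, Matrix.mul_smul,
      Matrix.mul_assoc, hSS']
    module
  -- $BB^\dagger$ is a combination of words in `S` and `R`, none of which involve the clean qubit,
  -- so `trace_zeroProj_mul` applies to it.
  have h₃ : Commute (lift (Setup.single c) xGate)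
      (((ω + ω ^ 3) • (R * S) - (ω + ω ^ 3 + ω ^ 2) • (S * (R * S))) *
      ((ω + ω ^ 3) • (R * S) - (ω + ω ^ 3 + ω ^ 2) • (S * (R * S)))ᴴ) := by
    have hS := hS xGate
    have hR := hR xGate
    have h₄ := hR.mul_right (hS.mul_right hR)
    have h₅ := hS.mul_right h₄
    have h₆ := hR.mul_right (hS.mul_right (hR.mul_right hS))
    rw [h₂]
    exact ((h₄.smul_right _).add_right ((h₆.add_right h₅).smul_right _)).sub_right
      ((hS.mul_right h₆).smul_right _)
  have t₁ : trace (R * (S * R)) = trace (S * R) := by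
    rw [trace_mul_comm, Matrix.mul_assoc, hRR]
  have t₂ : trace (S * (R * (S * R))) = trace (S * R * (S * R)) := by rw [Matrix.mul_assoc]
  have t₃ : trace (R * (S * (R * S))) = trace (S * R * (S * R)) := by
    rw [trace_mul_comm, ← t₂]
    simp only [Matrix.mul_assoc]
  have t₄ : trace (S * (R * (S * (R * S)))) = trace (S * R * (S * R)) := by
    rw [trace_mul_comm, ← t₃]
    simp only [Matrix.mul_assoc, hSS]
  rw [h₁, hU']
  generalize (ω + ω ^ 3) • (R * S) - (ω + ω ^ 3 + ω ^ 2) • (S * (R * S)) = B at *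
  have h₄ : trace (Z * B * (Z * B)ᴴ) = trace (Z * (B * Bᴴ)) := by
    rw [conjTranspose_mul, hZh, ← Matrix.mul_assoc, trace_mul_comm, ← Matrix.mul_assoc,
      ← Matrix.mul_assoc, hZZ, Matrix.mul_assoc]
  rw [h₄, trace_zeroProj_mul c h₃, h₂]
  simp only [trace_add, trace_sub, trace_smul, smul_eq_mul, t₁, t₂, t₃, t₄]
  linear_combination (-(ω ^ 2 + 2) * trace (S * R) / 2 + (ω ^ 2 + 1) *
    trace (S * R * (S * R)) / 2) * hω

/-- $\mathrm{tr}(SRSR)$ is the squared Hilbert–Schmidt norm of $SRS$, and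
$\mathrm{tr}(SR)-\mathrm{tr}(SRSR)$ is that of $SR(1-S)$. -/
theorem trace_bounds (hSS : S * S = S) (hRR : R * R = R) (hSh : Sᴴ = S) (hRh : Rᴴ = R) :
    0 ≤ (trace (S * R * (S * R))).re ∧ (trace (S * R * (S * R))).re ≤ (trace (S * R)).re := by
  have h₁ := trace_mul_conjTranspose_re (S * (R * S))
  have h₂ := trace_mul_conjTranspose_re (S * (R * (1 - S)))
  have e₁ : trace (S * (R * S) * (S * (R * S))ᴴ) = trace (S * R * (S * R)) := by
    simp only [conjTranspose_mul, hSh, hRh, Matrix.mul_assoc]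
    rw [← Matrix.mul_assoc S S, hSS, trace_mul_comm S]
    simp only [Matrix.mul_assoc]
    rw [hSS, trace_mul_comm]
    simp only [Matrix.mul_assoc]
  have e₂ : trace (S * (R * (1 - S)) * (S * (R * (1 - S)))ᴴ) =
      trace (S * R) - trace (S * R * (S * R)) := by
    have : (1 - S) * (1 - S) = 1 - S := by
      simp [Matrix.mul_sub, Matrix.sub_mul, hSS]
    simp only [conjTranspose_mul, conjTranspose_sub, conjTranspose_one, hSh, hRh, Matrix.mul_assoc]
    rw [← Matrix.mul_assoc (1 - S), this, trace_mul_comm S]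
    simp only [Matrix.mul_assoc, hSS, Matrix.sub_mul, Matrix.mul_sub, Matrix.one_mul, trace_sub]
    have : trace (R * (S * (R * S))) = trace (S * (R * (S * R))) := by
      rw [trace_mul_comm]
      simp only [Matrix.mul_assoc]
    rw [← Matrix.mul_assoc R R, hRR, this, trace_mul_comm R S]
  rw [e₁] at h₁
  rw [e₂, Complex.sub_re] at h₂
  exact ⟨h₁.1, by linarith [h₂.1]⟩

end Amplification

end CleanQubit

/-! ### The acceptance probability of the combined circuit. -/

namespace CleanQubit

set_option linter.unusedSectionVars false

open Matrix

variable {G : GateSet}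

/-- The projection onto the states in which qubit `o` is `|1⟩`. -/
def oneProj {w : ℕ} (o : Fin w) : Matrix (Bits w) (Bits w) ℂ :=
  diagonal fun i => if i o then 1 else 0

theorem oneProj_mul_self {w : ℕ} (c : Fin w) : oneProj c * oneProj c = oneProj c := by
  rw [oneProj, diagonal_mul_diagonal]
  congr 1
  funext i
  split_ifs <;> simp

theorem oneProj_conjTranspose {w : ℕ} (c : Fin w) : (oneProj c)ᴴ = oneProj c := by
  rw [oneProj, diagonal_conjTranspose]
  congr 1
  funext i
  simp only [Pi.star_apply]
  split_ifs <;> simp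

theorem xGate_conjTranspose : xGateᴴ = xGate := by
  refine ext_bits fun b c => ?_
  rw [conjTranspose_apply, xGate_apply, xGate_apply]
  cases b <;> cases c <;> simp

/-- The negation of qubit `c`. -/
noncomputable abbrev xOn {w : ℕ} (c : Fin w) : Matrix (Bits w) (Bits w) ℂ :=
  lift (Setup.single c) xGate

theorem xOn_mul_xOn {w : ℕ} (c : Fin w) : xOn c * xOn c = 1 := by
  rw [xOn, ← lift_mul, xGate_mul_xGate, lift_one]

theorem xOn_conjTranspose {w : ℕ} (c : Fin w) : (xOn c)ᴴ = xOn c := by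
  rw [xOn, ← lift_conjTranspose, xGate_conjTranspose]

theorem xOn_mul_oneProj_mul_xOn {w : ℕ} (c : Fin w) : xOn c * oneProj c * xOn c = zeroProj c := by
  have h : oneProj c = 1 - zeroProj c := by
    rw [oneProj, zeroProj, ← diagonal_one, diagonal_sub]
    congr 1
    funext i
    split_ifs <;> simp
  have h' : xOn c * zeroProj c * xOn c = 1 - zeroProj c := by
    rw [xOn, zeroProj_eq_lift, ← lift_mul, ← lift_mul, xGate_mul_zeroProj_mul_xGate, lift_sub,
      lift_one]
  rw [h, Matrix.mul_sub, Matrix.sub_mul, h', Matrix.mul_one, xOn_mul_xOn, sub_sub_cancel]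

namespace Setup

variable (δ : Setup G)

/-- The qubits of all the registers. -/
def registers : Fin δ.N × Fin δ.w ↪ Fin δ.width where
  toFun p := δ.register p.1 p.2
  inj' := by
    rintro ⟨i, j⟩ ⟨i', j'⟩ h
    simp only [Fin.ext_iff, register_val] at h
    have hj := j.2
    have hj' := j'.2
    have h₁ : i * (δ.w + 1) + (j : ℕ) = i' * (δ.w + 1) + j' := by omega
    have h₂ := congrArg (· % (δ.w + 1)) h₁
    have h₃ := congrArg (· / (δ.w + 1)) h₁
    simp only [Nat.mul_add_mod_self_right] at h₂
    rw [Nat.mod_eq_of_lt (by omega), Nat.mod_eq_of_lt (by omega)] at h₂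
    have h₄ : (i : ℕ) = i' := by
      rw [h₂] at h₁
      exact Nat.eq_of_mul_eq_mul_right (Nat.succ_pos δ.w) (Nat.add_right_cancel h₁)
    rw [Prod.mk.injEq]
    exact ⟨Fin.ext h₄, Fin.ext h₂⟩

theorem register_ne_zero (p : Fin δ.N × Fin δ.w) : δ.registers p ≠ 0 := by
  intro h
  have := congrArg Fin.val h
  rw [show δ.registers p = δ.register p.1 p.2 from rfl, register_val] at this
  simp at this

/-- The operator that acts as `M` on each of the registers. -/
noncomputable def each (M : Matrix (Bits δ.w) (Bits δ.w) ℂ) :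
    Matrix (Bits δ.width) (Bits δ.width) ℂ := lift δ.registers (tens fun _ => M)

theorem each_mul (M M' : Matrix (Bits δ.w) (Bits δ.w) ℂ) :
    δ.each (M * M') = δ.each M * δ.each M' := by
  rw [each, each, each, ← lift_mul, tens_mul]

theorem each_one : δ.each 1 = 1 := by
  rw [each, tens_one, lift_one]

theorem each_conjTranspose (M : Matrix (Bits δ.w) (Bits δ.w) ℂ) :
    δ.each Mᴴ = (δ.each M)ᴴ := by
  rw [each, each, ← lift_conjTranspose, tens_conjTranspose]

theorem trace_each (M : Matrix (Bits δ.w) (Bits δ.w) ℂ) :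
    2 ^ (δ.N * δ.w) * trace (δ.each M) = 2 ^ δ.width * trace M ^ δ.N := by
  have := trace_lift δ.registers (tens fun _ => M)
  rw [trace_tens] at this
  simpa [each] using this

theorem commute_each (A : Matrix (Bits 1) (Bits 1) ℂ) (M : Matrix (Bits δ.w) (Bits δ.w) ℂ) :
    Commute (lift (single (0 : Fin δ.width)) A) (δ.each M) :=
  commute_lift _ _ _ (fun _ p => (δ.register_ne_zero p).symm) _

theorem each_oneProj (k : Fin δ.w) : δ.each (oneProj k) =
    diagonal fun x => if decide (∀ i, x (δ.register i k) = true) then 1 else 0 := by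
  rw [each, oneProj, tens_diagonal, lift_diagonal]
  congr 1
  funext x
  rw [Finset.prod_ite_zero]
  simp
  rfl

/-- The original circuit, with its input and output qubits negated, as an operator. -/
noncomputable def inner' : Matrix (Bits δ.w) (Bits δ.w) ℂ :=
  xOn δ.o * opOf δ.gs * xOn δ.zero

theorem conjTranspose_mul_inner' : δ.inner'ᴴ * δ.inner' = 1 := by
  rw [inner', conjTranspose_mul, conjTranspose_mul, xOn_conjTranspose, xOn_conjTranspose]
  simp only [Matrix.mul_assoc]
  rw [← Matrix.mul_assoc (xOn δ.o) (xOn δ.o), xOn_mul_xOn, Matrix.one_mul,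
    ← Matrix.mul_assoc (opOf δ.gs)ᴴ, conjTranspose_mul_opOf, Matrix.one_mul, xOn_mul_xOn]

/-- The projection onto acceptance, before the application of the circuit. -/
noncomputable def accepting : Matrix (Bits δ.w) (Bits δ.w) ℂ :=
  δ.inner'ᴴ * oneProj δ.o * δ.inner'

theorem accepting_mul_self : δ.accepting * δ.accepting = δ.accepting := by
  have h : δ.inner' * δ.inner'ᴴ = 1 := mul_eq_one_comm.mp δ.conjTranspose_mul_inner'
  rw [accepting]
  simp only [Matrix.mul_assoc]
  rw [← Matrix.mul_assoc δ.inner' δ.inner'ᴴ, h, Matrix.one_mul,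
    ← Matrix.mul_assoc (oneProj δ.o) (oneProj δ.o), oneProj_mul_self]

theorem accepting_conjTranspose : δ.acceptingᴴ = δ.accepting := by
  rw [accepting, conjTranspose_mul, conjTranspose_mul, conjTranspose_conjTranspose,
    oneProj_conjTranspose, Matrix.mul_assoc]

/-- The negations in `inner'` turn the projections onto $|1\rangle$ into projections onto
$|0\rangle$; cyclicity of the trace does the rest. The right-hand side is the acceptance probability
of the original circuit without its factor $2^{-(w-1)}$. -/
theorem trace_oneProj_mul_accepting : trace (oneProj δ.zero * δ.accepting) =
    trace (zeroProj δ.o * (opOf δ.gs * zeroProj δ.zero * (opOf δ.gs)ᴴ)) := by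
  rw [accepting, inner', conjTranspose_mul, conjTranspose_mul, xOn_conjTranspose,
    xOn_conjTranspose, ← xOn_mul_oneProj_mul_xOn, ← xOn_mul_oneProj_mul_xOn]
  set Q := opOf δ.gs
  set x := xOn δ.zero
  set y := xOn δ.o
  set p := oneProj δ.zero
  set r := oneProj δ.o
  have h₁ : trace (p * (x * (Qᴴ * y) * r * (y * Q * x))) =
      trace ((p * x * Qᴴ) * (y * r * y * Q * x)) := by
    simp only [Matrix.mul_assoc]
  have h₂ : (y * r * y * Q * x) * (p * x * Qᴴ) = y * r * y * (Q * (x * p * x) * Qᴴ) := by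
    simp only [Matrix.mul_assoc]
  rw [h₁, trace_mul_comm, h₂]

variable {T : Gadgets G} (hT : T.Valid)
include hT

theorem opOf_forward (i : Fin δ.N) : opOf (δ.forward T i) = lift (δ.register i) δ.inner' := by
  have hx (j : Fin δ.w) :
      opOf (place T.x (single (δ.register i j))) = lift (δ.register i) (xOn j) := by
    rw [opOf_place, hT.x, xOn, lift_lift]
    rfl
  rw [forward, opOf_append, opOf_append, hx, hx, opOf_place, opOf_subst_self, inner', lift_mul,
    lift_mul]

theorem opOf_backward (i : Fin δ.N) :
    opOf (δ.backward T i) = lift (δ.register i) δ.inner'ᴴ := by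
  have hx (j : Fin δ.w) :
      opOf (place T.x (single (δ.register i j))) = lift (δ.register i) (xOn j) := by
    rw [opOf_place, hT.x, xOn, lift_lift]
    rfl
  rw [backward, opOf_append, opOf_append, hx, hx, opOf_place, opOf_subst_inv hT.inv, inner',
    conjTranspose_mul, conjTranspose_mul, xOn_conjTranspose, xOn_conjTranspose, lift_mul,
    lift_mul, Matrix.mul_assoc]

theorem opOf_flipIf_eq (k : Fin δ.w) : opOf (δ.flipIf T k) =
    1 + δ.each (oneProj k) * lift (single 0) (xGate - 1) := by
  rw [δ.opOf_flipIf hT, permMat_toggle, lift_sub, lift_one, each_oneProj]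
  · congr 3
    rw [xGate, lift_toggle]
    rfl
  · intro x b
    congr 1
    simp only [eq_iff_iff]
    refine forall_congr' fun i => ?_
    rw [Function.update_of_ne (show δ.register i k ≠ 0 from δ.register_ne_zero (i, k))]

/-- Between `forward` and `backward` the clean qubit is negated conditionally on the outputs.
Conjugation by the circuits turns that condition into acceptance, the projection `R`, since they do
not act on the clean qubit. -/
theorem opOf_gates : opOf (δ.gates T) =
    amplifier 0 (δ.each (oneProj δ.zero)) (δ.each δ.accepting) := by
  have h₁ : opOf (ascend (δ.forward T)) = δ.each δ.inner' :=
    opOf_ascend δ.registers (δ.opOf_forward hT)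
  have h₂ : opOf (ascend (δ.backward T)) = δ.each δ.inner'ᴴ :=
    opOf_ascend δ.registers (δ.opOf_backward hT)
  have h₃ : δ.each δ.inner'ᴴ * ((1 + δ.each (oneProj δ.o) * lift (single 0) (xGate - 1)) *
      δ.each δ.inner') = 1 + δ.each δ.accepting * lift (single 0) (xGate - 1) := by
    rw [Matrix.add_mul, Matrix.mul_add, Matrix.one_mul, ← each_mul, conjTranspose_mul_inner',
      each_one, Matrix.mul_assoc (δ.each (oneProj δ.o)), (δ.commute_each _ _).eq,
      ← Matrix.mul_assoc, ← Matrix.mul_assoc, ← each_mul, ← each_mul]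
    rfl
  rw [amplifier, ← h₃, gates]
  simp only [opOf_append, opOf_place, opOf_power, hT.h, hT.t, δ.opOf_flipIf_eq hT, h₁, h₂,
    Matrix.mul_assoc]

end Setup

/-- The acceptance probability as a complex number. -/
theorem accProb_one (C : Circuit G) : C.accProb 1 = (((1 / 2 : ℂ) ^ (C.width - 1)) *
    trace (zeroProj C.out * (opOf C.gates * zeroProj ⟨0, C.out.pos⟩ * (opOf C.gates)ᴴ))).re := by
  rw [Circuit.accProb, initState_one C.out.pos]
  congr 1
  rw [Matrix.mul_smul, Matrix.smul_mul, Matrix.mul_smul, trace_smul, smul_eq_mul]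

/-- The probability is $2^{-W}(2\,\mathrm{tr}(SR)-\mathrm{tr}(SRSR))$ for the total width $W$, and
$2^{-W}\mathrm{tr}(SR)=(a/2)^N$ because `S` and `R` are tensor powers. `trace_bounds` then gives
both inequalities. -/
theorem accProb_circuit_bounds {T : Gadgets G} (hT : T.Valid) (Q : Circuit G) (N : ℕ) :
    0 ≤ Q.accProb 1 ∧
    (Q.accProb 1 / 2) ^ N ≤ (Setup.circuit ⟨Q.width, N, Q.out, Q.gates⟩ T).accProb 1 ∧
    (Setup.circuit ⟨Q.width, N, Q.out, Q.gates⟩ T).accProb 1 ≤ 2 * (Q.accProb 1 / 2) ^ N := by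
  set δ : Setup G := ⟨Q.width, N, Q.out, Q.gates⟩ with hδ
  have hP := oneProj_mul_self δ.zero
  have hPh := oneProj_conjTranspose δ.zero
  have hR := δ.accepting_mul_self
  have hRh := δ.accepting_conjTranspose
  -- For projections $P$ and $A$ one has $\mathrm{tr}(PA)=\mathrm{tr}(PA(PA)^\dagger)$, so this
  -- trace is real and nonnegative.
  obtain ⟨τ, hτ, hτ0⟩ : ∃ τ : ℝ, trace (oneProj δ.zero * δ.accepting) = τ ∧ 0 ≤ τ := by
    have h := trace_mul_conjTranspose_re (oneProj δ.zero * δ.accepting)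
    have e : trace (oneProj δ.zero * δ.accepting * (oneProj δ.zero * δ.accepting)ᴴ) =
        trace (oneProj δ.zero * δ.accepting) := by
      rw [conjTranspose_mul, hPh, hRh, ← Matrix.mul_assoc, Matrix.mul_assoc (oneProj δ.zero), hR,
        trace_mul_comm, ← Matrix.mul_assoc, hP]
    rw [e] at h
    exact ⟨_, Complex.ext rfl h.2, h.1⟩
  have hw : 0 < δ.w := Q.out.pos
  -- The original circuit has only $w-1$ mixed qubits, whereas all $w$ qubits of a register are
  -- mixed; hence the extra factor $1/2$ for each copy.
  have ha : Q.accProb 1 / 2 = (1 / 2 : ℝ) ^ δ.w * τ := by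
    have h := δ.trace_oneProj_mul_accepting
    rw [hτ] at h
    have h' : trace (zeroProj Q.out *
        (opOf Q.gates * zeroProj ⟨0, Q.out.pos⟩ * (opOf Q.gates)ᴴ)) = τ := h.symm
    rw [accProb_one, h']
    have e : (1 / 2 : ℂ) ^ (Q.width - 1) * τ = (((1 / 2 : ℝ) ^ (Q.width - 1) * τ : ℝ) : ℂ) := by
      push_cast
      rfl
    rw [e, Complex.ofReal_re]
    have : δ.w = Q.width - 1 + 1 := (Nat.succ_pred_eq_of_pos hw).symm
    rw [this, pow_succ]
    ring
  set S := δ.each (oneProj δ.zero) with hS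
  set R := δ.each δ.accepting with hRdef
  have hSS : S * S = S := by rw [hS, ← Setup.each_mul, hP]
  have hRR : R * R = R := by rw [hRdef, ← Setup.each_mul, hR]
  have hSh : Sᴴ = S := by rw [hS, ← Setup.each_conjTranspose, hPh]
  have hRh' : Rᴴ = R := by rw [hRdef, ← Setup.each_conjTranspose, hRh]
  obtain ⟨h₁, h₂⟩ := trace_bounds hSS hRR hSh hRh'
  have hacc : (Setup.circuit δ T).accProb 1 =
      (1 / 2 : ℝ) ^ δ.width * (2 * (trace (S * R)).re - (trace (S * R * (S * R))).re) := by
    have h := trace_amplifier (0 : Fin δ.width) (fun A => δ.commute_each A _)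
      (fun A => δ.commute_each A _) hSS hRR hSh hRh'
    have hz : zeroProj (⟨0, (Setup.circuit δ T).out.pos⟩ : Fin (Setup.circuit δ T).width) =
      zeroProj (0 : Fin δ.width) := rfl
    have e : (Setup.circuit δ T).accProb 1 = (((1 / 2 : ℂ) ^ (δ.width - 1)) *
        trace (zeroProj (0 : Fin δ.width) * (amplifier 0 S R * zeroProj 0 *
          (amplifier 0 S R)ᴴ))).re := by
      rw [accProb_one, hz, ← δ.opOf_gates hT]
      rfl
    rw [e, h]
    have e' : (1 / 2 : ℂ) ^ (δ.width - 1) * ((2 * trace (S * R) - trace (S * R * (S * R))) / 2) =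
        (((1 / 2 : ℝ) ^ δ.width : ℝ) : ℂ) * (2 * trace (S * R) - trace (S * R * (S * R))) := by
      have h₃ : (1 / 2 : ℝ) ^ δ.width = (1 / 2) ^ (δ.width - 1) * (1 / 2) := by
        rw [← pow_succ]
        congr 1
      rw [h₃]
      push_cast
      ring
    rw [e', Complex.re_ofReal_mul]
    simp
  have hm : (1 / 2 : ℝ) ^ δ.width * (trace (S * R)).re = (Q.accProb 1 / 2) ^ N := by
    have h := δ.trace_each (oneProj δ.zero * δ.accepting)
    rw [Setup.each_mul, ← hS, ← hRdef, hτ] at h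
    have h' := congrArg Complex.re h
    have e₁ : (2 : ℂ) ^ (δ.N * δ.w) = ((2 ^ (δ.N * δ.w) : ℝ) : ℂ) := by push_cast; rfl
    have e₂ : (2 : ℂ) ^ δ.width * (τ : ℂ) ^ δ.N = ((2 ^ δ.width * τ ^ δ.N : ℝ) : ℂ) := by
      push_cast; rfl
    rw [e₁, e₂, Complex.re_ofReal_mul, Complex.ofReal_re] at h'
    rw [ha, mul_pow, ← pow_mul, one_div, inv_pow, inv_pow, mul_comm δ.w]
    change _ = ((2 : ℝ) ^ (δ.N * δ.w))⁻¹ * τ ^ δ.N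
    field_simp
    linarith [h']
  have hpos : (0 : ℝ) < (1 / 2 : ℝ) ^ δ.width := by positivity
  refine ⟨?_, ?_, ?_⟩
  · have : 0 ≤ Q.accProb 1 / 2 := by
      rw [ha]
      positivity
    linarith
  · rw [hacc, ← hm]
    exact mul_le_mul_of_nonneg_left (by linarith) hpos.le
  · rw [hacc, ← hm]
    nlinarith

end CleanQubit

/-! ### The Toffoli gate from Hadamard, $T$ and CNOT gates. -/

namespace CleanQubit

open Matrix

section Toffoli

theorem ω_pow_eight : ω ^ 8 = 1 := by
  linear_combination (ω ^ 4 - 1) * ω_pow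

theorem permMat_mul_diagonal_mul {κ : Type} [Fintype κ] [DecidableEq κ]
    {F F' : (κ → Bool) → κ → Bool} (h : F' ∘ F = id) (d : (κ → Bool) → ℂ) :
    permMat F' * diagonal d * permMat F = diagonal (d ∘ F) := by
  ext i j
  rw [Matrix.mul_apply, Finset.sum_eq_single (F j)]
  · rw [Matrix.mul_diagonal, permMat, permMat, if_pos rfl, mul_one, show F' (F j) = j from
      congrFun h j]
    by_cases hi : i = j
    · subst hi
      simp
    · rw [if_neg hi, zero_mul, diagonal_apply_ne _ hi]
  · intro k _ hk
    rw [permMat.eq_1 F, if_neg hk, mul_zero]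
  · simp

variable {G : GateSet} {w : ℕ}

theorem opOf_phase {t : List (PlacedGate G 1)} (ht : opOf t = tGate) (k : ℕ) (q : Fin w) :
    opOf (place (power k t) (Setup.single q)) = diagonal fun x => if x q then ω ^ k else 1 := by
  rw [opOf_place, opOf_power, ht, tGate_pow, lift_diagonal]
  rfl

theorem opOf_pair {cx : List (PlacedGate G 2)} (hcx : opOf cx = permMat (toggle 1 fun x => x 0))
    {i j : Fin w} (h : i ≠ j) :
    opOf (place cx (Setup.pair i j h)) = permMat (toggle j fun x => x i) := by
  rw [opOf_place, hcx, lift_toggle]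
  rfl

/-- The phase `ω ^ k` on the sum of the bits `i` and `j`. -/
theorem opOf_phase_xor {t : List (PlacedGate G 1)} (ht : opOf t = tGate)
    {cx : List (PlacedGate G 2)} (hcx : opOf cx = permMat (toggle 1 fun x => x 0))
    (k : ℕ) {i j : Fin w} (h : i ≠ j) :
    opOf (place cx (Setup.pair i j h) ++ place (power k t) (Setup.single j) ++
      place cx (Setup.pair i j h)) = diagonal fun x => if xor (x j) (x i) then ω ^ k else 1 := by
  have hF : toggle j (fun x : Bits w => x i) ∘ toggle j (fun x => x i) = id := by
    funext x q
    by_cases hq : q = j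
    · subst hq
      simp [toggle_self, toggle_of_ne h]
    · simp [toggle_of_ne hq]
  rw [opOf_append, opOf_append, opOf_phase ht, opOf_pair hcx, ← Matrix.mul_assoc,
    permMat_mul_diagonal_mul hF]
  congr 1
  funext x
  simp only [Function.comp_apply, toggle_self]

/-- The phase `ω ^ k` on the sum of the bits `i`, `j` and `l`. -/
theorem opOf_phase_xor_xor {t : List (PlacedGate G 1)} (ht : opOf t = tGate)
    {cx : List (PlacedGate G 2)} (hcx : opOf cx = permMat (toggle 1 fun x => x 0))
    (k : ℕ) {i j l : Fin w} (h : i ≠ j) (h' : j ≠ l) :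
    opOf (place cx (Setup.pair i j h) ++ (place cx (Setup.pair j l h') ++
      place (power k t) (Setup.single l) ++ place cx (Setup.pair j l h')) ++
      place cx (Setup.pair i j h)) =
      diagonal fun x => if xor (x l) (xor (x j) (x i)) then ω ^ k else 1 := by
  have hF : toggle j (fun x : Bits w => x i) ∘ toggle j (fun x => x i) = id := by
    funext x q
    by_cases hq : q = j
    · subst hq
      simp [toggle_self, toggle_of_ne h]
    · simp [toggle_of_ne hq]
  rw [opOf_append, opOf_append, opOf_phase_xor ht hcx, opOf_pair hcx, ← Matrix.mul_assoc,
    permMat_mul_diagonal_mul hF]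
  congr 1
  funext x
  simp only [Function.comp_apply, toggle_self, toggle_of_ne h'.symm]

/-- The doubly controlled phase gate. -/
def ccz (t : List (PlacedGate G 1)) (cx : List (PlacedGate G 2)) : List (PlacedGate G 3) :=
  place (power 1 t) (Setup.single 0) ++ (place (power 1 t) (Setup.single 1) ++
  (place (power 1 t) (Setup.single 2) ++
  ((place cx (Setup.pair 0 1 (by decide)) ++ place (power 7 t) (Setup.single 1) ++
    place cx (Setup.pair 0 1 (by decide))) ++
  ((place cx (Setup.pair 0 2 (by decide)) ++ place (power 7 t) (Setup.single 2) ++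
    place cx (Setup.pair 0 2 (by decide))) ++
  ((place cx (Setup.pair 1 2 (by decide)) ++ place (power 7 t) (Setup.single 2) ++
    place cx (Setup.pair 1 2 (by decide))) ++
  (place cx (Setup.pair 0 1 (by decide)) ++ (place cx (Setup.pair 1 2 (by decide)) ++
      place (power 1 t) (Setup.single 2) ++ place cx (Setup.pair 1 2 (by decide))) ++
      place cx (Setup.pair 0 1 (by decide))))))))

/-- For bits, $x+y+z-(x\oplus y)-(x\oplus z)-(y\oplus z)+(x\oplus y\oplus z)=4xyz$, so $T$ phases on
these seven parities multiply to $\omega^{4xyz}=(-1)^{xyz}$. As $\omega^8=1$, the power `7` stands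
for the inverse of $T$. -/
theorem opOf_ccz {t : List (PlacedGate G 1)} (ht : opOf t = tGate)
    {cx : List (PlacedGate G 2)} (hcx : opOf cx = permMat (toggle 1 fun x => x 0)) :
    opOf (ccz t cx) = 1 + diagonal (fun x => if x 0 && x 1 then 1 else 0) *
      lift (Setup.single 2) (tGate ^ 4 - 1) := by
  have h : opOf (ccz t cx) = diagonal fun x => if x 0 && x 1 && x 2 then ω ^ 4 else 1 := by
    simp only [ccz]
    rw [opOf_append, opOf_append, opOf_append, opOf_append, opOf_append, opOf_append,
      opOf_phase ht, opOf_phase ht, opOf_phase ht, opOf_phase_xor ht hcx, opOf_phase_xor ht hcx,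
      opOf_phase_xor ht hcx, opOf_phase_xor_xor ht hcx]
    simp only [diagonal_mul_diagonal]
    congr 1
    funext x
    have h₁ : ω ^ 16 = 1 := by linear_combination (ω ^ 8 + 1) * ω_pow_eight
    cases x 0 <;> cases x 1 <;> cases x 2 <;> simp <;> ring_nf <;> exact h₁
  rw [h, lift_sub, lift_one, tGate_pow, lift_diagonal, ← diagonal_one, diagonal_sub,
    diagonal_mul_diagonal, diagonal_add]
  congr 1
  funext x
  by_cases h₀ : x 0 <;> by_cases h₁ : x 1 <;> by_cases h₂ : x 2 <;> simp [h₀, h₁, h₂]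

/-- Hadamard gates on the target turn $T^4$ into the negation and commute with the condition on the
two controls. -/
theorem opOf_toffoli {h t : List (PlacedGate G 1)} (hh : opOf h = hGate) (ht : opOf t = tGate)
    {cx : List (PlacedGate G 2)} (hcx : opOf cx = permMat (toggle 1 fun x => x 0)) :
    opOf (place h (Setup.single 2) ++ ccz t cx ++ place h (Setup.single 2)) =
      permMat (toggle 2 fun x : Bits 3 => x 0 && x 1) := by
  set P : Matrix (Bits 3) (Bits 3) ℂ := diagonal fun x => if x 0 && x 1 then 1 else 0 with hP
  have hcomm : lift (Setup.single 2) hGate * P = P * lift (Setup.single 2) hGate := by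
    have : P = lift (Setup.pair 0 1 (by decide)) (diagonal fun x => if x 0 && x 1 then 1 else 0) := by
      rw [lift_diagonal]
      rfl
    rw [this]
    refine commute_lift _ _ _ (fun _ b => ?_) _
    fin_cases b
    · exact (by decide : (2 : Fin 3) ≠ 0)
    · exact (by decide : (2 : Fin 3) ≠ 1)
  have hX : hGate * (tGate ^ 4 - 1) * hGate = xGate - 1 := by
    rw [Matrix.mul_sub, Matrix.sub_mul, hGate_tGate_hGate, Matrix.mul_one, hGate_mul_hGate]
  rw [opOf_append, opOf_append, opOf_place, hh, opOf_ccz ht hcx, ← hP, Matrix.add_mul,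
    Matrix.mul_add, Matrix.one_mul, ← lift_mul, hGate_mul_hGate, lift_one, Matrix.mul_assoc P,
    ← Matrix.mul_assoc _ P, hcomm, Matrix.mul_assoc P, ← lift_mul, ← lift_mul, ← Matrix.mul_assoc,
    hX, lift_sub, lift_one, xGate, lift_toggle, permMat_toggle _ fun x => x 0 && x 1]
  · rfl
  · intro x b
    rw [Function.update_of_ne (by decide), Function.update_of_ne (by decide)]

theorem cnot_eq : cnot = permMat (toggle 1 fun x => x 0) := by
  ext i j
  refine if_congr ⟨fun h => funext fun q => ?_, fun h => ?_⟩ rfl rfl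
  · fin_cases q
    · exact h.1.trans (toggle_of_ne (by decide) (fun x => x 0) j).symm
    · exact h.2.trans (toggle_self 1 (fun x => x 0) j).symm
  · rw [h]
    exact ⟨toggle_of_ne (by decide) _ _, toggle_self 1 (fun x => x 0) j⟩

theorem exists_opOf_eq {k : ℕ} {M : Matrix (Bits k) (Bits k) ℂ} {g : Fin G.size}
    (h : G.gate g = ⟨k, M⟩) : ∃ L : List (PlacedGate G k), opOf L = M := by
  -- The arity of the gate is part of the equation, so the dependent pair is generalised as a whole
  -- before substituting.
  have key : ∀ s : Σ k, Matrix (Bits k) (Bits k) ℂ, G.gate g = s →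
      ∃ L : List (PlacedGate G s.1), opOf L = s.2 := by
    rintro s rfl
    exact ⟨G.self g, opOf_self g⟩
  exact key _ h

theorem exists_valid_gadgets (hG : G.ContainsHTCnot) (hinv : G.InverseClosed) :
    ∃ T : Gadgets G, T.Valid := by
  obtain ⟨⟨g₁, h₁⟩, ⟨g₂, h₂⟩, g₃, h₃⟩ := hG
  obtain ⟨h, hh⟩ := exists_opOf_eq h₁
  obtain ⟨t, ht⟩ := exists_opOf_eq h₂
  obtain ⟨cx, hcx⟩ := exists_opOf_eq h₃
  rw [cnot_eq] at hcx
  choose inv hinv using hinv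
  refine ⟨⟨h, t, h ++ power 4 t ++ h, cx, _, inv⟩, hh, ht, ?_, hcx, opOf_toffoli hh ht hcx, hinv⟩
  rw [opOf_append, opOf_append, opOf_power, hh, ht, ← Matrix.mul_assoc]
  exact hGate_tGate_hGate

end Toffoli

end CleanQubit

/-! ### Choice of the number of copies and of the exponent. -/

theorem mainTheorem8 (G : CleanQubit.GateSet) (hG : G.ContainsHTCnot) (hinv : G.InverseClosed)
    (p : ℕ → ℕ+) (hp : CleanQubit.PolyBounded p)
    (A : CleanQubit.PromiseProblem) (hA : A ∈ CleanQubit.SBQoneP G) :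
    ∃ q : ℕ → ℕ+, CleanQubit.PolyBounded q ∧
      A ∈ CleanQubit.QoneP G
        (fun n => CleanQubit.twoPowNeg q n * (1 - CleanQubit.twoPowNeg p n))
        (fun n => CleanQubit.twoPowNeg q n * CleanQubit.twoPowNeg p n) := by
  obtain ⟨r, hr, Q, hQ, ⟨w, hw, -, hQw⟩, hyes, hno⟩ := hA
  obtain ⟨T, hT⟩ := CleanQubit.exists_valid_gadgets hG hinv
  have hbound (x : List Bool) := CleanQubit.accProb_circuit_bounds hT (Q x) (p x.length + 1)
  have hpow (f : ℕ → ℕ+) (n : ℕ) : CleanQubit.twoPowNeg f n = (2⁻¹ : ℝ) ^ (f n : ℕ) := by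
    rw [CleanQubit.twoPowNeg, zpow_neg, zpow_natCast, inv_pow]
  -- In the yes case $p+1$ copies give $(2^{-r}/2)^{p+1}$, which determines the exponent
  -- $q=(r+1)(p+1)$.
  have hq : CleanQubit.PolyBounded fun n => (r n + 1) * (p n + 1) :=
    hr.add_mul hp 0 fun n => by simp
  have hw' : CleanQubit.PolyBounded fun n => (p n + 1) * (w n + 1) + 2 :=
    hp.add_mul hw 2 fun n => by
      push_cast
      ring
  refine ⟨_, hq, _, hQ.combine hp T, ⟨_, hw', fun n => one_le, fun x => ?_⟩,
    fun x hx => ?_, fun x hx => ?_⟩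
  · simp [CleanQubit.Setup.circuit, CleanQubit.Setup.width, hQw]
  · have h := hyes x hx
    obtain ⟨-, h', -⟩ := hbound x
    refine le_trans ?_ h'
    rw [hpow, PNat.one_coe] at h
    beta_reduce
    rw [hpow, hpow]
    have h₁ : (2⁻¹ : ℝ) ^ (((r x.length + 1) * (p x.length + 1) : ℕ+) : ℕ) =
        (2⁻¹ ^ (r x.length : ℕ) / 2) ^ ((p x.length : ℕ) + 1) := by
      rw [div_eq_mul_inv, ← pow_succ, ← pow_mul]
      push_cast
      rfl
    have h₂ : (0 : ℝ) < 2⁻¹ ^ (p x.length : ℕ) := by positivity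
    -- The amplified probability is at least $2^{-q}$ itself; the factor $1-2^{-p}\le 1$ is slack.
    calc _ ≤ (2⁻¹ : ℝ) ^ (((r x.length + 1) * (p x.length + 1) : ℕ+) : ℕ) :=
          mul_le_of_le_one_right (by positivity) (by linarith)
      _ ≤ _ := by
          rw [h₁]
          gcongr
  · have h := hno x hx
    obtain ⟨h₀, -, h'⟩ := hbound x
    refine le_trans h' ?_
    rw [hpow, PNat.one_coe] at h
    beta_reduce
    rw [hpow, hpow]
    -- $2\cdot 2^{-(r+2)(p+1)}=2^{-(r+1)(p+1)}\cdot 2\cdot 2^{-(p+1)}$: using $p+1$ copies rather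
    -- than $p$ absorbs the factor $2$ of the upper bound.
    have h₁ : (2⁻¹ : ℝ) ^ (((r x.length + 1) * (p x.length + 1) : ℕ+) : ℕ) *
        2⁻¹ ^ (p x.length : ℕ) =
        2 * (2⁻¹ ^ ((r x.length + 1 : ℕ+) : ℕ) / 2) ^ ((p x.length : ℕ) + 1) := by
      rw [div_eq_mul_inv, mul_pow, ← pow_mul, pow_succ _ (p x.length : ℕ)]
      push_cast
      ring
    rw [h₁]
    gcongr
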